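/- Write $\sigma_1=\begin{pmatrix}0&1\\1&0\end{pmatrix}$, $\sigma_2=\begin{pmatrix}0&-\mathrm i\\ \mathrm i&0\end{pmatrix}$, $\sigma_3=\begin{pmatrix}1&0\\0&-1\end{pmatrix}$ and $$\hat p(y,t,\mu)=-\frac{\mathrm i(\mu^2-1)}{4\mu}\Bigl(-y+\frac{8\mu^2}{(\mu^2+1)^2}\,t\Bigr).$$ **Riemann–Hilbert problem.** Let $\Gamma\subset\mathbb C$ be a contour (closed, covered in each disk by finitely many rectifiable arcs), invariant under $\mu\mapsto\bar\mu,\ -\mu,\ 1/\mu$, with finitely many nodes (self-intersections, end points). Let $\mathbb C\setminus\Gamma=D_1\cup D_2$ with $D_1,D_2$ open, disjoint, both with boundary $\Gamma$; let $+$, $-$ denote boundary values from $D_1$, $D_2$. Let $J_0(\mu)$ be a $2\times2$ matrix function on $\Gamma$ with $\det J_0=1$, $J_0(\mu)=I+O(1/\mu)$ as $\mu\to\infty$ and, if $\mathrm i\in\Gamma$, $J_0(\mu)=I+O(\mu-\mathrm i)$ as $\mu\to \mathrm i$. Let $\{\mu_j\}\subset D_1\setminus\{\pm\mathrm i\}$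 be a finite set with $\{\bar\mu_j\}\subset D_2$, symmetric under $\mu\mapsto-1/\mu$ and $\mu\mapsto-\bar\mu$, let $c_j=c_{\mu_j}\in\mathbb C$ satisfy $c_{-1/\mu_j}=-\mu_j^{-2}c_{\mu_j}$ and $c_{-\bar\mu_j}=\overline{c_{\mu_j}}$, and let $c\in\mathbb C$ be a constant. Let $\Omega\subset\mathbb R^2$ be open. For $(y,t)\in\Omega$ let $\hat M(y,t,\mu)$ be a $2\times 2$ matrix whose first (second) column is analytic in $\mu$ off $\Gamma$, $\pm1$ and the $\mu_j$ (the $\bar\mu_j$), such that: * $\hat M_+=\hat M_-\,\mathrm e^{-\hat p\sigma_3}J_0\,\mathrm e^{\hat p\sigma_3}$ on $\Gamma$, off the nodes and the points $0,\pm1,\pm\mathrm i$; $\hat M$ is bounded near $\pm \mathrm i$ and near the nodes other than $0,\pm1$; * $\hat M=I+O(1/\mu)$ as $\mu\to\infty$; * $\hat M(\bar\mu)=\sigma_1\overline{\hat M(\mu)}\sigma_1$, $\hat M(-\mu)=\sigma_2\hat M(\mu)\sigma_2$, $\hat M(\mu^{-1})=\sigma_1\hat M(\mu)\sigma_1$;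 * for some real function $\alpha_+(y,t)$, as $\mu\to\pm1$ with $\operatorname{Im}\mu>0$, $$\hat M=\frac{\mathrm i\alpha_+}{2(\mu-1)}\begin{pmatrix}-c&1\\-c&1\end{pmatrix}+O(1)\ (\mu\to1),\qquad \hat M=-\frac{\mathrm i\alpha_+}{2(\mu+1)}\begin{pmatrix}c&1\\-c&-1\end{pmatrix}+O(1)\ (\mu\to-1);$$ * $\operatorname{Res}_{\mu_j}\hat M^{(1)}=c_j\mathrm e^{2\hat p(y,t,\mu_j)}\hat M^{(2)}(y,t,\mu_j)$ and $\operatorname{Res}_{\bar\mu_j}\hat M^{(2)}=\bar c_j\mathrm e^{-2\hat p(y,t,\bar\mu_j)}\hat M^{(1)}(y,t,\bar\mu_j)$. $\hat M$ is assumed differentiable with respect to $y$ and $t$, in the sense that $\hat M_y,\hat M_t,\alpha_{+y},\alpha_{+t}$ exist, $\hat M_y$ and $\hat M_t$ are analytic in $\mu$ where $\hat M$ is, and all the above limit relations and $O$-estimates in $\mu$ may be differentiated in $y$ and in $t$. Put $\hat\Psi=\hat M\mathrm e^{-\hat p\sigma_3}$. The equations below are asserted at every $(y,t)\in\Omega$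 and every $\mu\notin\Gamma\cup\{\mu_j\}\cup\{\bar\mu_j\}\cup\{0,\pm1,\pm\mathrm i\}$. **(1)** If $\hat M=I+\frac1\mu M_1+O(\mu^{-2})$ as $\mu\to\infty$ at $(y,t)\in\Omega$, then $M_1=\begin{pmatrix}\xi&\eta_2\\ \eta_2&-\xi\end{pmatrix}$ for some $\xi,\eta_2$, and at $(y,t)$, with $f=-\eta_2/2$, $$\hat\Psi_y=\Bigl[-\tfrac{\mathrm i(\mu^2-1)}{4\mu}\sigma_3+\tfrac{\mathrm if}{\mu-1}\begin{pmatrix}1&-1\\1&-1\end{pmatrix}+\tfrac{\mathrm if}{\mu+1}\begin{pmatrix}1&1\\-1&-1\end{pmatrix}+\mathrm if\begin{pmatrix}0&-1\\1&0\end{pmatrix}\Bigr]\hat\Psi .$$ **(2)** If $\hat M=A_0+A_1(\mu-\mathrm i)+O((\mu-\mathrm i)^2)$ as $\mu\to\mathrm i$ at $(y,t)\in\Omega$, then $A_0=\begin{pmatrix}a_1&0\\0&a_1^{-1}\end{pmatrix}$ with $a_1\ne0$ and $A_1=\begin{pmatrix}0&a_2\\a_3&0\end{pmatrix}$. If moreover,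 on $\Omega$, $$\hat M=-\frac{\mathrm i\alpha_+}{2(\mu+1)}\begin{pmatrix}c&1\\-c&-1\end{pmatrix}+\begin{pmatrix}n&m\\ f&g\end{pmatrix}+O(\mu+1),\qquad \mu\to-1,\ \operatorname{Im}\mu>0,$$ where $n,m,f,g$ are functions of $(y,t)$ with partial derivatives in $y$ and $t$ and the relation may be differentiated in $y$ and $t$, then at $(y,t)$ $$\hat\Psi_t=\Bigl[\tfrac{2\mathrm i(\mu^2-1)\mu}{(\mu^2+1)^2}\sigma_3+\tfrac{\mathrm i\beta_2}{\mu-1}\begin{pmatrix}1&-1\\1&-1\end{pmatrix}+\tfrac{\mathrm i\beta_2}{\mu+1}\begin{pmatrix}1&1\\-1&-1\end{pmatrix}+\tfrac1{\mu-\mathrm i}\begin{pmatrix}0&\gamma_1\\ \gamma_2&0\end{pmatrix}+\tfrac1{\mu+\mathrm i}\begin{pmatrix}0&\gamma_2\\ \gamma_1&0\end{pmatrix}\Bigr]\hat\Psi$$ with $$\gamma_1=2a_2a_1,\qquad \gamma_2=-2a_3a_1^{-1},\qquad \beta_2=\tfrac12\bigl(\alpha_{+t}(f-cg)-\alpha_+(f_t-cg_t)+c\,\alpha_+^2\bigr).$$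 -/

import Mathlib

open Complex Filter Topology Asymptotics Matrix

namespace MCH

noncomputable section

/-- The complex `2 × 2` matrices. -/
abbrev Mat := Matrix (Fin 2) (Fin 2) ℂ

def pauli1 : Mat := !![0, 1; 1, 0]

def pauli2 : Mat := !![0, -I; I, 0]

def pauli3 : Mat := !![1, 0; 0, -1]

/-- `exp (z σ₃) = diag (exp z, exp (-z))`. -/
def expPauli3 (z : ℂ) : Mat := !![exp z, 0; 0, exp (-z)]

/-- The phase `p̂(y,t,μ) = -(i(μ²-1)/(4μ)) (-y + 8μ²/(μ²+1)² t)`; it is only used away from its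
singular points `μ = 0` and `μ = ± i`. -/
def phase (y t : ℝ) (μ : ℂ) : ℂ :=
  -(I * (μ ^ 2 - 1) / (4 * μ)) * (-(y : ℂ) + 8 * μ ^ 2 / (μ ^ 2 + 1) ^ 2 * (t : ℂ))

/-! ### Scalar families `F(y,t,μ)` and asymptotics that may be differentiated in `y` and `t` -/

/-- `∂F/∂y`. -/
def dY (F : ℝ → ℝ → ℂ → ℂ) (y t : ℝ) (μ : ℂ) : ℂ := deriv (fun s => F s t μ) y

/-- `∂F/∂t`. -/
def dT (F : ℝ → ℝ → ℂ → ℂ) (y t : ℝ) (μ : ℂ) : ℂ := deriv (fun s => F y s μ) t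

/-- The function `B(y,t)` has both partial derivatives at every point of `Ω`. -/
def PartialDiff {E : Type*} [NormedAddCommGroup E] [NormedSpace ℝ E]
    (Ω : Set (ℝ × ℝ)) (B : ℝ → ℝ → E) : Prop :=
  ∀ y t, (y, t) ∈ Ω →
    DifferentiableAt ℝ (fun s => B s t) y ∧ DifferentiableAt ℝ (fun s => B y s) t

/-- For every `(y,t) ∈ Ω`, `F(y,t,μ)` tends to `B(y,t)` along the filter `l` in the variable `μ`,
and this relation may be differentiated with respect to `y` and to `t`. -/
def TendstoC1 (Ω : Set (ℝ × ℝ)) (F : ℝ → ℝ → ℂ → ℂ) (l : Filter ℂ) (B : ℝ → ℝ → ℂ) : Prop :=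
  PartialDiff Ω B ∧ ∀ y t, (y, t) ∈ Ω →
    Tendsto (F y t) l (𝓝 (B y t)) ∧
    Tendsto (dY F y t) l (𝓝 (deriv (fun s => B s t) y)) ∧
    Tendsto (dT F y t) l (𝓝 (deriv (fun s => B y s) t))

/-- For every `(y,t) ∈ Ω`, `F(y,t,μ) = O(g(μ))` along the filter `l` in the variable `μ`,
and this relation may be differentiated with respect to `y` and to `t`. -/
def IsBigOC1 (Ω : Set (ℝ × ℝ)) (F : ℝ → ℝ → ℂ → ℂ) (l : Filter ℂ) (g : ℂ → ℂ) : Prop :=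
  ∀ y t, (y, t) ∈ Ω → F y t =O[l] g ∧ dY F y t =O[l] g ∧ dT F y t =O[l] g

/-! ### The data of the Riemann-Hilbert problem -/

/-- A closed subset of the plane which, in every disk, is covered by finitely many rectifiable
(Lipschitz parametrized) arcs. -/
def IsContour (Γ : Set ℂ) : Prop :=
  IsClosed Γ ∧ ∀ R : ℝ, ∃ (n : ℕ) (γ : Fin n → ℝ → ℂ) (K : NNReal),
    (∀ k, LipschitzOnWith K (γ k) (Set.Icc 0 1)) ∧
    Γ ∩ Metric.closedBall 0 R ⊆ ⋃ k, γ k '' Set.Icc 0 1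

/-- The data `(Γ, D₁, D₂, J₀, {μ_j}, {c_j}, c)` of the Riemann-Hilbert problem. -/
structure RHData where
  /-- the contour -/
  Γ : Set ℂ
  /-- the part of the complement of `Γ` on the `+` side (the left side) of `Γ` -/
  D₁ : Set ℂ
  /-- the part of the complement of `Γ` on the `-` side (the right side) of `Γ` -/
  D₂ : Set ℂ
  /-- the finitely many points of self-intersection and end points of arcs of `Γ` -/
  nodes : Finset ℂ
  /-- the jump matrix, before conjugation by the exponentials -/
  J₀ : ℂ → Mat
  /-- the poles `μ_j` of the first column -/
  poles : Finset ℂ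
  /-- the residue coefficients: `c_j = coef μ_j` -/
  coef : ℂ → ℂ
  /-- the constant in the conditions at `± 1` -/
  c : ℂ
  contour : IsContour Γ
  conj_mem : ∀ μ, μ ∈ Γ → (starRingEnd ℂ) μ ∈ Γ
  neg_mem : ∀ μ, μ ∈ Γ → -μ ∈ Γ
  inv_mem : ∀ μ, μ ∈ Γ → μ ≠ 0 → μ⁻¹ ∈ Γ
  open₁ : IsOpen D₁
  open₂ : IsOpen D₂
  disj : Disjoint D₁ D₂
  union : D₁ ∪ D₂ = Γᶜ
  frontier₁ : frontier D₁ = Γ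
  frontier₂ : frontier D₂ = Γ
  nodes_subset : ∀ ζ ∈ nodes, ζ ∈ Γ
  det_J₀ : ∀ μ ∈ Γ, μ ∉ nodes → μ ≠ 1 → μ ≠ -1 → (J₀ μ).det = 1
  J₀_infty : ∀ i j, (fun μ => J₀ μ i j - (1 : Mat) i j)
    =O[Bornology.cobounded ℂ ⊓ 𝓟 Γ] (fun μ => μ⁻¹)
  J₀_I : I ∈ Γ → ∀ i j, (fun μ => J₀ μ i j - (1 : Mat) i j) =O[𝓝[Γ \ {I}] I] (fun μ => μ - I)
  poles_mem : ∀ μ ∈ poles, μ ∈ D₁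
  conj_poles_mem : ∀ μ ∈ poles, (starRingEnd ℂ) μ ∈ D₂
  I_not_pole : I ∉ poles
  neg_I_not_pole : -I ∉ poles
  poles_inv : ∀ μ ∈ poles, -μ⁻¹ ∈ poles ∧ coef (-μ⁻¹) = -(μ ^ 2)⁻¹ * coef μ
  poles_conj : ∀ μ ∈ poles,
    -(starRingEnd ℂ) μ ∈ poles ∧ coef (-(starRingEnd ℂ) μ) = (starRingEnd ℂ) (coef μ)

namespace RHData

/-- The points at which the `j`-th column is required to be analytic: those off `Γ`, distinct from
`± 1` and not among the `μ_j` (first column), respectively the conjugates of the `μ_j`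
(second column). -/
def dom (d : RHData) (j : Fin 2) : Set ℂ :=
  {μ | μ ∉ d.Γ ∧ μ ≠ 1 ∧ μ ≠ -1 ∧ (j = 0 → μ ∉ d.poles) ∧
    (j = 1 → (starRingEnd ℂ) μ ∉ d.poles)}

/-- The points at which both columns are required to be analytic. -/
def regular (d : RHData) : Set ℂ := d.dom 0 ∩ d.dom 1

/-- The points of `Γ` at which boundary values are considered. -/
def jumpSet (d : RHData) : Set ℂ :=
  {μ | μ ∈ d.Γ ∧ μ ∉ d.nodes ∧ μ ≠ 0 ∧ μ ≠ 1 ∧ μ ≠ -1 ∧ μ ≠ I ∧ μ ≠ -I}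

/-- `J(y,t,μ) = exp (-p̂ σ₃) J₀(μ) exp (p̂ σ₃)`. -/
def J (d : RHData) (y t : ℝ) (μ : ℂ) : Mat :=
  expPauli3 (-phase y t μ) * d.J₀ μ * expPauli3 (phase y t μ)

/-- `μ → ∞` off `Γ`. -/
def atInfty (d : RHData) : Filter ℂ := Bornology.cobounded ℂ ⊓ 𝓟 d.Γᶜ

/-- `μ → ζ` in the open upper half plane, off `Γ`. -/
def upper (d : RHData) (ζ : ℂ) : Filter ℂ := 𝓝[{μ | 0 < μ.im} \ d.Γ] ζ

/-- The coefficient of `1 / (μ - 1)`, for `μ → 1` in the upper half plane. -/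
def singOne (d : RHData) (α : ℝ) : Mat :=
  (I * (α : ℂ) / 2) • (!![-d.c, 1; -d.c, 1] : Mat)

/-- The coefficient of `1 / (μ + 1)`, for `μ → -1` in the upper half plane. -/
def singNegOne (d : RHData) (α : ℝ) : Mat :=
  (-(I * (α : ℂ) / 2)) • (!![d.c, 1; -d.c, -1] : Mat)

/-- `M(y,t,μ)`, `(y,t) ∈ Ω`, is a solution of the Riemann-Hilbert problem with data `d` and with
real coefficient `α(y,t)` in the conditions at `± 1`. It is differentiable with respect to `y` and
`t`, in the sense that the conditions in the variable `μ` may be differentiated in `y` and `t`. -/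
structure IsSolution (d : RHData) (Ω : Set (ℝ × ℝ)) (α : ℝ → ℝ → ℝ) (M : ℝ → ℝ → ℂ → Mat) :
    Prop where
  diff_param : ∀ i j, ∀ μ ∈ d.dom j, PartialDiff Ω (fun y t => M y t μ i j)
  analytic : ∀ y t, (y, t) ∈ Ω → ∀ i j,
    DifferentiableOn ℂ (fun μ => M y t μ i j) (d.dom j) ∧
    DifferentiableOn ℂ (dY (fun y t μ => M y t μ i j) y t) (d.dom j) ∧
    DifferentiableOn ℂ (dT (fun y t μ => M y t μ i j) y t) (d.dom j)
  jump : ∀ μ₀ ∈ d.jumpSet, ∃ Mp Mm : ℝ → ℝ → Mat,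
    (∀ i j, TendstoC1 Ω (fun y t μ => M y t μ i j) (𝓝[d.D₁] μ₀) (fun y t => Mp y t i j)) ∧
    (∀ i j, TendstoC1 Ω (fun y t μ => M y t μ i j) (𝓝[d.D₂] μ₀) (fun y t => Mm y t i j)) ∧
    ∀ y t, (y, t) ∈ Ω → Mp y t = Mm y t * d.J y t μ₀
  bounded : ∀ ζ : ℂ, (ζ ∈ d.nodes ∨ ζ = I ∨ ζ = -I) → ζ ≠ 0 → ζ ≠ 1 → ζ ≠ -1 →
    ∀ i j, IsBigOC1 Ω (fun y t μ => M y t μ i j) (𝓝[d.Γᶜ] ζ) (fun _ => 1)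
  normalized : ∀ i j,
    IsBigOC1 Ω (fun y t μ => M y t μ i j - (1 : Mat) i j) d.atInfty (fun μ => μ⁻¹)
  symm_conj : ∀ y t, (y, t) ∈ Ω → ∀ μ ∈ d.regular,
    M y t ((starRingEnd ℂ) μ) = pauli1 * (M y t μ).map (starRingEnd ℂ) * pauli1
  symm_neg : ∀ y t, (y, t) ∈ Ω → ∀ μ ∈ d.regular,
    M y t (-μ) = pauli2 * M y t μ * pauli2
  symm_inv : ∀ y t, (y, t) ∈ Ω → ∀ μ ∈ d.regular, μ ≠ 0 →
    M y t μ⁻¹ = pauli1 * M y t μ * pauli1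
  diff_α : PartialDiff Ω α
  sing_one : ∀ i j,
    IsBigOC1 Ω (fun y t μ => M y t μ i j - d.singOne (α y t) i j / (μ - 1))
      (d.upper 1) (fun _ => 1)
  sing_neg_one : ∀ i j,
    IsBigOC1 Ω (fun y t μ => M y t μ i j - d.singNegOne (α y t) i j / (μ + 1))
      (d.upper (-1)) (fun _ => 1)
  residue₁ : ∀ μ₀ ∈ d.poles, ∀ i,
    TendstoC1 Ω (fun y t μ => (μ - μ₀) * M y t μ i 0) (𝓝[≠] μ₀)
      (fun y t => d.coef μ₀ * exp (2 * phase y t μ₀) * M y t μ₀ i 1)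
  residue₂ : ∀ μ₀ ∈ d.poles, ∀ i,
    TendstoC1 Ω (fun y t μ => (μ - (starRingEnd ℂ) μ₀) * M y t μ i 1)
      (𝓝[≠] ((starRingEnd ℂ) μ₀))
      (fun y t => (starRingEnd ℂ) (d.coef μ₀) *
        exp (-(2 * phase y t ((starRingEnd ℂ) μ₀))) * M y t ((starRingEnd ℂ) μ₀) i 0)

/-- The values of `μ` at which the differential equations are asserted: the points at which
`M` and the phase are regular. -/
def spectralSet (d : RHData) : Set ℂ := {μ | μ ∈ d.regular ∧ μ ≠ 0 ∧ μ ≠ I ∧ μ ≠ -I}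

end RHData

/-! ### The Lax pair -/

/-- `Ψ̂ = M̂ exp (-p̂ σ₃)`. -/
def psi (M : ℝ → ℝ → ℂ → Mat) (y t : ℝ) (μ : ℂ) : Mat :=
  M y t μ * expPauli3 (-phase y t μ)

/-- The coefficient matrix of the `y`-equation. -/
def laxU (f μ : ℂ) : Mat :=
  (-(I * (μ ^ 2 - 1) / (4 * μ))) • pauli3
    + (I * f / (μ - 1)) • (!![1, -1; 1, -1] : Mat)
    + (I * f / (μ + 1)) • (!![1, 1; -1, -1] : Mat)
    + (I * f) • (!![0, -1; 1, 0] : Mat)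

/-- The coefficient matrix of the `t`-equation. -/
def laxV (g₀ g₁ g₂ μ : ℂ) : Mat :=
  (2 * I * (μ ^ 2 - 1) * μ / (μ ^ 2 + 1) ^ 2) • pauli3
    + (I * g₀ / (μ - 1)) • (!![1, -1; 1, -1] : Mat)
    + (I * g₀ / (μ + 1)) • (!![1, 1; -1, -1] : Mat)
    + (1 / (μ - I)) • (!![0, g₁; g₂, 0] : Mat)
    + (1 / (μ + I)) • (!![0, g₂; g₁, 0] : Mat)

/-- `β₂ = ½ (α_t (f - c g) - α (f_t - c g_t) + c α²)`, where `(f, g)` is the second row of the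
constant term `B` of the expansion at `μ = -1` in the upper half plane. -/
def beta2 (c : ℂ) (α : ℝ → ℝ → ℝ) (B : ℝ → ℝ → Mat) (y t : ℝ) : ℂ :=
  1 / 2 * (((deriv (fun s => α y s) t : ℝ) : ℂ) * (B y t 1 0 - c * B y t 1 1)
    - (α y t : ℂ) * (deriv (fun s => B y s 1 0) t - c * deriv (fun s => B y s 1 1) t)
    + c * (α y t : ℂ) ^ 2)

end

end MCH

/-!
Let `p` be the phase, `N = M(y,t,·)`, and let `N'` and `q'` be the derivatives of `M` and `p` with
respect to `y` or to `t`. Then `Ψ' Ψ⁻¹ = W N⁻¹` with `W = N' - q' N σ₃`. Differentiating the jump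
and residue relations of `M` in the parameter shows that the rows of `W` satisfy the same relations
as the rows of `N` (`IsVariation.isFrame`). As these relations are linear with a matrix of
determinant one, each Wronskian `x₀ z₁ - x₁ z₀` of two such rows extends continuously across the
contour and has no singularities at the poles `μ_j` and their conjugates (`IsRow`). Because
`det N = 1` (`IsSolution.det_eq_one`), the entries of `W N⁻¹` are, up to sign, Wronskians of rows of `W`
and `N`, called brackets below.

A continuous function which is holomorphic off a contour is holomorphic, since the contour, being
locally a union of finitely many Lipschitz arcs, is met by only `O(n)` cells of an `n × n` grid, so
that integrals over small rectangles add up to `o(1)`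
(`IsContour.differentiableOn_of_continuousOn`). With Liouville's theorem, a function without jump
is therefore a sum of principal parts (`IsContour.exists_eq_sum_div_sub`), here at `0`, `± 1` and
`± i` only.

It remains to find these principal parts. Those at `0`, `∞` and `± i` are read off from `q'` and
from the expansions of `M`. At `1`, the singularities of `N` and of `W` are multiples of one fixed
matrix with both rows equal to `(-c, 1)`; hence the brackets have at most simple poles there, whose
residues satisfy a linear relation. Together with the symmetries `μ ↦ -μ` and `μ ↦ μ⁻¹` this leaves
a single number `κ` for the poles at `± 1`, and the symmetries also tie `κ` to the other principal
parts (`IsFrame.bracket_eq`). In the `y`-equation `κ` is given by `M₁`. In the `t`-equation it is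
given by the expansion at `i`, and comparison with the principal part at `-1` shows that `κ = i β₂`
(`IsSolution.coeff_eq_beta2`).
-/

namespace MCH

open scoped Interval

/-! ### Removability of contours for continuous functions -/

/-- The integral of `f` over the boundary of the rectangle `[x₁, x₂] × [y₁, y₂]`. -/
noncomputable def rectIntegral (f : ℂ → ℂ) (x₁ x₂ y₁ y₂ : ℝ) : ℂ :=
  (∫ x : ℝ in x₁..x₂, f (x + y₁ * I)) - (∫ x : ℝ in x₁..x₂, f (x + y₂ * I)) +
    I * (∫ y : ℝ in y₁..y₂, f (x₂ + y * I)) - I * ∫ y : ℝ in y₁..y₂, f (x₁ + y * I)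

theorem sum_rectIntegral_grid (f : ℂ → ℂ) (u v : ℕ → ℝ) (n : ℕ)
    (hx : ∀ i < n, ∀ j ≤ n,
      IntervalIntegrable (fun x : ℝ => f (x + v j * I)) MeasureTheory.volume (u i) (u (i + 1)))
    (hy : ∀ j < n, ∀ i ≤ n,
      IntervalIntegrable (fun y : ℝ => f (u i + y * I)) MeasureTheory.volume (v j) (v (j + 1))) :
    ∑ i ∈ Finset.range n, ∑ j ∈ Finset.range n, rectIntegral f (u i) (u (i + 1)) (v j) (v (j + 1))
      = rectIntegral f (u 0) (u n) (v 0) (v n) := by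
  set H : ℕ → ℕ → ℂ := fun i j => ∫ x : ℝ in (u i)..(u (i + 1)), f (x + v j * I) with hH
  set V : ℕ → ℕ → ℂ := fun i j => ∫ y : ℝ in (v j)..(v (j + 1)), f (u i + y * I) with hV
  have hHs : ∀ j ≤ n, ∑ i ∈ Finset.range n, H i j = ∫ x : ℝ in (u 0)..(u n), f (x + v j * I) :=
    fun j hj => intervalIntegral.sum_integral_adjacent_intervals fun i hi => hx i hi j hj
  have hVs : ∀ i ≤ n, ∑ j ∈ Finset.range n, V i j = ∫ y : ℝ in (v 0)..(v n), f (u i + y * I) :=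
    fun i hi => intervalIntegral.sum_integral_adjacent_intervals fun j hj => hy j hj i hi
  have h1 : ∀ i j, rectIntegral f (u i) (u (i + 1)) (v j) (v (j + 1))
      = (H i j - H i (j + 1)) + I * (V (i + 1) j - V i j) := by
    intro i j
    simp only [rectIntegral, hH, hV]
    ring
  simp only [h1, Finset.sum_add_distrib]
  rw [Finset.sum_comm (f := fun i j => I * (V (i + 1) j - V i j))]
  have h2 : ∀ j, ∑ i ∈ Finset.range n, (V (i + 1) j - V i j) = V n j - V 0 j :=
    fun j => Finset.sum_range_sub (fun i => V i j) n
  have h3 : ∀ i, ∑ j ∈ Finset.range n, (H i j - H i (j + 1)) = H i 0 - H i n :=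
    fun i => Finset.sum_range_sub' (fun j => H i j) n
  simp only [← Finset.mul_sum, h2, h3]
  rw [Finset.sum_sub_distrib, Finset.sum_sub_distrib]
  rw [hHs 0 (Nat.zero_le _), hHs n le_rfl, hVs 0 (Nat.zero_le _), hVs n le_rfl, rectIntegral]
  ring

theorem intervalIntegrable_horizontal {f : ℂ → ℂ} {x₁ x₂ y₁ y₂ y a b : ℝ}
    (hf : ContinuousOn f ([[x₁, x₂]] ×ℂ [[y₁, y₂]])) (hab : Set.uIcc a b ⊆ Set.uIcc x₁ x₂)
    (hy : y ∈ Set.uIcc y₁ y₂) :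
    IntervalIntegrable (fun x : ℝ => f (x + y * I)) MeasureTheory.volume a b := by
  refine ContinuousOn.intervalIntegrable (hf.comp (by fun_prop) fun x hx => ?_)
  simpa [mem_reProdIm] using ⟨hab hx, hy⟩

theorem intervalIntegrable_vertical {f : ℂ → ℂ} {x₁ x₂ y₁ y₂ x a b : ℝ}
    (hf : ContinuousOn f ([[x₁, x₂]] ×ℂ [[y₁, y₂]])) (hab : Set.uIcc a b ⊆ Set.uIcc y₁ y₂)
    (hx : x ∈ Set.uIcc x₁ x₂) :
    IntervalIntegrable (fun y : ℝ => f (x + y * I)) MeasureTheory.volume a b := by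
  refine ContinuousOn.intervalIntegrable (hf.comp (by fun_prop) fun y hy => ?_)
  simpa [mem_reProdIm] using ⟨hx, hab hy⟩

theorem norm_rectIntegral_le {f : ℂ → ℂ} {x₁ x₂ y₁ y₂ ε : ℝ}
    (hf : ContinuousOn f ([[x₁, x₂]] ×ℂ [[y₁, y₂]]))
    (hε : ∀ z ∈ [[x₁, x₂]] ×ℂ [[y₁, y₂]], ∀ w ∈ [[x₁, x₂]] ×ℂ [[y₁, y₂]],
      (z.re = w.re ∨ z.im = w.im) → ‖f z - f w‖ ≤ ε) :
    ‖rectIntegral f x₁ x₂ y₁ y₂‖ ≤ ε * (|x₂ - x₁| + |y₂ - y₁|) := by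
  have e : rectIntegral f x₁ x₂ y₁ y₂ = (∫ x : ℝ in x₁..x₂, (f (x + y₁ * I) - f (x + y₂ * I))) +
      I * ∫ y : ℝ in y₁..y₂, (f (x₂ + y * I) - f (x₁ + y * I)) := by
    rw [intervalIntegral.integral_sub, intervalIntegral.integral_sub, rectIntegral]
    · ring
    · exact intervalIntegrable_vertical hf subset_rfl Set.right_mem_uIcc
    · exact intervalIntegrable_vertical hf subset_rfl Set.left_mem_uIcc
    · exact intervalIntegrable_horizontal hf subset_rfl Set.left_mem_uIcc
    · exact intervalIntegrable_horizontal hf subset_rfl Set.right_mem_uIcc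
  rw [e, mul_add]
  refine (norm_add_le _ _).trans (add_le_add ?_ ?_)
  · refine intervalIntegral.norm_integral_le_of_norm_le_const fun x hx => ?_
    have hx' := Set.uIoc_subset_uIcc hx
    exact hε _ (by simpa [mem_reProdIm] using hx') _ (by simpa [mem_reProdIm] using hx')
      (by simp)
  · rw [norm_mul, norm_I, one_mul]
    refine intervalIntegral.norm_integral_le_of_norm_le_const fun x hx => ?_
    have hx' := Set.uIoc_subset_uIcc hx
    exact hε _ (by simpa [mem_reProdIm] using hx') _ (by simpa [mem_reProdIm] using hx')
      (by simp)

theorem rectIntegral_eq_zero_of_differentiableOn {f : ℂ → ℂ} {x₁ x₂ y₁ y₂ : ℝ}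
    (hf : DifferentiableOn ℂ f ([[x₁, x₂]] ×ℂ [[y₁, y₂]])) : rectIntegral f x₁ x₂ y₁ y₂ = 0 := by
  simpa [rectIntegral] using
    Complex.integral_boundary_rect_eq_zero_of_differentiableOn f ⟨x₁, y₁⟩ ⟨x₂, y₂⟩ hf

/-- An interval of length `2 b` contains at most `2 b + 1` integers. -/
theorem card_filter_abs_sub_le (n : ℕ) (a b : ℝ) (hb : 0 ≤ b) :
    (((Finset.range n).filter fun i : ℕ => |a - i| ≤ b).card : ℝ) ≤ 2 * b + 1 := by
  have h : ((Finset.range n).filter fun i : ℕ => |a - i| ≤ b).card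
      ≤ (Finset.Icc ⌈a - b⌉ ⌊a + b⌋).card := by
    refine Finset.card_le_card_of_injOn (fun i => (i : ℤ)) (fun i hi => ?_)
      (fun i _ j _ h => by simpa using h)
    have hi' := (Finset.mem_filter.1 hi).2
    rw [abs_le] at hi'
    simp only [Finset.coe_Icc, Set.mem_Icc, Int.ceil_le, Int.le_floor, Int.cast_natCast]
    constructor <;> linarith
  rw [Int.card_Icc] at h
  have h2 : (((⌊a + b⌋ + 1 - ⌈a - b⌉).toNat : ℤ) : ℝ) ≤ 2 * b + 1 := by
    rw [Int.toNat_eq_max]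
    push_cast
    refine max_le ?_ (by linarith)
    linarith [Int.floor_le (a + b), Int.le_ceil (a - b)]
  calc _ ≤ (((⌊a + b⌋ + 1 - ⌈a - b⌉).toNat : ℕ) : ℝ) := by exact_mod_cast h
    _ ≤ _ := by exact_mod_cast h2

theorem abs_sub_index_le {x a q δ : ℝ} {n i : ℕ} (ha : a ≠ 0) (hn : 0 < n) {p : ℝ}
    (hp : p ∈ Set.uIcc (x + i * (a / n)) (x + (i + 1 : ℕ) * (a / n))) (hq : |q - p| ≤ δ / n) :
    |(q - x) * n / a - i| ≤ δ / |a| + 1 := by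
  have hn' : (0 : ℝ) < n := by exact_mod_cast hn
  have ha' : 0 < |a| := abs_pos.2 ha
  have h1 := Set.abs_sub_left_of_mem_uIcc hp
  have h2 : x + ((i + 1 : ℕ) : ℝ) * (a / n) - (x + i * (a / n)) = a / n := by push_cast; ring
  rw [h2, abs_div, abs_of_pos hn'] at h1
  have h3 : (q - x) * n / a - i = ((q - p) + (p - (x + i * (a / n)))) * (n / a) := by
    field_simp
    ring
  rw [h3, abs_mul, abs_div, abs_of_pos hn']
  calc _ ≤ (δ / n + |a| / n) * (n / |a|) := by
        gcongr
        exact (abs_add_le _ _).trans (add_le_add hq h1)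
    _ = _ := by field_simp

theorem add_mul_div_mem_uIcc (z c : ℝ) {n k : ℕ} (hn : 0 < n) (hk : k ≤ n) :
    z + k * (c / n) ∈ Set.uIcc z (z + c) := by
  have hn' : (0 : ℝ) < n := by exact_mod_cast hn
  have hk' : (k : ℝ) / n ≤ 1 := (div_le_one hn').2 (by exact_mod_cast hk)
  have hk0 : (0 : ℝ) ≤ (k : ℝ) / n := by positivity
  have e : z + k * (c / n) = z + (k / n : ℝ) * c := by ring
  rw [e, Set.mem_uIcc]
  rcases le_total 0 c with hc | hc
  · left; constructor <;> nlinarith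
  · right; constructor <;> nlinarith

theorem uIcc_cell_subset (z c : ℝ) {n i : ℕ} (hi : i < n) :
    Set.uIcc (z + i * (c / n)) (z + (i + 1 : ℕ) * (c / n)) ⊆ Set.uIcc z (z + c) :=
  Set.uIcc_subset_uIcc (add_mul_div_mem_uIcc z c (by omega) hi.le)
    (add_mul_div_mem_uIcc z c (by omega) hi)

/-- A contour meets at most `O(n)` of the `n²` cells of a regular `n × n` subdivision of a
rectangle, since each of its arcs splits into `n + 1` pieces of diameter `O(1 / n)`. -/
theorem IsContour.exists_card_cells_le {Γ : Set ℂ} (hΓ : IsContour Γ) {x y a b : ℝ} (ha : a ≠ 0)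
    (hb : b ≠ 0) : ∃ C : ℝ, ∀ n : ℕ, 0 < n → ∃ T : Finset (ℕ × ℕ), (T.card : ℝ) ≤ C * n ∧
      ∀ i < n, ∀ j < n, ([[x + i * (a / n), x + (i + 1 : ℕ) * (a / n)]] ×ℂ
        [[y + j * (b / n), y + (j + 1 : ℕ) * (b / n)]] ∩ Γ).Nonempty → (i, j) ∈ T := by
  obtain ⟨R, hR⟩ := ((Metric.isBounded_iff_subset_closedBall (0 : ℂ)).1
    ((isCompact_uIcc (a := x) (b := x + a)).reProdIm
      (isCompact_uIcc (a := y) (b := y + b))).isBounded)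
  obtain ⟨m, γ, K, hγ, hcov⟩ := hΓ.2 R
  set A : ℝ := 2 * (K / |a| + 1) + 1 with hA
  set B : ℝ := 2 * (K / |b| + 1) + 1 with hB
  refine ⟨m * (2 * (A * B)), fun n hn => ?_⟩
  have hn' : (0 : ℝ) < n := by exact_mod_cast hn
  let S : Fin m → ℕ → Finset (ℕ × ℕ) := fun k l =>
    ((Finset.range n).filter fun i : ℕ =>
      |((γ k (l / n)).re - x) * n / a - i| ≤ K / |a| + 1) ×ˢ
    ((Finset.range n).filter fun j : ℕ =>
      |((γ k (l / n)).im - y) * n / b - j| ≤ K / |b| + 1)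
  have hS : ∀ k l, ((S k l).card : ℝ) ≤ A * B := by
    intro k l
    simp only [S, Finset.card_product, Nat.cast_mul]
    gcongr
    · exact card_filter_abs_sub_le _ _ _ (by positivity)
    · exact card_filter_abs_sub_le _ _ _ (by positivity)
  refine ⟨Finset.univ.biUnion fun k => (Finset.range (n + 1)).biUnion fun l => S k l, ?_, ?_⟩
  · have h1 : ∀ k, (((Finset.range (n + 1)).biUnion fun l => S k l).card : ℝ)
        ≤ (n + 1 : ℕ) * (A * B) := by
      intro k
      calc (((Finset.range (n + 1)).biUnion fun l => S k l).card : ℝ)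
          ≤ ∑ l ∈ Finset.range (n + 1), ((S k l).card : ℝ) := by
            exact_mod_cast Finset.card_biUnion_le
        _ ≤ ∑ l ∈ Finset.range (n + 1), A * B := Finset.sum_le_sum fun l _ => hS k l
        _ = _ := by simp
    calc ((Finset.univ.biUnion fun k => (Finset.range (n + 1)).biUnion fun l => S k l).card : ℝ)
        ≤ ∑ k : Fin m, (((Finset.range (n + 1)).biUnion fun l => S k l).card : ℝ) := by
          exact_mod_cast Finset.card_biUnion_le
      _ ≤ ∑ k : Fin m, (n + 1 : ℕ) * (A * B) := Finset.sum_le_sum fun k _ => h1 k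
      _ = m * ((n + 1 : ℕ) * (A * B)) := by simp
      _ ≤ m * (2 * n * (A * B)) := by
          have : ((n + 1 : ℕ) : ℝ) ≤ 2 * n := by
            push_cast
            have : (1 : ℝ) ≤ n := by exact_mod_cast hn
            linarith
          gcongr
      _ = _ := by ring
  · rintro i hi j hj ⟨p, ⟨hpx, hpy⟩, hpΓ⟩
    have hpR : p ∈ Metric.closedBall (0 : ℂ) R :=
      hR ⟨uIcc_cell_subset x a hi hpx, uIcc_cell_subset y b hj hpy⟩
    obtain ⟨k, τ, hτ, rfl⟩ := Set.mem_iUnion.1 (hcov ⟨hpΓ, hpR⟩)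
    have hfl : (⌊τ * n⌋₊ : ℝ) ≤ τ * n := Nat.floor_le (by have := hτ.1; positivity)
    have hfl2 : τ * n < ⌊τ * n⌋₊ + 1 := Nat.lt_floor_add_one _
    have hln : ⌊τ * n⌋₊ ≤ n := by
      apply Nat.floor_le_of_le
      have := hτ.2
      nlinarith
    have hd : dist (γ k (⌊τ * n⌋₊ / n)) (γ k τ) ≤ K / n := by
      have h1 := (hγ k).dist_le_mul (⌊τ * n⌋₊ / n : ℝ)
        ⟨by positivity, (div_le_one hn').2 (by exact_mod_cast hln)⟩ τ hτ
      refine h1.trans ?_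
      rw [div_eq_mul_one_div (K : ℝ)]
      gcongr
      rw [Real.dist_eq, abs_sub_comm, abs_le]
      have e : τ - ⌊τ * n⌋₊ / n = (τ * n - ⌊τ * n⌋₊) / n := by field_simp
      rw [e]
      constructor
      · have : 0 ≤ (τ * n - ⌊τ * n⌋₊) / n := div_nonneg (by linarith) hn'.le
        have : 0 ≤ 1 / (n : ℝ) := by positivity
        linarith
      · gcongr
        linarith
    rw [dist_eq_norm] at hd
    simp only [Finset.mem_biUnion, Finset.mem_univ, true_and, Finset.mem_range]
    refine ⟨k, ⌊τ * n⌋₊, Nat.lt_succ_of_le hln, ?_⟩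
    simp only [S, Finset.mem_product, Finset.mem_filter, Finset.mem_range]
    refine ⟨⟨hi, abs_sub_index_le ha hn hpx ?_⟩, ⟨hj, abs_sub_index_le hb hn hpy ?_⟩⟩
    · rw [← sub_re]; exact (abs_re_le_norm _).trans hd
    · rw [← sub_im]; exact (abs_im_le_norm _).trans hd

/-- Over a cell of mesh `1 / n` the boundary integral is `o(1 / n)` by uniform continuity, and only
`O(n)` cells meet the contour; the other ones contribute nothing, by Cauchy's theorem. -/
theorem IsContour.rectIntegral_eq_zero {Γ : Set ℂ} (hΓ : IsContour Γ) {f : ℂ → ℂ} {x y a b : ℝ}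
    (hc : ContinuousOn f ([[x, x + a]] ×ℂ [[y, y + b]]))
    (hd : ∀ z ∈ [[x, x + a]] ×ℂ [[y, y + b]], z ∉ Γ → DifferentiableAt ℂ f z) :
    rectIntegral f x (x + a) y (y + b) = 0 := by
  rcases eq_or_ne a 0 with rfl | ha
  · simp [rectIntegral]
  rcases eq_or_ne b 0 with rfl | hb
  · simp [rectIntegral]
  obtain ⟨C, hC⟩ := hΓ.exists_card_cells_le (x := x) (y := y) ha hb
  have key : ∀ ε > 0, ‖rectIntegral f x (x + a) y (y + b)‖ ≤ ε * (C * (|a| + |b|)) := by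
    intro ε hε
    have hcomp := ((isCompact_uIcc (a := x) (b := x + a)).reProdIm
      (isCompact_uIcc (a := y) (b := y + b)))
    obtain ⟨δ, hδ, huc⟩ := Metric.uniformContinuousOn_iff.1
      (hcomp.uniformContinuousOn_of_continuous hc) ε hε
    obtain ⟨n, hn⟩ := exists_nat_gt (max 0 ((|a| + |b|) / δ))
    have hn' : (0 : ℝ) < n := (le_max_left _ _).trans_lt hn
    have hn0 : 0 < n := by exact_mod_cast hn'
    have hnδ : (|a| + |b|) / n < δ := by
      rw [div_lt_comm₀ hn' hδ]
      exact (le_max_right _ _).trans_lt hn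
    obtain ⟨T, hTc, hT⟩ := hC n hn0
    set u : ℕ → ℝ := fun i => x + i * (a / n) with hu
    set v : ℕ → ℝ := fun j => y + j * (b / n) with hv
    have hcell : ∀ i < n, ∀ j < n, [[u i, u (i + 1)]] ×ℂ [[v j, v (j + 1)]] ⊆
        [[x, x + a]] ×ℂ [[y, y + b]] := fun i hi j hj =>
      Set.inter_subset_inter (Set.preimage_mono (uIcc_cell_subset x a hi))
        (Set.preimage_mono (uIcc_cell_subset y b hj))
    have hsum := sum_rectIntegral_grid f u v n
      (fun i hi j hj => intervalIntegrable_horizontal hc (uIcc_cell_subset x a hi)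
        (add_mul_div_mem_uIcc y b hn0 hj))
      (fun j hj i hi => intervalIntegrable_vertical hc (uIcc_cell_subset y b hj)
        (add_mul_div_mem_uIcc x a hn0 hi))
    have e1 : u 0 = x := by simp [hu]
    have e2 : u n = x + a := by simp only [hu]; field_simp
    have e3 : v 0 = y := by simp [hv]
    have e4 : v n = y + b := by simp only [hv]; field_simp
    rw [e1, e2, e3, e4] at hsum
    have du : ∀ i, u (i + 1) - u i = a / n := fun i => by simp only [hu]; push_cast; ring
    have dv : ∀ j, v (j + 1) - v j = b / n := fun j => by simp only [hv]; push_cast; ring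
    have hbd : ∀ i < n, ∀ j < n, ‖rectIntegral f (u i) (u (i + 1)) (v j) (v (j + 1))‖ ≤
        if (i, j) ∈ T then ε * ((|a| + |b|) / n) else 0 := by
      intro i hi j hj
      split_ifs with hij
      · refine (norm_rectIntegral_le (ε := ε) (hc.mono (hcell i hi j hj)) ?_).trans_eq ?_
        · intro z hz w hw _
          rw [← dist_eq_norm]
          refine (huc z (hcell i hi j hj hz) w (hcell i hi j hj hw) ?_).le
          refine lt_of_le_of_lt ?_ hnδ
          rw [dist_eq_norm]
          refine (norm_le_abs_re_add_abs_im _).trans ?_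
          have h1 := Set.abs_sub_le_of_uIcc_subset_uIcc
            (Set.uIcc_subset_uIcc hz.1 hw.1)
          have h2 := Set.abs_sub_le_of_uIcc_subset_uIcc
            (Set.uIcc_subset_uIcc hz.2 hw.2)
          rw [du, abs_div, abs_of_pos hn'] at h1
          rw [dv, abs_div, abs_of_pos hn'] at h2
          rw [abs_sub_comm] at h1 h2
          rw [sub_re, sub_im, add_div]
          exact add_le_add h1 h2
        · rw [du, dv, abs_div, abs_div, abs_of_pos hn', add_div]
      · rw [rectIntegral_eq_zero_of_differentiableOn, norm_zero]
        intro z hz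
        refine (hd z (hcell i hi j hj hz) fun hzΓ => hij (hT i hi j hj ⟨z, hz, hzΓ⟩))
          |>.differentiableWithinAt
    rw [← hsum, ← Finset.sum_product' (f := fun i j =>
      rectIntegral f (u i) (u (i + 1)) (v j) (v (j + 1)))]
    refine (norm_sum_le _ _).trans ((Finset.sum_le_sum (g := fun p : ℕ × ℕ =>
      if p ∈ T then ε * ((|a| + |b|) / n) else 0) fun p hp => ?_).trans ?_)
    · rw [Finset.mem_product, Finset.mem_range, Finset.mem_range] at hp
      exact hbd p.1 hp.1 p.2 hp.2
    · rw [Finset.sum_ite_mem, Finset.sum_const, nsmul_eq_mul]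
      calc _ ≤ (T.card : ℝ) * (ε * ((|a| + |b|) / n)) := by
            gcongr
            exact Finset.inter_subset_right
        _ ≤ (C * n) * (ε * ((|a| + |b|) / n)) := by gcongr
        _ = _ := by field_simp
  by_contra hne
  have hpos : 0 < ‖rectIntegral f x (x + a) y (y + b)‖ := norm_pos_iff.2 hne
  have hk : 0 < C * (|a| + |b|) := by
    have := key 1 one_pos
    linarith
  generalize C * (|a| + |b|) = k at key hk
  have h := key (‖rectIntegral f x (x + a) y (y + b)‖ / (2 * k)) (by positivity)
  have e : ‖rectIntegral f x (x + a) y (y + b)‖ / (2 * k) * k =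
      ‖rectIntegral f x (x + a) y (y + b)‖ / 2 := by field_simp
  rw [e] at h
  linarith

/-- Painlevé's theorem: contours are removable for continuous functions. -/
theorem IsContour.differentiableOn_of_continuousOn {Γ U : Set ℂ} (hΓ : IsContour Γ)
    (hU : IsOpen U) {f : ℂ → ℂ} (hc : ContinuousOn f U) (hd : DifferentiableOn ℂ f (U \ Γ)) :
    DifferentiableOn ℂ f U := by
  refine (isConservativeOn_and_continuousOn_iff_isDifferentiableOn hU).1 ⟨fun z w hzw => ?_, hc⟩
  rw [← add_eq_zero_iff_eq_neg, wedgeIntegral_add_wedgeIntegral_eq]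
  have hsub : [[z.re, z.re + (w.re - z.re)]] ×ℂ [[z.im, z.im + (w.im - z.im)]] ⊆ U := by
    simpa [Rectangle] using hzw
  have h := hΓ.rectIntegral_eq_zero (f := f) (hc.mono hsub) fun p hp hpΓ =>
    hd.differentiableAt ((hU.sdiff hΓ.1).mem_nhds ⟨hsub hp, hpΓ⟩)
  simpa [rectIntegral] using h

/-! ### Functions without jump: partial fraction expansion -/

theorem norm_le_of_dense {A V : Set ℂ} (hA : Dense A) (hV : IsOpen V) {k : ℂ → ℂ} {C : ℝ}
    (hk : ContinuousOn k V) (h : ∀ μ ∈ V ∩ A, ‖k μ‖ ≤ C) : ∀ μ ∈ V, ‖k μ‖ ≤ C := by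
  intro μ hμ
  have h1 : k μ ∈ closure (k '' (V ∩ A)) :=
    ((hk μ hμ).mono Set.inter_subset_left).mem_closure_image (hA.open_subset_closure_inter hV hμ)
  have h2 : k '' (V ∩ A) ⊆ Metric.closedBall 0 C := by
    rintro _ ⟨z, hz, rfl⟩
    simpa using h z hz
  simpa using closure_minimal h2 Metric.isClosed_closedBall h1

theorem tendsto_cobounded_of_dense {A : Set ℂ} (hA : Dense A) {F : ℂ → ℂ} (hF : Continuous F)
    (h : Tendsto F (Bornology.cobounded ℂ ⊓ 𝓟 A) (𝓝 0)) :
    Tendsto F (Bornology.cobounded ℂ) (𝓝 0) := by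
  rw [Metric.tendsto_nhds] at h ⊢
  intro ε hε
  obtain ⟨R, -, hR⟩ := hasBasis_cobounded_norm.mem_iff.1
    (eventually_inf_principal.1 (h (ε / 2) (by positivity)))
  have h1 := norm_le_of_dense hA (V := {z : ℂ | R < ‖z‖}) (isOpen_lt continuous_const continuous_norm)
    (k := F) (C := ε / 2) hF.continuousOn fun μ hμ => by
      have h0 : R < ‖μ‖ := hμ.1
      have := hR (show μ ∈ {x : ℂ | R ≤ ‖x‖} from h0.le) hμ.2
      simpa using this.le
  refine hasBasis_cobounded_norm.mem_iff.2 ⟨R + 1, trivial, fun z hz => ?_⟩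
  have := h1 z (by simp only [Set.mem_ofPred_eq] at hz ⊢; linarith)
  simp only [Set.mem_ofPred_eq, dist_zero_right]
  linarith

theorem tendsto_div_sub_cobounded (r s : ℂ) :
    Tendsto (fun μ => r / (μ - s)) (Bornology.cobounded ℂ) (𝓝 0) := by
  have h1 : Tendsto (fun μ : ℂ => μ - s) (Bornology.cobounded ℂ) (Bornology.cobounded ℂ) :=
    tendsto_sub_const_cobounded s
  simpa [div_eq_mul_inv] using (tendsto_inv₀_cobounded.comp h1).const_mul r

/-- A function that is holomorphic in a punctured neighbourhood of `s` and bounded by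
`C / |μ - s|` there differs from a simple pole by a function with a limit at `s`. -/
theorem exists_tendsto_sub_div {G : ℂ → ℂ} {s : ℂ} {C : ℝ}
    (hd : ∀ᶠ μ in 𝓝[≠] s, DifferentiableAt ℂ G μ)
    (hb : ∀ᶠ μ in 𝓝[≠] s, ‖(μ - s) * G μ‖ ≤ C) :
    ∃ r l, Tendsto (fun μ => G μ - r / (μ - s)) (𝓝[≠] s) (𝓝 l) := by
  set k : ℂ → ℂ := fun μ => (μ - s) * G μ with hk
  have hkd : ∀ᶠ μ in 𝓝[≠] s, DifferentiableAt ℂ k μ := by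
    filter_upwards [hd] with μ hμ
    exact (differentiableAt_id.sub_const s).mul hμ
  have hlim := tendsto_limUnder_of_differentiable_on_punctured_nhds_of_bounded_under hkd
    ⟨C, by
      rw [eventually_map]
      filter_upwards [hb] with μ hμ
      simpa [hk] using hμ⟩
  set r := limUnder (𝓝[≠] s) k with hr
  set K := Function.update k s r with hK
  have hKne : ∀ μ, μ ≠ s → K μ = k μ := fun μ hμ => Function.update_of_ne hμ _ _
  have hKs : K s = r := Function.update_self _ _ _
  have hKc : ContinuousAt K s := continuousAt_update_same.2 hlim
  have hKd : ∀ᶠ μ in 𝓝[≠] s, DifferentiableAt ℂ K μ := by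
    filter_upwards [hkd, self_mem_nhdsWithin] with μ hμ hne
    refine hμ.congr_of_eventuallyEq ?_
    filter_upwards [isOpen_ne.mem_nhds hne] with z hz
    exact hKne z hz
  have hKa := (analyticAt_of_differentiable_on_punctured_nhds_of_continuousAt hKd hKc)
    |>.differentiableAt.hasDerivAt
  refine ⟨r, deriv K s, (hasDerivAt_iff_tendsto_slope.1 hKa).congr' ?_⟩
  filter_upwards [self_mem_nhdsWithin] with μ hμ
  have hne : μ - s ≠ 0 := sub_ne_zero.2 hμ
  rw [slope_def_field, hKs, hKne μ hμ, hk]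
  field_simp

/-- A function which is holomorphic off a contour and finitely many points, has no jump across the
contour, has at most simple poles at the exceptional points and vanishes at infinity is the sum
of its principal parts. The pole order is only tested along a dense set `A`. -/
theorem IsContour.exists_eq_sum_div_sub {Γ A : Set ℂ} (hΓ : IsContour Γ) (hA : Dense A)
    (hAΓ : A ⊆ Γᶜ) {S : Finset ℂ} {g : ℂ → ℂ} (hd : DifferentiableOn ℂ g (Γᶜ \ S))
    (hlim : ∀ μ ∈ Γ, μ ∉ S → ∃ l, Tendsto g (𝓝[Γᶜ] μ) (𝓝 l))
    (hS : ∀ s ∈ S, (fun μ => (μ - s) * g μ) =O[𝓝[A] s] (fun _ => (1 : ℂ)))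
    (hinf : Tendsto g (Bornology.cobounded ℂ ⊓ 𝓟 Γᶜ) (𝓝 0)) :
    ∃ r : ℂ → ℂ, ∀ μ, μ ∉ Γ → μ ∉ S → g μ = ∑ s ∈ S, r s / (μ - s) := by
  have hΓd : Dense Γᶜ := hA.mono hAΓ
  have hD : Dense (Γᶜ \ (S : Set ℂ)) := hΓd.sdiff_finset S
  have hAS : Dense (A \ (S : Set ℂ)) := hA.sdiff_finset S
  have hSo : IsOpen ((S : Set ℂ)ᶜ) := S.finite_toSet.isClosed.isOpen_compl
  have hDo : IsOpen (Γᶜ \ (S : Set ℂ)) := hΓ.1.isOpen_compl.inter hSo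
  -- `G` extends `g` across the contour and is holomorphic off `S` by Painlevé's theorem
  set G := extendFrom (Γᶜ \ (S : Set ℂ)) g with hG
  have hGg : ∀ μ ∈ Γᶜ \ (S : Set ℂ), G μ = g μ := extendFrom_extends hd.continuousOn
  have hGc : ContinuousOn G (S : Set ℂ)ᶜ := by
    refine continuousOn_extendFrom (fun x _ => hD x) fun x hx => ?_
    by_cases hxΓ : x ∈ Γ
    · obtain ⟨l, hl⟩ := hlim x hxΓ hx
      exact ⟨l, hl.mono_left (nhdsWithin_mono _ Set.sdiff_subset)⟩
    · exact ⟨_, hd.continuousOn x ⟨hxΓ, hx⟩⟩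
  have hGd : DifferentiableOn ℂ G (S : Set ℂ)ᶜ := by
    refine hΓ.differentiableOn_of_continuousOn hSo hGc ?_
    have e : (S : Set ℂ)ᶜ \ Γ = Γᶜ \ (S : Set ℂ) := by
      ext z; simp only [Set.mem_sdiff, Set.mem_compl_iff]; tauto
    rw [e]
    exact hd.congr hGg
  have hpole : ∀ s ∈ S, ∃ r l, Tendsto (fun μ => G μ - r / (μ - s)) (𝓝[≠] s) (𝓝 l) := by
    intro s hs
    obtain ⟨C, hC⟩ := (hS s hs).bound
    simp only [norm_one, mul_one] at hC
    obtain ⟨V, hV, hVo, hsV⟩ := eventually_nhds_iff.1 (eventually_nhdsWithin_iff.1 hC)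
    have hS' : IsOpen ((S.erase s : Set ℂ)ᶜ) := (S.erase s).finite_toSet.isClosed.isOpen_compl
    have hVs : ∀ᶠ μ in 𝓝[≠] s, μ ∈ V ∩ (S : Set ℂ)ᶜ := by
      rw [eventually_nhdsWithin_iff]
      filter_upwards [hVo.mem_nhds hsV, hS'.mem_nhds (by simp : s ∈ (S.erase s : Set ℂ)ᶜ)]
        with μ h1 h2 h3
      refine ⟨h1, fun h4 => h2 ?_⟩
      simpa using ⟨h4, h3⟩
    refine exists_tendsto_sub_div (C := C) ?_ ?_
    · filter_upwards [hVs] with μ hμ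
      exact hGd.differentiableAt (hSo.mem_nhds hμ.2)
    · have h1 := norm_le_of_dense hAS (hVo.inter hSo) (k := fun μ => (μ - s) * G μ) (C := C)
        ((by fun_prop : Continuous fun μ : ℂ => μ - s).continuousOn.mul
          (hGc.mono Set.inter_subset_right)) (by
          rintro μ ⟨⟨h1, -⟩, h2, h3⟩
          simp only [hGg μ ⟨hAΓ h2, h3⟩]
          exact hV μ h1 h2)
      filter_upwards [hVs] with μ hμ using h1 μ hμ
  choose! r l hr using hpole
  refine ⟨r, ?_⟩
  -- without its principal parts, `G` extends to an entire function that vanishes at infinity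
  set T : ℂ → ℂ := fun μ => G μ - ∑ s ∈ S, r s / (μ - s) with hT
  have hTd : DifferentiableOn ℂ T (S : Set ℂ)ᶜ := by
    refine hGd.sub (DifferentiableOn.fun_sum fun s hs => ?_)
    refine (differentiableOn_const _).div (by fun_prop) fun μ hμ => sub_ne_zero.2 ?_
    rintro rfl
    exact hμ hs
  have hSd : Dense ((S : Set ℂ)ᶜ) := hD.mono fun x hx => hx.2
  have hTlim : ∀ x, ∃ y, Tendsto T (𝓝[(S : Set ℂ)ᶜ] x) (𝓝 y) := by
    intro x
    by_cases hx : x ∈ S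
    · have h1 : Tendsto (fun μ => ∑ s ∈ S.erase x, r s / (μ - s)) (𝓝 x)
          (𝓝 (∑ s ∈ S.erase x, r s / (x - s))) := by
        refine tendsto_finsetSum _ fun s hs => ?_
        refine tendsto_const_nhds.div ((continuous_id.sub continuous_const).tendsto x)
          (sub_ne_zero.2 (Finset.ne_of_mem_erase hs).symm)
      have h2 : 𝓝[(S : Set ℂ)ᶜ] x ≤ 𝓝[≠] x :=
        nhdsWithin_mono _ fun z hz => by rintro rfl; exact hz hx
      refine ⟨_, (((hr x hx).mono_left h2).sub (h1.mono_left nhdsWithin_le_nhds)).congr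
        fun μ => ?_⟩
      simp only [hT]
      rw [← Finset.add_sum_erase S _ hx]
      ring
    · exact ⟨_, hTd.continuousOn x hx⟩
  set E := extendFrom ((S : Set ℂ)ᶜ) T with hE
  have hEc : Continuous E := continuous_extendFrom hSd hTlim
  have hET : ∀ μ ∈ (S : Set ℂ)ᶜ, E μ = T μ := extendFrom_extends hTd.continuousOn
  have hEd : DifferentiableOn ℂ E (S : Set ℂ)ᶜ := hTd.congr hET
  have hEdiff : Differentiable ℂ E := by
    intro x
    by_cases hx : x ∈ S
    · refine (analyticAt_of_differentiable_on_punctured_nhds_of_continuousAt ?_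
        hEc.continuousAt).differentiableAt
      have hS' : IsOpen ((S.erase x : Set ℂ)ᶜ) := (S.erase x).finite_toSet.isClosed.isOpen_compl
      rw [eventually_nhdsWithin_iff]
      filter_upwards [hS'.mem_nhds (by simp : x ∈ (S.erase x : Set ℂ)ᶜ)] with μ h2 h3
      refine hEd.differentiableAt (hSo.mem_nhds fun h4 => h2 ?_)
      simpa using ⟨h4, h3⟩
    · exact hEd.differentiableAt (hSo.mem_nhds hx)
  have hsum : Tendsto (fun μ => ∑ s ∈ S, r s / (μ - s)) (Bornology.cobounded ℂ) (𝓝 0) := by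
    simpa using tendsto_finsetSum S fun s _ => tendsto_div_sub_cobounded (r s) s
  have hEinf : Tendsto E (Bornology.cobounded ℂ) (𝓝 0) := by
    refine tendsto_cobounded_of_dense hD hEc ?_
    have h1 : Tendsto (fun μ => g μ - ∑ s ∈ S, r s / (μ - s))
        (Bornology.cobounded ℂ ⊓ 𝓟 (Γᶜ \ (S : Set ℂ))) (𝓝 (0 - 0)) :=
      (hinf.mono_left (inf_le_inf_left _ (principal_mono.2 Set.sdiff_subset))).sub
        (hsum.mono_left inf_le_left)
    rw [sub_zero] at h1
    refine h1.congr' ?_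
    filter_upwards [mem_inf_of_right (mem_principal_self _)] with μ hμ
    rw [hET μ hμ.2]
    simp only [hT, hGg μ hμ]
  intro μ h1 h2
  have h3 := hEdiff.apply_eq_of_tendsto_cocompact μ
    (by rwa [← Metric.cobounded_eq_cocompact])
  rw [hET μ h2, hT] at h3
  simp only [hGg μ ⟨h1, h2⟩] at h3
  exact sub_eq_zero.1 h3

theorem tendsto_sub_mul_sum_div_sub {S : Finset ℂ} (r : ℂ → ℂ) {s : ℂ} (hs : s ∈ S) :
    Tendsto (fun μ => (μ - s) * ∑ p ∈ S, r p / (μ - p)) (𝓝[≠] s) (𝓝 (r s)) := by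
  have h1 : Tendsto (fun μ => (μ - s) * ∑ p ∈ S.erase s, r p / (μ - p)) (𝓝[≠] s)
      (𝓝 ((s - s) * ∑ p ∈ S.erase s, r p / (s - p))) := by
    refine Tendsto.mono_left ?_ nhdsWithin_le_nhds
    refine ((continuous_id.sub continuous_const).tendsto s).mul
      (tendsto_finsetSum _ fun p hp => ?_)
    exact tendsto_const_nhds.div ((continuous_id.sub continuous_const).tendsto s)
      (sub_ne_zero.2 (Finset.ne_of_mem_erase hp).symm)
  have h2 := (tendsto_const_nhds (x := r s)).add h1
  rw [sub_self, zero_mul, add_zero] at h2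
  refine h2.congr' ?_
  filter_upwards [self_mem_nhdsWithin] with μ hμ
  have hne : μ - s ≠ 0 := sub_ne_zero.2 hμ
  rw [← Finset.add_sum_erase S _ hs]
  field_simp

/-! ### Rows of solutions and their Wronskians -/

/-- The points at which the coefficients of the Lax pair may have poles. -/
noncomputable def special : Finset ℂ := {0, 1, -1, I, -I}

theorem sum_special (r : ℂ → ℂ) (μ : ℂ) : ∑ s ∈ special, r s / (μ - s) =
    r 0 / μ + r 1 / (μ - 1) + r (-1) / (μ + 1) + r I / (μ - I) + r (-I) / (μ + I) := by
  have h1 : (1 : ℂ) ≠ -1 := by norm_num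
  have h2 : (1 : ℂ) ≠ I := fun h => by simpa using congrArg Complex.im h
  have h3 : (1 : ℂ) ≠ -I := fun h => by simpa using congrArg Complex.im h
  have h4 : (-1 : ℂ) ≠ I := fun h => by simpa using congrArg Complex.im h
  have h5 : (-1 : ℂ) ≠ -I := fun h => by simpa using congrArg Complex.im h
  have h6 : I ≠ -I := fun h => by
    have := congrArg Complex.im h
    norm_num at this
  have h7 : (0 : ℂ) ≠ I := fun h => by simpa using congrArg Complex.im h
  have h8 : (0 : ℂ) ≠ -I := fun h => by simpa using congrArg Complex.im h
  have h9 : (0 : ℂ) ≠ -1 := by norm_num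
  rw [special, Finset.sum_insert (by simp [h7, h8, h9]), Finset.sum_insert (by simp [h1, h2, h3]),
    Finset.sum_insert (by simp only [Finset.mem_insert, Finset.mem_singleton]; tauto),
    Finset.sum_insert (by simpa using h6), Finset.sum_singleton]
  simp only [sub_neg_eq_add, sub_zero]
  ring

namespace RHData

variable (d : RHData)

/-- All points at which a solution or the phase may be singular. -/
noncomputable def sing : Finset ℂ :=
  d.nodes ∪ d.poles ∪ d.poles.image (starRingEnd ℂ) ∪ special

/-- The non-real points off the contour at which everything is regular. -/
def testSet : Set ℂ := {μ | μ.im ≠ 0} ∩ (d.Γᶜ \ d.sing)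

theorem dense_compl : Dense d.Γᶜ := by
  intro x
  by_cases hx : x ∈ d.Γ
  · rw [← d.frontier₁] at hx
    refine closure_mono (fun z hz => ?_) (frontier_subset_closure hx)
    rw [← d.union]
    exact Or.inl hz
  · exact subset_closure hx

theorem dense_testSet : Dense d.testSet := by
  have h1 : Dense {μ : ℂ | μ.im ≠ 0} := by
    have : Dense ({0}ᶜ : Set ℝ) := dense_compl_singleton 0
    exact this.preimage Complex.isOpenMap_im
  have h2 : IsOpen {μ : ℂ | μ.im ≠ 0} := isOpen_ne.preimage continuous_im
  exact h1.inter_of_isOpen_left (d.dense_compl.sdiff_finset _) h2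

theorem testSet_subset_compl : d.testSet ⊆ d.Γᶜ := fun _ h => h.2.1

theorem neBot_testSet (s : ℂ) : (𝓝[d.testSet] s).NeBot :=
  mem_closure_iff_nhdsWithin_neBot.1 (d.dense_testSet s)

theorem special_subset_sing : special ⊆ d.sing := Finset.subset_union_right

theorem nhdsWithin_testSet_le {s : ℂ} (hs : s ∈ d.sing) : 𝓝[d.testSet] s ≤ 𝓝[≠] s :=
  nhdsWithin_mono _ fun z hz => by rintro rfl; exact hz.2.2 hs

theorem not_mem_of_mem_D₁ {μ : ℂ} (h : μ ∈ d.D₁) : μ ∉ d.Γ := by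
  have : μ ∈ d.Γᶜ := d.union ▸ Or.inl h
  exact this

theorem not_mem_of_mem_D₂ {μ : ℂ} (h : μ ∈ d.D₂) : μ ∉ d.Γ := by
  have : μ ∈ d.Γᶜ := d.union ▸ Or.inr h
  exact this

/-- A pole `μ_j` lies in `D₁` and its conjugate in `D₂`. -/
theorem conj_not_mem_poles {μ : ℂ} (h : μ ∈ d.poles) : (starRingEnd ℂ) μ ∉ d.poles := fun h' =>
  Set.disjoint_left.1 d.disj (d.poles_mem _ h') (d.conj_poles_mem _ h)

theorem pole_ne_conj {μ : ℂ} (h : μ ∈ d.poles) : (starRingEnd ℂ) μ ≠ μ := fun h' =>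
  d.conj_not_mem_poles h (h'.symm ▸ h)

theorem pole_not_mem_special {μ : ℂ} (h : μ ∈ d.poles) : μ ∉ special := by
  have := d.pole_ne_conj h
  simp only [special, Finset.mem_insert, Finset.mem_singleton]
  rintro (rfl | rfl | rfl | rfl | rfl)
  · simp at this
  · simp at this
  · simp at this
  · exact d.I_not_pole h
  · exact d.neg_I_not_pole h

theorem conj_pole_not_mem_special {μ : ℂ} (h : μ ∈ d.poles) :
    (starRingEnd ℂ) μ ∉ special := by
  intro h'
  refine d.pole_not_mem_special h ?_
  have e : (starRingEnd ℂ) ((starRingEnd ℂ) μ) = μ := by simp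
  rw [← e]
  simp only [special, Finset.mem_insert, Finset.mem_singleton] at h' ⊢
  rcases h' with h' | h' | h' | h' | h' <;> rw [h'] <;> simp

theorem isOpen_dom (j : Fin 2) : IsOpen (d.dom j) := by
  have h1 : IsOpen {μ : ℂ | μ ∉ d.poles} := d.poles.finite_toSet.isClosed.isOpen_compl
  have h2 : IsOpen {μ : ℂ | (starRingEnd ℂ) μ ∉ d.poles} := h1.preimage continuous_conj
  have h3 : IsOpen {μ : ℂ | j = 0 → μ ∉ d.poles} := by
    fin_cases j
    · simpa using h1
    · simp
  have h4 : IsOpen {μ : ℂ | j = 1 → (starRingEnd ℂ) μ ∉ d.poles} := by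
    fin_cases j
    · simp
    · simpa using h2
  exact d.contour.1.isOpen_compl.inter (isOpen_ne.inter (isOpen_ne.inter (h3.inter h4)))

theorem isOpen_dom_sdiff (j : Fin 2) : IsOpen (d.dom j \ {0, I, -I}) :=
  (d.isOpen_dom j).sdiff (Set.toFinite _).isClosed

theorem mem_dom_of_not_mem_sing {μ : ℂ} (h : μ ∉ d.Γ) (hs : μ ∉ d.sing) (j : Fin 2) :
    μ ∈ d.dom j \ {0, I, -I} := by
  simp only [sing, special, Finset.mem_union, Finset.mem_image, Finset.mem_insert,
    Finset.mem_singleton, not_or, not_exists, not_and] at hs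
  obtain ⟨⟨⟨-, hp⟩, hc⟩, h0, h1, h2, h3, h4⟩ := hs
  refine ⟨⟨h, h1, h2, fun _ => hp, fun _ hc' => hc _ hc' (by simp)⟩, ?_⟩
  simp [h0, h3, h4]

theorem pole_mem_dom_one {μ : ℂ} (h : μ ∈ d.poles) : μ ∈ d.dom 1 := by
  have h1 := d.pole_not_mem_special h
  simp only [special, Finset.mem_insert, Finset.mem_singleton, not_or] at h1
  exact ⟨d.not_mem_of_mem_D₁ (d.poles_mem _ h), h1.2.1, h1.2.2.1, by simp,
    fun _ => d.conj_not_mem_poles h⟩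

theorem conj_pole_mem_dom_zero {μ : ℂ} (h : μ ∈ d.poles) : (starRingEnd ℂ) μ ∈ d.dom 0 := by
  have h1 := d.conj_pole_not_mem_special h
  simp only [special, Finset.mem_insert, Finset.mem_singleton, not_or] at h1
  exact ⟨d.not_mem_of_mem_D₂ (d.conj_poles_mem _ h), h1.2.1, h1.2.2.1,
    fun _ => d.conj_not_mem_poles h, by simp⟩

theorem det_J {y t : ℝ} {μ : ℂ} (h : μ ∈ d.jumpSet) : (d.J y t μ).det = 1 := by
  have hE : ∀ z, (expPauli3 z).det = 1 := by
    intro z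
    rw [expPauli3, Matrix.det_fin_two_of, ← Complex.exp_add]
    simp
  rw [J, Matrix.det_mul, Matrix.det_mul, hE, hE, d.det_J₀ μ h.1 h.2.1 h.2.2.2.1 h.2.2.2.2.1]
  simp

theorem nhdsWithin_compl_eq (μ : ℂ) : 𝓝[d.Γᶜ] μ = 𝓝[d.D₁] μ ⊔ 𝓝[d.D₂] μ := by
  rw [← d.union, nhdsWithin_union]

/-- The row `x = (x₀, x₁)` has the analyticity, jump and residue properties of a row of a solution
at the point `(y, t)`. Nothing is required at `0`, `± 1` and `± i`. -/
structure IsRow (y t : ℝ) (x : Fin 2 → ℂ → ℂ) : Prop where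
  differentiableOn : ∀ j, DifferentiableOn ℂ (x j) (d.dom j \ {0, I, -I})
  jump : ∀ μ₀ ∈ d.jumpSet, ∃ p m : Fin 2 → ℂ, (∀ j, Tendsto (x j) (𝓝[d.D₁] μ₀) (𝓝 (p j))) ∧
    (∀ j, Tendsto (x j) (𝓝[d.D₂] μ₀) (𝓝 (m j))) ∧ p = m ᵥ* d.J y t μ₀
  bounded : ∀ ζ ∈ d.nodes, ζ ∉ special → ∀ j, x j =O[𝓝[d.Γᶜ] ζ] (fun _ => (1 : ℂ))
  residue₁ : ∀ μ₀ ∈ d.poles, Tendsto (fun μ => (μ - μ₀) * x 0 μ) (𝓝[≠] μ₀)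
    (𝓝 (d.coef μ₀ * exp (2 * phase y t μ₀) * x 1 μ₀))
  residue₂ : ∀ μ₀ ∈ d.poles, Tendsto (fun μ => (μ - (starRingEnd ℂ) μ₀) * x 1 μ)
    (𝓝[≠] ((starRingEnd ℂ) μ₀)) (𝓝 ((starRingEnd ℂ) (d.coef μ₀) *
      exp (-(2 * phase y t ((starRingEnd ℂ) μ₀))) * x 0 ((starRingEnd ℂ) μ₀)))

end RHData

/-- The determinant of two rows. -/
def wronskian (x z : Fin 2 → ℂ → ℂ) (μ : ℂ) : ℂ := x 0 μ * z 1 μ - x 1 μ * z 0 μ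

theorem isBigO_one_of_residue {a b : ℂ → ℂ} {s ρ : ℂ}
    (ha : ∀ᶠ μ in 𝓝[≠] s, DifferentiableAt ℂ a μ) (hb : ∀ᶠ μ in 𝓝 s, DifferentiableAt ℂ b μ)
    (h : Tendsto (fun μ => (μ - s) * a μ) (𝓝[≠] s) (𝓝 (ρ * b s))) :
    (fun μ => a μ - ρ / (μ - s) * b μ) =O[𝓝[≠] s] (fun _ => (1 : ℂ)) := by
  set K : ℂ → ℂ := fun μ => a μ - ρ / (μ - s) * b μ with hK
  have hKd : ∀ᶠ μ in 𝓝[≠] s, DifferentiableAt ℂ K μ := by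
    filter_upwards [ha, nhdsWithin_le_nhds hb, self_mem_nhdsWithin] with μ h1 h2 h3
    have hne : μ - s ≠ 0 := sub_ne_zero.2 h3
    fun_prop (disch := exact hne)
  have hb0 : Tendsto b (𝓝[≠] s) (𝓝 (b s)) :=
    (hb.self_of_nhds.continuousAt.tendsto).mono_left nhdsWithin_le_nhds
  have hsub : Tendsto (fun μ => μ - s) (𝓝[≠] s) (𝓝 0) := by
    have : Tendsto (fun μ : ℂ => μ - s) (𝓝 s) (𝓝 (s - s)) :=
      (continuous_id.sub continuous_const).tendsto s
    rw [sub_self] at this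
    exact this.mono_left nhdsWithin_le_nhds
  have hlim : Tendsto (fun μ => (μ - s) * a μ - ρ * b μ - (μ - s) * K s) (𝓝[≠] s) (𝓝 0) := by
    have := (h.sub (hb0.const_mul ρ)).sub (hsub.mul_const (K s))
    simpa using this
  have ho : (fun z => K z - K s) =o[𝓝[≠] s] fun z => (z - s)⁻¹ := by
    rw [isLittleO_iff_tendsto']
    · refine hlim.congr' ?_
      filter_upwards [self_mem_nhdsWithin] with μ hμ
      have hne : μ - s ≠ 0 := sub_ne_zero.2 hμ
      simp only [hK]
      field_simp
    · filter_upwards [self_mem_nhdsWithin] with μ hμ h0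
      exact absurd (inv_eq_zero.1 h0) (sub_ne_zero.2 hμ)
  exact (tendsto_limUnder_of_differentiable_on_punctured_nhds_of_isLittleO hKd ho).isBigO_one ℂ

/-- The singular parts of two functions `a`, `a'` whose residues are the same multiple of `b`, `b'`
cancel in `a b' - b a'`. -/
theorem isBigO_one_of_residue_of_residue {a b a' b' : ℂ → ℂ} {s ρ : ℂ}
    (ha : ∀ᶠ μ in 𝓝[≠] s, DifferentiableAt ℂ a μ) (hb : ∀ᶠ μ in 𝓝 s, DifferentiableAt ℂ b μ)
    (h : Tendsto (fun μ => (μ - s) * a μ) (𝓝[≠] s) (𝓝 (ρ * b s)))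
    (ha' : ∀ᶠ μ in 𝓝[≠] s, DifferentiableAt ℂ a' μ)
    (hb' : ∀ᶠ μ in 𝓝 s, DifferentiableAt ℂ b' μ)
    (h' : Tendsto (fun μ => (μ - s) * a' μ) (𝓝[≠] s) (𝓝 (ρ * b' s))) :
    (fun μ => a μ * b' μ - b μ * a' μ) =O[𝓝[≠] s] (fun _ => (1 : ℂ)) := by
  have h1 := isBigO_one_of_residue ha hb h
  have h2 := isBigO_one_of_residue ha' hb' h'
  have hb1 : b =O[𝓝[≠] s] (fun _ => (1 : ℂ)) :=
    (hb.self_of_nhds.continuousAt.tendsto.mono_left nhdsWithin_le_nhds).isBigO_one ℂ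
  have hb2 : b' =O[𝓝[≠] s] (fun _ => (1 : ℂ)) :=
    (hb'.self_of_nhds.continuousAt.tendsto.mono_left nhdsWithin_le_nhds).isBigO_one ℂ
  have h3 := (h1.mul hb2).sub (hb1.mul h2)
  simp only [mul_one] at h3
  refine h3.congr_left fun μ => ?_
  ring

namespace RHData.IsRow

variable {d : RHData} {y t : ℝ} {x z : Fin 2 → ℂ → ℂ}

theorem differentiableOn_wronskian (hx : d.IsRow y t x) (hz : d.IsRow y t z) :
    DifferentiableOn ℂ (wronskian x z) (d.Γᶜ \ d.sing) := by
  have h : ∀ {w : Fin 2 → ℂ → ℂ}, d.IsRow y t w → ∀ j,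
      DifferentiableOn ℂ (w j) (d.Γᶜ \ d.sing) := fun hw j =>
    (hw.differentiableOn j).mono fun μ hμ => d.mem_dom_of_not_mem_sing hμ.1 hμ.2 j
  exact ((h hx 0).mul (h hz 1)).sub ((h hx 1).mul (h hz 0))

/-- The jump matrix has determinant one. -/
theorem tendsto_wronskian (hx : d.IsRow y t x) (hz : d.IsRow y t z) {μ : ℂ} (hμ : μ ∈ d.Γ)
    (hs : μ ∉ d.sing) : ∃ l, Tendsto (wronskian x z) (𝓝[d.Γᶜ] μ) (𝓝 l) := by
  have hjump : μ ∈ d.jumpSet := by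
    simp only [sing, special, Finset.mem_union, Finset.mem_image, Finset.mem_insert,
      Finset.mem_singleton, not_or, not_exists, not_and] at hs
    obtain ⟨⟨⟨hn, -⟩, -⟩, h0, h1, h2, h3, h4⟩ := hs
    exact ⟨hμ, hn, h0, h1, h2, h3, h4⟩
  obtain ⟨p, m, hp, hm, hpm⟩ := hx.jump μ hjump
  obtain ⟨p', m', hp', hm', hpm'⟩ := hz.jump μ hjump
  have hdet := d.det_J (y := y) (t := t) hjump
  rw [Matrix.det_fin_two] at hdet
  refine ⟨p 0 * p' 1 - p 1 * p' 0, ?_⟩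
  rw [d.nhdsWithin_compl_eq, tendsto_sup]
  refine ⟨((hp 0).mul (hp' 1)).sub ((hp 1).mul (hp' 0)), ?_⟩
  have e : p 0 * p' 1 - p 1 * p' 0 = m 0 * m' 1 - m 1 * m' 0 := by
    simp only [hpm, hpm', Matrix.vecMul, dotProduct, Fin.sum_univ_two]
    linear_combination (m 0 * m' 1 - m 1 * m' 0) * hdet
  rw [e]
  exact ((hm 0).mul (hm' 1)).sub ((hm 1).mul (hm' 0))

theorem isBigO_wronskian (hx : d.IsRow y t x) (hz : d.IsRow y t z) {s : ℂ} (hs : s ∈ d.sing)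
    (hs' : s ∉ special) : wronskian x z =O[𝓝[d.testSet] s] (fun _ => (1 : ℂ)) := by
  simp only [sing, Finset.mem_union, hs', or_false, Finset.mem_image] at hs
  have hsp : s ∉ ({0, I, -I} : Set ℂ) := fun h => hs' (by
    simp only [Set.mem_insert_iff, Set.mem_singleton_iff] at h
    simp only [special, Finset.mem_insert, Finset.mem_singleton]
    tauto)
  have hopen : ∀ {w : Fin 2 → ℂ → ℂ}, d.IsRow y t w → ∀ j, s ∈ d.dom j →
      ∀ᶠ μ in 𝓝 s, DifferentiableAt ℂ (w j) μ := by
    intro w hw j hj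
    filter_upwards [(d.isOpen_dom_sdiff j).mem_nhds ⟨hj, hsp⟩] with μ hμ
    exact (hw.differentiableOn j).differentiableAt ((d.isOpen_dom_sdiff j).mem_nhds hμ)
  have hpunct : ∀ {w : Fin 2 → ℂ → ℂ}, d.IsRow y t w → ∀ i j, s ∈ d.dom i →
      ∀ᶠ μ in 𝓝[≠] s, DifferentiableAt ℂ (w j) μ := by
    intro w hw i j hi
    have hfin : IsOpen ((d.sing.erase s : Set ℂ)ᶜ) :=
      (d.sing.erase s).finite_toSet.isClosed.isOpen_compl
    rw [eventually_nhdsWithin_iff]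
    filter_upwards [(d.isOpen_dom i).mem_nhds hi,
      hfin.mem_nhds (by simp : s ∈ (d.sing.erase s : Set ℂ)ᶜ)] with μ h1 h2 h3
    have h4 : μ ∉ d.sing := fun h4 => h2 (by simpa using ⟨h4, h3⟩)
    exact (hw.differentiableOn j).differentiableAt ((d.isOpen_dom_sdiff j).mem_nhds
      (d.mem_dom_of_not_mem_sing h1.1 h4 j))
  have hle : 𝓝[d.testSet] s ≤ 𝓝[≠] s := d.nhdsWithin_testSet_le (by
    simp only [sing, Finset.mem_union, Finset.mem_image]
    exact Or.inl hs)
  rcases hs with (hs | hs) | ⟨s, hs, rfl⟩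
  · have h1 := fun j => (hx.bounded s hs hs' j).mono (nhdsWithin_mono _ d.testSet_subset_compl)
    have h2 := fun j => (hz.bounded s hs hs' j).mono (nhdsWithin_mono _ d.testSet_subset_compl)
    simpa using! ((h1 0).mul (h2 1)).sub ((h1 1).mul (h2 0))
  · have hdom := d.pole_mem_dom_one hs
    exact (isBigO_one_of_residue_of_residue (hpunct hx 1 0 hdom) (hopen hx 1 hdom)
      (hx.residue₁ s hs) (hpunct hz 1 0 hdom) (hopen hz 1 hdom) (hz.residue₁ s hs)).mono hle
  · have hdom := d.conj_pole_mem_dom_zero hs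
    refine ((isBigO_one_of_residue_of_residue (hpunct hx 0 1 hdom) (hopen hx 0 hdom)
      (hx.residue₂ s hs) (hpunct hz 0 1 hdom) (hopen hz 0 hdom) (hz.residue₂ s hs)).mono
      hle).neg_left.congr_left fun μ => ?_
    simp only [wronskian]
    ring

end RHData.IsRow

namespace RHData

variable (d : RHData)

/-- The points off the contour at which everything is regular. -/
def good : Set ℂ := d.Γᶜ \ d.sing

theorem testSet_subset_good : d.testSet ⊆ d.good := Set.inter_subset_right

theorem dense_good : Dense d.good := d.dense_testSet.mono d.testSet_subset_good

end RHData

namespace RHData.IsRow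

variable {d : RHData} {y t : ℝ} {x z : Fin 2 → ℂ → ℂ}

/-- The Wronskian of two rows is the sum of its principal parts at `0`, `± 1` and `± i`, after
subtraction of a function `e` that accounts for multiple poles and for the growth at infinity. -/
theorem exists_wronskian_eq (hx : d.IsRow y t x) (hz : d.IsRow y t z) {e : ℂ → ℂ}
    (he : DifferentiableOn ℂ e (special : Set ℂ)ᶜ)
    (hP : ∀ s ∈ special,
      (fun μ => (μ - s) * (wronskian x z μ - e μ)) =O[𝓝[d.testSet] s] (fun _ => (1 : ℂ)))
    (hinf : Tendsto (fun μ => wronskian x z μ - e μ) d.atInfty (𝓝 0)) :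
    ∃ r : ℂ → ℂ, ∀ μ ∈ d.good, wronskian x z μ - e μ = ∑ s ∈ special, r s / (μ - s) := by
  have hSo : IsOpen ((special : Set ℂ)ᶜ) := special.finite_toSet.isClosed.isOpen_compl
  have hbdd : ∀ s ∈ d.sing, s ∉ special →
      (fun μ => wronskian x z μ - e μ) =O[𝓝[d.testSet] s] (fun _ => (1 : ℂ)) := by
    intro s hs hs'
    have h1 : e =O[𝓝[d.testSet] s] (fun _ => (1 : ℂ)) :=
      (((he.differentiableAt (hSo.mem_nhds hs')).continuousAt.tendsto).mono_left
        nhdsWithin_le_nhds).isBigO_one ℂ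
    exact (hx.isBigO_wronskian hz hs hs').sub h1
  have hsub : ∀ s, Tendsto (fun μ : ℂ => μ - s) (𝓝[d.testSet] s) (𝓝 0) := by
    intro s
    have : Tendsto (fun μ : ℂ => μ - s) (𝓝 s) (𝓝 (s - s)) :=
      (continuous_id.sub continuous_const).tendsto s
    rw [sub_self] at this
    exact this.mono_left nhdsWithin_le_nhds
  obtain ⟨r, hr⟩ := d.contour.exists_eq_sum_div_sub (S := d.sing) d.dense_testSet
    d.testSet_subset_compl (g := fun μ => wronskian x z μ - e μ)
    ((hx.differentiableOn_wronskian hz).sub (he.mono fun μ hμ h =>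
      hμ.2 (d.special_subset_sing h)))
    (fun μ hμ hs => by
      obtain ⟨l, hl⟩ := hx.tendsto_wronskian hz hμ hs
      exact ⟨_, hl.sub (((he.differentiableAt (hSo.mem_nhds fun h =>
        hs (d.special_subset_sing h))).continuousAt.tendsto).mono_left nhdsWithin_le_nhds)⟩)
    (fun s hs => by
      by_cases hs' : s ∈ special
      · exact hP s hs'
      · simpa using ((hsub s).isBigO_one ℂ).mul (hbdd s hs hs'))
    hinf
  refine ⟨r, fun μ hμ => ?_⟩
  rw [hr μ hμ.1 hμ.2]
  symm
  refine Finset.sum_subset d.special_subset_sing fun s hs hs' => ?_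
  have h1 : Tendsto (fun μ => (μ - s) * (wronskian x z μ - e μ)) (𝓝[d.testSet] s) (𝓝 0) := by
    have h2 : (fun μ => (μ - s) * (wronskian x z μ - e μ)) =O[𝓝[d.testSet] s]
        (fun μ => μ - s) := by
      simpa using (isBigO_refl (fun μ => μ - s) _).mul (hbdd s hs hs')
    exact h2.trans_tendsto (hsub s)
  have h2 := (tendsto_sub_mul_sum_div_sub r hs).mono_left (d.nhdsWithin_testSet_le hs)
  have := d.neBot_testSet s
  have h3 : r s = 0 := tendsto_nhds_unique (h2.congr' (by
    filter_upwards [self_mem_nhdsWithin] with p hp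
    rw [← hr p hp.2.1 hp.2.2])) h1
  rw [h3, zero_div]

end RHData.IsRow

namespace RHData

variable (d : RHData)

theorem residue_eq_of_tendsto {g r : ℂ → ℂ}
    (h : ∀ μ ∈ d.good, g μ = ∑ s ∈ special, r s / (μ - s)) {s l : ℂ} (hs : s ∈ special)
    {F : Filter ℂ} [F.NeBot] (hF : F ≤ 𝓝[≠] s) (hg : ∀ᶠ μ in F, μ ∈ d.good)
    (hl : Tendsto (fun μ => (μ - s) * g μ) F (𝓝 l)) : r s = l := by
  refine tendsto_nhds_unique ?_ hl
  refine ((tendsto_sub_mul_sum_div_sub r hs).mono_left hF).congr' ?_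
  filter_upwards [hg] with μ hμ
  rw [h μ hμ]

theorem residue_eq_zero {g r : ℂ → ℂ}
    (h : ∀ μ ∈ d.good, g μ = ∑ s ∈ special, r s / (μ - s)) {s : ℂ} (hs : s ∈ special)
    {F : Filter ℂ} [F.NeBot] (hF : F ≤ 𝓝[≠] s) (hg : ∀ᶠ μ in F, μ ∈ d.good)
    (hb : g =O[F] (fun _ => (1 : ℂ))) : r s = 0 := by
  refine d.residue_eq_of_tendsto h hs hF hg ?_
  have hsub : Tendsto (fun μ : ℂ => μ - s) F (𝓝 0) := by
    have : Tendsto (fun μ : ℂ => μ - s) (𝓝 s) (𝓝 (s - s)) :=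
      (continuous_id.sub continuous_const).tendsto s
    rw [sub_self] at this
    exact this.mono_left (hF.trans nhdsWithin_le_nhds)
  have h2 : (fun μ => (μ - s) * g μ) =O[F] (fun μ => μ - s) := by
    simpa using (isBigO_refl (fun μ => μ - s) _).mul hb
  exact h2.trans_tendsto hsub

/-! ### The symmetries of the domain -/

theorem mem_good_iff {μ : ℂ} : μ ∈ d.good ↔
    μ ∉ d.Γ ∧ μ ∉ d.poles ∧ (starRingEnd ℂ) μ ∉ d.poles ∧ μ ∉ special := by
  have h1 : (∃ a ∈ d.poles, (starRingEnd ℂ) a = μ) ↔ (starRingEnd ℂ) μ ∈ d.poles := by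
    constructor
    · rintro ⟨a, ha, rfl⟩
      simpa using ha
    · intro h
      exact ⟨_, h, by simp⟩
  have h2 : μ ∈ d.nodes → μ ∈ d.Γ := d.nodes_subset μ
  rw [good, Set.mem_sdiff, Set.mem_compl_iff]
  simp only [sing, Finset.coe_union, Set.mem_union, Finset.mem_coe, Finset.mem_image,
    h1]
  tauto

theorem good_ne {μ : ℂ} (h : μ ∈ d.good) : μ ≠ 0 ∧ μ ≠ 1 ∧ μ ≠ -1 ∧ μ ≠ I ∧ μ ≠ -I := by
  have := (d.mem_good_iff.1 h).2.2.2
  simpa only [special, Finset.mem_insert, Finset.mem_singleton, not_or] using this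

theorem neg_mem_poles {μ : ℂ} (h : -μ ∈ d.poles) : (starRingEnd ℂ) μ ∈ d.poles := by
  simpa using (d.poles_conj _ h).1

theorem inv_mem_poles {μ : ℂ} (h : μ⁻¹ ∈ d.poles) : (starRingEnd ℂ) μ ∈ d.poles := by
  have := (d.poles_inv _ h).1
  rw [inv_inv] at this
  exact d.neg_mem_poles this

theorem neg_mem_good {μ : ℂ} (h : μ ∈ d.good) : -μ ∈ d.good := by
  rw [mem_good_iff] at h ⊢
  obtain ⟨h1, h2, h3, h4⟩ := h
  refine ⟨fun h => h1 (by simpa using d.neg_mem _ h), fun h => h3 (d.neg_mem_poles h),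
    fun h => h2 ?_, fun h => h4 ?_⟩
  · rw [map_neg] at h
    simpa using d.neg_mem_poles h
  · simp only [special, Finset.mem_insert, Finset.mem_singleton, neg_eq_iff_eq_neg] at h ⊢
    simp only [neg_zero, neg_neg] at h
    tauto

theorem inv_mem_good {μ : ℂ} (h : μ ∈ d.good) : μ⁻¹ ∈ d.good := by
  have h0 := (d.good_ne h).1
  rw [mem_good_iff] at h ⊢
  obtain ⟨h1, h2, h3, h4⟩ := h
  refine ⟨fun h => h1 (by simpa using d.inv_mem _ h (inv_ne_zero h0)),
    fun h => h3 (d.inv_mem_poles h), fun h => h2 ?_, fun h => h4 ?_⟩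
  · rw [map_inv₀] at h
    simpa using d.inv_mem_poles h
  · simp only [special, Finset.mem_insert, Finset.mem_singleton, inv_eq_iff_eq_inv] at h ⊢
    simp only [_root_.inv_zero, inv_one, inv_neg, inv_I, neg_neg] at h
    tauto

theorem neg_mem_testSet {μ : ℂ} (h : μ ∈ d.testSet) : -μ ∈ d.testSet :=
  ⟨by simpa using! h.1, d.neg_mem_good h.2⟩

theorem inv_mem_testSet {μ : ℂ} (h : μ ∈ d.testSet) : μ⁻¹ ∈ d.testSet := by
  refine ⟨?_, d.inv_mem_good h.2⟩
  have h0 := (d.good_ne h.2).1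
  have h1 : μ.im ≠ 0 := h.1
  show μ⁻¹.im ≠ 0
  rw [Complex.inv_im]
  exact div_ne_zero (neg_ne_zero.2 h1) (normSq_pos.2 h0).ne'

theorem tendsto_neg_testSet (s : ℂ) :
    Tendsto (fun μ : ℂ => -μ) (𝓝[d.testSet] s) (𝓝[d.testSet] (-s)) :=
  tendsto_nhdsWithin_iff.2 ⟨(continuous_neg.tendsto s).mono_left nhdsWithin_le_nhds,
    eventually_nhdsWithin_of_forall fun _ h => d.neg_mem_testSet h⟩

theorem tendsto_inv_testSet_zero :
    Tendsto (fun μ : ℂ => μ⁻¹) (𝓝[d.testSet] 0) d.atInfty := by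
  refine tendsto_inf.2 ⟨?_, ?_⟩
  · exact tendsto_inv₀_nhdsNE_zero.mono_left (nhdsWithin_mono _ fun z hz =>
      (d.good_ne hz.2).1)
  · rw [tendsto_principal]
    exact eventually_nhdsWithin_of_forall fun _ h => (d.inv_mem_testSet h).2.1

/-- The inversion exchanges the two half planes at `1`. -/
theorem isBigO_testSet_one {g g' : ℂ → ℂ}
    (h : (fun μ => (μ - 1) * g μ) =O[d.upper 1] (fun _ => (1 : ℂ)))
    (h' : (fun μ => (μ - 1) * g' μ) =O[d.upper 1] (fun _ => (1 : ℂ)))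
    (hsymm : ∀ μ ∈ d.good, g μ = g' μ⁻¹) :
    (fun μ => (μ - 1) * g μ) =O[𝓝[d.testSet] 1] (fun _ => (1 : ℂ)) := by
  have e : d.testSet = (d.testSet ∩ {μ | 0 < μ.im}) ∪ (d.testSet ∩ {μ | μ.im < 0}) := by
    rw [← Set.inter_union_distrib_left]
    symm
    refine Set.inter_eq_left.2 fun μ hμ => ?_
    exact (lt_or_gt_of_ne hμ.1).symm
  rw [e, nhdsWithin_union]
  refine IsBigO.sup (h.mono (nhdsWithin_mono _ fun μ hμ => ⟨hμ.2, hμ.1.2.1⟩)) ?_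
  have hinv : Tendsto (fun μ : ℂ => μ⁻¹) (𝓝[d.testSet ∩ {μ | μ.im < 0}] 1) (d.upper 1) := by
    refine tendsto_nhdsWithin_iff.2 ⟨?_, eventually_nhdsWithin_of_forall fun μ hμ => ?_⟩
    · have := (tendsto_inv₀ (one_ne_zero (α := ℂ))).mono_left
        (nhdsWithin_le_nhds (s := d.testSet ∩ {μ | μ.im < 0}))
      simpa using this
    · refine ⟨?_, (d.inv_mem_good hμ.1.2).1⟩
      show 0 < μ⁻¹.im
      have h0 : μ.im < 0 := hμ.2
      rw [Complex.inv_im]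
      exact div_pos (neg_pos.2 h0) (normSq_pos.2 (d.good_ne hμ.1.2).1)
  have hμ1 : (fun μ : ℂ => -μ) =O[𝓝[d.testSet ∩ {μ | μ.im < 0}] 1] (fun _ => (1 : ℂ)) :=
    ((continuous_neg.tendsto 1).mono_left nhdsWithin_le_nhds).isBigO_one ℂ
  have h2 := hμ1.mul (h'.comp_tendsto hinv)
  refine (h2.congr' ?_ ?_)
  · filter_upwards [self_mem_nhdsWithin] with μ hμ
    have h0 := (d.good_ne hμ.1.2).1
    simp only [Function.comp]
    rw [hsymm μ hμ.1.2]
    field_simp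
    ring
  · exact Eventually.of_forall fun _ => by simp

end RHData

/-! ### Brackets of matrix functions -/

/-- The determinant of the `i`-th row of `X` and the `k`-th row of `Z`; up to signs these are the
entries of `X * adjugate Z`. -/
def bracket (X Z : ℂ → Mat) (i k : Fin 2) (μ : ℂ) : ℂ := X μ i 0 * Z μ k 1 - X μ i 1 * Z μ k 0

namespace RHData

variable (d : RHData)

/-- A matrix function with the properties of a solution at the point `(y, t)`, except that nothing
is required at `0`, at `± i` and at infinity, and that the coefficient `ν` of the singularity at
`1` is arbitrary. -/
structure IsFrame (y t : ℝ) (ν : ℂ) (X : ℂ → Mat) : Prop where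
  row : ∀ i, d.IsRow y t (fun j μ => X μ i j)
  neg : ∀ μ ∈ d.good, X (-μ) = !![X μ 1 1, -X μ 1 0; -X μ 0 1, X μ 0 0]
  inv : ∀ μ ∈ d.good, X μ⁻¹ = !![X μ 1 1, X μ 1 0; X μ 0 1, X μ 0 0]
  one : ∀ i j, (fun μ => X μ i j - ν * (![-d.c, 1] : Fin 2 → ℂ) j / (μ - 1))
    =O[d.upper 1] (fun _ => (1 : ℂ))

/-- The leading singularities of two rows at `1` are proportional. -/
theorem isBigO_mul_wronskian {F : Filter ℂ} (hF : Tendsto (fun μ : ℂ => μ - 1) F (𝓝 0))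
    (hF' : ∀ᶠ μ in F, μ ≠ 1) {x z : Fin 2 → ℂ → ℂ} {v : Fin 2 → ℂ} {ν ρ : ℂ}
    (hx : ∀ j, (fun μ => x j μ - ν * v j / (μ - 1)) =O[F] (fun _ => (1 : ℂ)))
    (hz : ∀ j, (fun μ => z j μ - ρ * v j / (μ - 1)) =O[F] (fun _ => (1 : ℂ))) :
    (fun μ => (μ - 1) * wronskian x z μ) =O[F] (fun _ => (1 : ℂ)) := by
  have hc : ∀ c : ℂ, (fun _ : ℂ => c) =O[F] (fun _ => (1 : ℂ)) := fun c =>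
    isBigO_const_const _ one_ne_zero _
  have hs := hF.isBigO_one ℂ
  have h1 := (hs.mul ((hx 0).mul (hz 1))).sub (hs.mul ((hx 1).mul (hz 0)))
  have h2 := ((hc (ν * v 0)).mul (hz 1)).sub ((hc (ν * v 1)).mul (hz 0))
  have h3 := ((hc (ρ * v 1)).mul (hx 0)).sub ((hc (ρ * v 0)).mul (hx 1))
  have h4 := (h1.add (by simpa using! h2)).add (by simpa using! h3)
  refine h4.congr' ?_ (Eventually.of_forall fun _ => by simp)
  filter_upwards [hF'] with μ hμ
  have hne : μ - 1 ≠ 0 := sub_ne_zero.2 hμ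
  simp only [wronskian]
  field_simp
  ring

theorem tendsto_sub_upper (s : ℂ) : Tendsto (fun μ : ℂ => μ - s) (d.upper s) (𝓝 0) := by
  have : Tendsto (fun μ : ℂ => μ - s) (𝓝 s) (𝓝 (s - s)) :=
    (continuous_id.sub continuous_const).tendsto s
  rw [sub_self] at this
  exact this.mono_left nhdsWithin_le_nhds

theorem eventually_ne_upper {s : ℂ} (hs : s.im = 0) : ∀ᶠ μ in d.upper s, μ ≠ s :=
  eventually_nhdsWithin_of_forall fun μ hμ h => by
    have h1 : 0 < μ.im := hμ.1
    rw [h, hs] at h1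
    exact lt_irrefl _ h1

theorem upper_le {s : ℂ} (hs : s.im = 0) : d.upper s ≤ 𝓝[≠] s :=
  nhdsWithin_mono _ fun μ hμ h => by
    have h1 : 0 < μ.im := hμ.1
    rw [Set.mem_singleton_iff.1 h, hs] at h1
    exact lt_irrefl _ h1

theorem neBot_upper {s : ℂ} (hs : s.im = 0) : (d.upper s).NeBot := by
  refine mem_closure_iff_nhdsWithin_neBot.1 ?_
  have h1 : IsOpen {μ : ℂ | 0 < μ.im} := isOpen_lt continuous_const continuous_im
  have h2 := d.dense_compl.open_subset_closure_inter h1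
  have h3 : s ∈ closure {μ : ℂ | 0 < μ.im} := by
    rw [Complex.closure_setOfPred_lt_im]
    exact hs.ge
  exact closure_minimal h2 isClosed_closure h3

theorem eventually_good_upper {s : ℂ} (hs : s.im = 0) : ∀ᶠ μ in d.upper s, μ ∈ d.good := by
  have hfin : IsOpen ((d.sing.erase s : Set ℂ)ᶜ) :=
    (d.sing.erase s).finite_toSet.isClosed.isOpen_compl
  filter_upwards [d.eventually_ne_upper hs, nhdsWithin_le_nhds (hfin.mem_nhds
    (by simp : s ∈ (d.sing.erase s : Set ℂ)ᶜ)), self_mem_nhdsWithin] with μ h1 h2 h3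
  exact ⟨h3.2, fun h4 => h2 (by simpa using ⟨h4, h1⟩)⟩

end RHData

namespace RHData.IsFrame

variable {d : RHData} {y t : ℝ} {ν ρ : ℂ} {X Z : ℂ → Mat}

theorem bracket_neg (hX : d.IsFrame y t ν X) (hZ : d.IsFrame y t ρ Z) {μ : ℂ} (hμ : μ ∈ d.good) :
    bracket X Z 0 0 (-μ) = bracket X Z 1 1 μ ∧ bracket X Z 0 1 (-μ) = -bracket X Z 1 0 μ ∧
    bracket X Z 1 0 (-μ) = -bracket X Z 0 1 μ ∧ bracket X Z 1 1 (-μ) = bracket X Z 0 0 μ := by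
  simp only [bracket, hX.neg μ hμ, hZ.neg μ hμ, of_apply, cons_val', cons_val_zero, cons_val_one,
    cons_val_fin_one]
  refine ⟨?_, ?_, ?_, ?_⟩ <;> ring

theorem bracket_inv (hX : d.IsFrame y t ν X) (hZ : d.IsFrame y t ρ Z) {μ : ℂ} (hμ : μ ∈ d.good) :
    bracket X Z 0 0 μ⁻¹ = -bracket X Z 1 1 μ ∧ bracket X Z 0 1 μ⁻¹ = -bracket X Z 1 0 μ ∧
    bracket X Z 1 0 μ⁻¹ = -bracket X Z 0 1 μ ∧ bracket X Z 1 1 μ⁻¹ = -bracket X Z 0 0 μ := by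
  simp only [bracket, hX.inv μ hμ, hZ.inv μ hμ, of_apply, cons_val', cons_val_zero, cons_val_one,
    cons_val_fin_one]
  refine ⟨?_, ?_, ?_, ?_⟩ <;> ring

theorem isBigO_upper_one (hX : d.IsFrame y t ν X) (hZ : d.IsFrame y t ρ Z) (i k : Fin 2) :
    (fun μ => (μ - 1) * bracket X Z i k μ) =O[d.upper 1] (fun _ => (1 : ℂ)) :=
  isBigO_mul_wronskian (d.tendsto_sub_upper 1) (d.eventually_ne_upper (by simp)) (hX.one i)
    (hZ.one k)

/-- The singularity at `1` has equal rows. -/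
theorem isBigO_upper_one_sum (hX : d.IsFrame y t ν X) (hZ : d.IsFrame y t ρ Z) :
    (fun μ => bracket X Z 0 0 μ - bracket X Z 0 1 μ - bracket X Z 1 0 μ + bracket X Z 1 1 μ)
      =O[d.upper 1] (fun _ => (1 : ℂ)) := by
  have h1 := fun j => (hX.one 0 j).sub (hX.one 1 j)
  have h2 := fun j => (hZ.one 0 j).sub (hZ.one 1 j)
  have h3 := ((h1 0).mul (h2 1)).sub ((h1 1).mul (h2 0))
  refine h3.congr (fun μ => ?_) fun _ => by simp
  simp only [bracket]
  ring

/-- The inversion `μ ↦ μ⁻¹` fixes `1` and carries the bound in the upper half plane to the lower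
one. -/
theorem isBigO_one (hX : d.IsFrame y t ν X) (hZ : d.IsFrame y t ρ Z) (i k : Fin 2) :
    (fun μ => (μ - 1) * bracket X Z i k μ) =O[𝓝[d.testSet] 1] (fun _ => (1 : ℂ)) := by
  have hup := fun i k => (hX.isBigO_upper_one hZ i k).neg_left
  have hs : ∀ μ ∈ d.good, bracket X Z i k μ =
      (fun μ => -bracket X Z (1 - i) (1 - k) μ) μ⁻¹ := by
    intro μ hμ
    obtain ⟨h1, h2, h3, h4⟩ := hX.bracket_inv hZ hμ
    fin_cases i <;> fin_cases k <;> simp [h1, h2, h3, h4]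
  refine d.isBigO_testSet_one (g' := fun μ => -bracket X Z (1 - i) (1 - k) μ)
    (hX.isBigO_upper_one hZ i k) ?_ hs
  simpa only [mul_neg] using hup (1 - i) (1 - k)

theorem isBigO_neg_one (hX : d.IsFrame y t ν X) (hZ : d.IsFrame y t ρ Z) (i k : Fin 2) :
    (fun μ => (μ - (-1)) * bracket X Z i k μ) =O[𝓝[d.testSet] (-1)] (fun _ => (1 : ℂ)) := by
  have hneg := d.tendsto_neg_testSet (-1)
  rw [neg_neg] at hneg
  have h := (hX.isBigO_one hZ (1 - i) (1 - k)).comp_tendsto hneg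
  rw [← isBigO_norm_left] at h ⊢
  refine h.congr' ?_ (Eventually.of_forall fun _ => rfl)
  filter_upwards [self_mem_nhdsWithin] with μ hμ
  obtain ⟨h1, h2, h3, h4⟩ := hX.bracket_neg hZ hμ.2
  have e : ‖-μ - 1‖ = ‖μ - (-1)‖ := by rw [← norm_neg]; congr 1; ring
  simp only [Function.comp, norm_mul, e]
  congr 1
  fin_cases i <;> fin_cases k <;> simp [h1, h2, h3, h4]

end RHData.IsFrame

theorem eq_zero_of_eqOn_dense {V : Set ℂ} (hV : Dense V)
    (hV' : ∀ μ ∈ V, μ ≠ 0 ∧ μ ≠ 1 ∧ μ ≠ -1) {a b r s u : ℂ}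
    (h : ∀ μ ∈ V, a + b * μ + r / μ + s / (μ - 1) + u / (μ + 1) = 0) :
    a = 0 ∧ b = 0 ∧ r = 0 ∧ s = 0 ∧ u = 0 := by
  set P : ℂ → ℂ := fun μ => a * μ * (μ ^ 2 - 1) + b * μ ^ 2 * (μ ^ 2 - 1) + r * (μ ^ 2 - 1) +
    s * μ * (μ + 1) + u * μ * (μ - 1) with hP
  have h0 : P = fun _ => 0 := by
    refine Continuous.ext_on hV (by fun_prop) continuous_const fun μ hμ => ?_
    obtain ⟨h0, h1, h2⟩ := hV' μ hμ
    have h1' : μ - 1 ≠ 0 := sub_ne_zero.2 h1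
    have h2' : μ + 1 ≠ 0 := fun h => h2 (eq_neg_of_add_eq_zero_left h)
    have := h μ hμ
    field_simp at this
    simp only [hP]
    linear_combination this
  have e1 := congrFun h0 0
  have e2 := congrFun h0 1
  have e3 := congrFun h0 (-1)
  -- the points `± 2` separate the two remaining coefficients
  have e4 := congrFun h0 2
  have e5 := congrFun h0 (-2)
  simp only [hP] at e1 e2 e3 e4 e5
  have hr : r = 0 := by linear_combination -e1
  have hs : s = 0 := by linear_combination e2 / 2
  have hu : u = 0 := by linear_combination e3 / 2
  rw [hr, hs, hu] at e4 e5
  refine ⟨?_, ?_, hr, hs, hu⟩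
  · linear_combination (e4 - e5) / 12
  · linear_combination (e4 + e5) / 24

theorem eq_zero_of_eqOn_dense_of_eq {V : Set ℂ} (hV : Dense V)
    (hV' : ∀ μ ∈ V, μ ≠ 0 ∧ μ ≠ 1 ∧ μ ≠ -1) {f : ℂ → ℂ} {a b r s u : ℂ} (hf : ∀ μ ∈ V, f μ = 0)
    (h : ∀ μ ∈ V, f μ = a + b * μ + r / μ + s / (μ - 1) + u / (μ + 1)) :
    a = 0 ∧ b = 0 ∧ r = 0 ∧ s = 0 ∧ u = 0 :=
  eq_zero_of_eqOn_dense hV hV' fun μ hμ => (h μ hμ).symm.trans (hf μ hμ)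

/-- The symmetries `μ ↦ -μ` and `μ ↦ μ⁻¹` determine the principal parts of the brackets of two
frames up to the constant `κ`, which measures the asymmetry of the subtracted functions `e`. -/
theorem RHData.IsFrame.bracket_eq {d : RHData} {y t : ℝ} {ν ρ : ℂ} {X Z : ℂ → Mat}
    (hX : d.IsFrame y t ν X) (hZ : d.IsFrame y t ρ Z) {e : Fin 2 → Fin 2 → ℂ → ℂ} {κ : ℂ}
    (he : ∀ i k, DifferentiableOn ℂ (e i k) ({0, I, -I} : Set ℂ)ᶜ)
    (hneg : ∀ μ ∈ d.good, e 1 1 μ = e 0 0 (-μ) ∧ e 1 0 μ = -e 0 1 (-μ))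
    (hinv : ∀ μ ∈ d.good, e 0 0 μ⁻¹ = -e 1 1 μ + 2 * κ ∧ e 0 1 μ⁻¹ = -e 1 0 μ)
    (h0 : ∀ i k, (fun μ => μ * (bracket X Z i k μ - e i k μ)) =O[𝓝[d.testSet] 0]
      (fun _ => (1 : ℂ)))
    (hI : ∀ i k, (fun μ => bracket X Z i k μ - e i k μ) =O[𝓝[d.testSet] I] (fun _ => (1 : ℂ)))
    (hinf : ∀ i k, Tendsto (fun μ => bracket X Z i k μ - e i k μ) d.atInfty (𝓝 0)) :
    ∀ μ ∈ d.good,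
      bracket X Z 0 0 μ = e 0 0 μ + κ / (μ - 1) - κ / (μ + 1) ∧
      bracket X Z 0 1 μ = e 0 1 μ + κ / (μ - 1) + κ / (μ + 1) ∧
      bracket X Z 1 0 μ = e 1 0 μ + κ / (μ - 1) + κ / (μ + 1) ∧
      bracket X Z 1 1 μ = e 1 1 μ + κ / (μ - 1) - κ / (μ + 1) := by
  set g : Fin 2 → Fin 2 → ℂ → ℂ := fun i k μ => bracket X Z i k μ - e i k μ with hg
  have hgneg : ∀ μ ∈ d.good, g 0 0 μ = g 1 1 (-μ) ∧ g 0 1 μ = -g 1 0 (-μ) ∧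
      g 1 0 μ = -g 0 1 (-μ) ∧ g 1 1 μ = g 0 0 (-μ) := by
    intro μ hμ
    obtain ⟨b1, b2, b3, b4⟩ := hX.bracket_neg hZ hμ
    obtain ⟨c1, c2⟩ := hneg μ hμ
    obtain ⟨c3, c4⟩ := hneg (-μ) (d.neg_mem_good hμ)
    rw [neg_neg] at c3 c4
    refine ⟨?_, ?_, ?_, ?_⟩
    · linear_combination c3 - b4
    · linear_combination b3 - c4
    · linear_combination b2 - c2
    · linear_combination -c1 - b1
  have hginv : ∀ μ ∈ d.good, g 0 0 μ⁻¹ = -g 1 1 μ - 2 * κ ∧ g 0 1 μ⁻¹ = -g 1 0 μ := by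
    intro μ hμ
    obtain ⟨b1, b2, b3, b4⟩ := hX.bracket_inv hZ hμ
    obtain ⟨c1, c2⟩ := hinv μ hμ
    simp only [hg, b1, b2, c1, c2]
    refine ⟨?_, ?_⟩ <;> ring
  have hgI : ∀ i k, g i k =O[𝓝[d.testSet] (-I)] (fun _ => (1 : ℂ)) := by
    intro i k
    have hn := d.tendsto_neg_testSet (-I)
    rw [neg_neg] at hn
    have h := (hI (1 - i) (1 - k)).comp_tendsto hn
    rw [← isBigO_norm_left] at h ⊢
    refine h.congr' ?_ (Eventually.of_forall fun _ => rfl)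
    filter_upwards [self_mem_nhdsWithin] with μ hμ
    obtain ⟨h1, h2, h3, h4⟩ := hgneg μ hμ.2
    show ‖g (1 - i) (1 - k) (-μ)‖ = ‖g i k μ‖
    fin_cases i <;> fin_cases k <;> simp [h1, h2, h3, h4]
  have hsub : ∀ s : ℂ, Tendsto (fun μ : ℂ => μ - s) (𝓝[d.testSet] s) (𝓝 (s - s)) := fun s =>
    ((continuous_id.sub continuous_const).tendsto s).mono_left nhdsWithin_le_nhds
  have hopen : IsOpen (({0, I, -I} : Set ℂ)ᶜ) := (Set.toFinite _).isClosed.isOpen_compl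
  have he1 : ∀ i k, ∀ s ∉ ({0, I, -I} : Set ℂ), e i k =O[𝓝 s] (fun _ => (1 : ℂ)) :=
    fun i k s hs => (((he i k).differentiableAt (hopen.mem_nhds hs)).continuousAt.tendsto)
      |>.isBigO_one ℂ
  have h1mem : (1 : ℂ) ∉ ({0, I, -I} : Set ℂ) := by
    simp only [Set.mem_insert_iff, Set.mem_singleton_iff, not_or]
    exact ⟨one_ne_zero, fun h => by simpa using congrArg Complex.im h,
      fun h => by simpa using congrArg Complex.im h⟩
  have h2mem : (-1 : ℂ) ∉ ({0, I, -I} : Set ℂ) := by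
    simp only [Set.mem_insert_iff, Set.mem_singleton_iff, not_or]
    exact ⟨by norm_num, fun h => by simpa using congrArg Complex.im h,
      fun h => by simpa using congrArg Complex.im h⟩
  have hexp : ∀ i k, ∃ r0 r1 r2 : ℂ, ∀ μ ∈ d.good,
      g i k μ = r0 / μ + r1 / (μ - 1) + r2 / (μ + 1) := by
    intro i k
    have hmem : ∀ s ∈ special, s ∈ d.sing := fun s hs => d.special_subset_sing hs
    have hIs : I ∈ special := by simp [special]
    have hIs' : -I ∈ special := by simp [special]
    obtain ⟨r, hr⟩ := (hX.row i).exists_wronskian_eq (hZ.row k) (e := e i k)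
      ((he i k).mono fun z hz hz' => hz (by
        simp only [special, Finset.coe_insert, Finset.coe_singleton, Set.mem_insert_iff,
          Set.mem_singleton_iff] at hz' ⊢
        tauto)) (by
        intro s hs
        have hes := fun h => ((hsub s).isBigO_one ℂ).mul ((he1 i k s h).mono nhdsWithin_le_nhds)
        simp only [mul_one] at hes
        simp only [special, Finset.mem_insert, Finset.mem_singleton] at hs
        rcases hs with rfl | rfl | rfl | rfl | rfl
        · simpa only [sub_zero] using! h0 i k
        · refine ((hX.isBigO_one hZ i k).sub (hes h1mem)).congr_left fun μ => ?_
          simp only [bracket, wronskian]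
          ring
        · refine ((hX.isBigO_neg_one hZ i k).sub (hes h2mem)).congr_left fun μ => ?_
          simp only [bracket, wronskian]
          ring
        · simpa only [mul_one] using! ((hsub I).isBigO_one ℂ).mul (hI i k)
        · simpa only [mul_one] using! ((hsub (-I)).isBigO_one ℂ).mul (hgI i k)) (hinf i k)
    have := d.neBot_testSet I
    have := d.neBot_testSet (-I)
    have hev : ∀ s, ∀ᶠ μ in 𝓝[d.testSet] s, μ ∈ d.good := fun s =>
      eventually_nhdsWithin_of_forall fun _ h => h.2
    have hrI := d.residue_eq_zero hr hIs (d.nhdsWithin_testSet_le (hmem _ hIs)) (hev _) (hI i k)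
    have hrI' := d.residue_eq_zero hr hIs' (d.nhdsWithin_testSet_le (hmem _ hIs')) (hev _)
      (hgI i k)
    refine ⟨r 0, r 1, r (-1), fun μ hμ => ?_⟩
    have := hr μ hμ
    rw [sum_special, hrI, hrI', zero_div, zero_div, add_zero, add_zero] at this
    exact this
  have hne : ∀ μ ∈ d.good, μ ≠ 0 ∧ μ ≠ 1 ∧ μ ≠ -1 := fun μ hμ =>
    ⟨(d.good_ne hμ).1, (d.good_ne hμ).2.1, (d.good_ne hμ).2.2.1⟩
  obtain ⟨a0, a1, a2, ha⟩ := hexp 0 0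
  obtain ⟨b0, b1, b2, hb⟩ := hexp 1 1
  obtain ⟨c0, c1, c2, hc⟩ := hexp 0 1
  obtain ⟨l0, l1, l2, hl⟩ := hexp 1 0
  have hne' : ∀ μ ∈ d.good, μ ≠ 0 ∧ μ - 1 ≠ 0 ∧ μ + 1 ≠ 0 ∧ -μ - 1 ≠ 0 ∧ -μ + 1 ≠ 0 ∧
      μ⁻¹ - 1 ≠ 0 ∧ μ⁻¹ + 1 ≠ 0 := by
    intro μ hμ
    obtain ⟨h0, h1, h2⟩ := hne μ hμ
    have h1' : μ - 1 ≠ 0 := sub_ne_zero.2 h1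
    have h2' : μ + 1 ≠ 0 := fun h => h2 (eq_neg_of_add_eq_zero_left h)
    refine ⟨h0, h1', h2', fun h => h2' ?_, fun h => h1' ?_, fun h => h1' ?_, fun h => h2' ?_⟩
    · linear_combination -h
    · linear_combination -h
    · field_simp at h
      linear_combination -h
    · field_simp at h
      linear_combination h
  -- each symmetry is an identity between partial fractions
  obtain ⟨-, -, e1, e2, e3⟩ := eq_zero_of_eqOn_dense_of_eq d.dense_good hne
    (f := fun μ => g 1 1 μ - g 0 0 (-μ)) (a := 0) (b := 0) (r := b0 + a0) (s := b1 + a2)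
    (u := b2 + a1) (fun μ hμ => by simp only [(hgneg μ hμ).2.2.2, sub_self]) (fun μ hμ => by
      obtain ⟨n0, n1, n2, n3, n4, -⟩ := hne' μ hμ
      simp only [ha (-μ) (d.neg_mem_good hμ), hb μ hμ]
      rw [show -μ - 1 = -(μ + 1) by ring, show -μ + 1 = -(μ - 1) by ring]
      simp only [div_neg]
      field_simp
      ring)
  obtain ⟨-, -, e4, e5, e6⟩ := eq_zero_of_eqOn_dense_of_eq d.dense_good hne
    (f := fun μ => g 1 0 μ + g 0 1 (-μ)) (a := 0) (b := 0) (r := l0 - c0) (s := l1 - c2)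
    (u := l2 - c1) (fun μ hμ => by simp only [(hgneg μ hμ).2.2.1]; ring) (fun μ hμ => by
      obtain ⟨n0, n1, n2, n3, n4, -⟩ := hne' μ hμ
      simp only [hc (-μ) (d.neg_mem_good hμ), hl μ hμ]
      rw [show -μ - 1 = -(μ + 1) by ring, show -μ + 1 = -(μ - 1) by ring]
      simp only [div_neg]
      field_simp
      ring)
  have hinv1 : ∀ μ ∈ d.good, ∀ r0 r1 r2 : ℂ, r0 / μ⁻¹ + r1 / (μ⁻¹ - 1) + r2 / (μ⁻¹ + 1) =
      (r2 - r1) + r0 * μ - r1 / (μ - 1) - r2 / (μ + 1) := by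
    intro μ hμ r0 r1 r2
    obtain ⟨n0, n1, n2, n3, n4, n5, n6⟩ := hne' μ hμ
    have k1 : μ⁻¹ - 1 = -(μ - 1) / μ := by field_simp; ring
    have k2 : μ⁻¹ + 1 = (μ + 1) / μ := by field_simp; ring
    have k3 : -(μ - 1) ≠ 0 := neg_ne_zero.2 n1
    rw [k1, k2, div_inv_eq_mul, div_div_eq_mul_div, div_div_eq_mul_div, div_neg]
    field_simp
    ring
  obtain ⟨e7, e8, e9, e10, e11⟩ := eq_zero_of_eqOn_dense_of_eq d.dense_good hne
    (f := fun μ => g 0 0 μ⁻¹ + g 1 1 μ + 2 * κ) (a := a2 - a1 + 2 * κ) (b := a0) (r := b0)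
    (s := b1 - a1) (u := b2 - a2) (fun μ hμ => by simp only [(hginv μ hμ).1]; ring)
    (fun μ hμ => by
      simp only [ha μ⁻¹ (d.inv_mem_good hμ), hb μ hμ, hinv1 μ hμ]
      ring)
  obtain ⟨e12, e13, e14, e15, e16⟩ := eq_zero_of_eqOn_dense_of_eq d.dense_good hne
    (f := fun μ => g 0 1 μ⁻¹ + g 1 0 μ) (a := c2 - c1) (b := c0) (r := l0)
    (s := l1 - c1) (u := l2 - c2) (fun μ hμ => by simp only [(hginv μ hμ).2]; ring)
    (fun μ hμ => by
      simp only [hc μ⁻¹ (d.inv_mem_good hμ), hl μ hμ, hinv1 μ hμ]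
      ring)
  -- the linear relation between the residues at `1`
  have e17 : a1 - c1 - l1 + b1 = 0 := by
    have hne1 := d.neBot_upper (s := 1) (by simp)
    have hb1 : (fun μ => g 0 0 μ - g 0 1 μ - g 1 0 μ + g 1 1 μ) =O[d.upper 1]
        (fun _ => (1 : ℂ)) := by
      have k := fun i k => (he1 i k 1 h1mem).mono (nhdsWithin_le_nhds : d.upper 1 ≤ 𝓝 1)
      refine ((hX.isBigO_upper_one_sum hZ).sub ((((k 0 0).sub (k 0 1)).sub (k 1 0)).add
        (k 1 1))).congr_left fun μ => ?_
      simp only [hg]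
      ring
    refine d.residue_eq_zero (g := fun μ => g 0 0 μ - g 0 1 μ - g 1 0 μ + g 1 1 μ)
      (r := fun s => if s = 0 then a0 - c0 - l0 + b0 else if s = 1 then a1 - c1 - l1 + b1 else
        if s = -1 then a2 - c2 - l2 + b2 else 0) (s := 1) (fun μ hμ => ?_) (by simp [special])
      (d.upper_le (by simp)) (d.eventually_good_upper (by simp)) hb1 |> fun h => by simpa using h
    rw [sum_special]
    have k1 : I ≠ 1 := fun h => by simpa using congrArg Complex.im h
    have k2 : -I ≠ 1 := fun h => by simpa using congrArg Complex.im h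
    have k3 : I ≠ -1 := fun h => by simpa using congrArg Complex.im h
    have k4 : -I ≠ -1 := fun h => by simpa using congrArg Complex.im h
    have k5 : (-1 : ℂ) ≠ 1 := by norm_num
    simp only [if_true, if_neg k1, if_neg k2, if_neg k3, if_neg k4, if_neg k5, one_ne_zero,
      neg_ne_zero.2 (one_ne_zero : (1 : ℂ) ≠ 0), I_ne_zero, neg_ne_zero.2 I_ne_zero, if_false,
      ha μ hμ, hb μ hμ, hc μ hμ, hl μ hμ]
    ring
  have f1 : a1 = κ := by linear_combination -e7 / 2 + e2 / 2 - e10 / 2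
  have f2 : a2 = -κ := by linear_combination e2 - e10 - f1
  have f3 : b1 = κ := by linear_combination e10 + f1
  have f4 : b2 = -κ := by linear_combination e11 + f2
  have f5 : c1 = κ := by linear_combination (-e17 - e15 + f1 + f3) / 2
  have f6 : c2 = κ := by linear_combination e12 + f5
  have f7 : l1 = κ := by linear_combination e15 + f5
  have f8 : l2 = κ := by linear_combination e16 + f6
  intro μ hμ
  have ga := ha μ hμ
  have gb := hb μ hμ
  have gc := hc μ hμ
  have gl := hl μ hμ
  rw [e8, f1, f2] at ga
  rw [e9, f3, f4] at gb
  rw [e13, f5, f6] at gc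
  rw [e14, f7, f8] at gl
  simp only [hg] at ga gb gc gl
  refine ⟨?_, ?_, ?_, ?_⟩
  · linear_combination ga
  · linear_combination gc
  · linear_combination gl
  · linear_combination gb

/-! ### Differentiation in the parameters -/

/-- The diagonal of `σ₃`. -/
def sgn : Fin 2 → ℂ := ![1, -1]

/-- `N' - q' N σ₃`: if `N'` and `q'` are the derivatives of `N` and of the phase `p` with respect
to a parameter, this is `(N exp (-p σ₃))' exp (p σ₃)`. -/
def twist (q' : ℂ → ℂ) (N N' : ℂ → Mat) (μ : ℂ) : Mat :=
  Matrix.of fun i j => N' μ i j - q' μ * sgn j * N μ i j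

/-- `∂p/∂y`. -/
noncomputable def phaseY (μ : ℂ) : ℂ := I * (μ ^ 2 - 1) / (4 * μ)

/-- `∂p/∂t`. -/
noncomputable def phaseT (μ : ℂ) : ℂ := -(2 * I * (μ ^ 2 - 1) * μ / (μ ^ 2 + 1) ^ 2)

theorem hasDerivAt_phase_y (y t : ℝ) (μ : ℂ) :
    HasDerivAt (fun s : ℝ => phase s t μ) (phaseY μ) y := by
  have h1 : HasDerivAt (fun s : ℝ => (s : ℂ)) 1 y := Complex.ofRealCLM.hasDerivAt
  have h2 := ((h1.neg).add_const (8 * μ ^ 2 / (μ ^ 2 + 1) ^ 2 * (t : ℂ))).const_mul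
    (-(I * (μ ^ 2 - 1) / (4 * μ)))
  refine h2.congr_deriv ?_
  rw [phaseY]
  ring

theorem hasDerivAt_phase_t (y t : ℝ) (μ : ℂ) :
    HasDerivAt (fun s : ℝ => phase y s μ) (phaseT μ) t := by
  have h1 : HasDerivAt (fun s : ℝ => (s : ℂ)) 1 t := Complex.ofRealCLM.hasDerivAt
  have h2 := ((h1.const_mul (8 * μ ^ 2 / (μ ^ 2 + 1) ^ 2)).const_add (-(y : ℂ))).const_mul
    (-(I * (μ ^ 2 - 1) / (4 * μ)))
  refine h2.congr_deriv ?_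
  rw [phaseT]
  rcases eq_or_ne μ 0 with rfl | h
  · simp
  · have h3 : μ * μ⁻¹ = 1 := mul_inv_cancel₀ h
    linear_combination -(2 * I * (μ ^ 2 - 1) * μ / (μ ^ 2 + 1) ^ 2) * h3

theorem expPauli3_conj_apply (p : ℂ) (A : Mat) (k j : Fin 2) :
    (expPauli3 (-p) * A * expPauli3 p) k j = exp ((sgn j - sgn k) * p) * A k j := by
  have h1 : exp (-p) * exp p = 1 := by rw [← Complex.exp_add]; simp
  rw [Matrix.eta_fin_two A]
  fin_cases k <;> fin_cases j <;> simp [expPauli3, sgn]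
  · linear_combination A 0 0 * h1
  · rw [show (-1 - 1) * p = -p + -p by ring, Complex.exp_add]; ring
  · rw [show (1 + 1) * p = p + p by ring, Complex.exp_add]; ring
  · linear_combination A 1 1 * h1

/-- The derivative of a jump relation: the commutator terms from the conjugation by `exp (p σ₃)`
are absorbed by the correction `-p' P σ₃`. -/
theorem deriv_jump {P Q : ℝ → Mat} {p : ℝ → ℂ} {p' : ℂ} {A : Mat} {s₀ : ℝ}
    (h : ∀ᶠ s in 𝓝 s₀, P s = Q s * (expPauli3 (-p s) * A * expPauli3 (p s)))
    (hQ : ∀ i j, DifferentiableAt ℝ (fun s => Q s i j) s₀) (hp : HasDerivAt p p' s₀) (i : Fin 2) :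
    (fun j => deriv (fun s => P s i j) s₀ - p' * sgn j * P s₀ i j) =
      (fun j => deriv (fun s => Q s i j) s₀ - p' * sgn j * Q s₀ i j) ᵥ*
        (expPauli3 (-p s₀) * A * expPauli3 (p s₀)) := by
  funext j
  have e : (fun s => P s i j) =ᶠ[𝓝 s₀] fun s =>
      ∑ k, Q s i k * (exp ((sgn j - sgn k) * p s) * A k j) := by
    filter_upwards [h] with s hs
    rw [hs, Matrix.mul_apply]
    simp only [expPauli3_conj_apply]
  have hd : HasDerivAt (fun s => ∑ k, Q s i k * (exp ((sgn j - sgn k) * p s) * A k j))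
      (∑ k, (deriv (fun s => Q s i k) s₀ * (exp ((sgn j - sgn k) * p s₀) * A k j) +
        Q s₀ i k * (exp ((sgn j - sgn k) * p s₀) * ((sgn j - sgn k) * p') * A k j))) s₀ :=
    HasDerivAt.fun_sum fun k _ =>
      (hQ i k).hasDerivAt.mul (((hp.const_mul (sgn j - sgn k)).cexp).mul_const (A k j))
  rw [e.deriv_eq, hd.deriv, show P s₀ i j = _ from e.self_of_nhds]
  simp only [Matrix.vecMul, dotProduct, expPauli3_conj_apply, Fin.sum_univ_two]
  ring

namespace RHData

variable (d : RHData)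

/-- `N'` has the properties of the derivative of a solution `N` with respect to one of the
parameters, at the point `(y, t)`, where `q'` is the corresponding derivative of the phase and `ν'`
that of the coefficient of the singularity at `1`. -/
structure IsVariation (y t : ℝ) (q' : ℂ → ℂ) (ν' : ℂ) (N N' : ℂ → Mat) : Prop where
  differentiableOn : ∀ i j, DifferentiableOn ℂ (fun μ => N' μ i j) (d.dom j)
  jump : ∀ μ₀ ∈ d.jumpSet, ∃ P P' Q Q' : Mat,
    (∀ i j, Tendsto (fun μ => N μ i j) (𝓝[d.D₁] μ₀) (𝓝 (P i j))) ∧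
    (∀ i j, Tendsto (fun μ => N' μ i j) (𝓝[d.D₁] μ₀) (𝓝 (P' i j))) ∧
    (∀ i j, Tendsto (fun μ => N μ i j) (𝓝[d.D₂] μ₀) (𝓝 (Q i j))) ∧
    (∀ i j, Tendsto (fun μ => N' μ i j) (𝓝[d.D₂] μ₀) (𝓝 (Q' i j))) ∧
    ∀ i, (fun j => P' i j - q' μ₀ * sgn j * P i j) =
      (fun j => Q' i j - q' μ₀ * sgn j * Q i j) ᵥ* d.J y t μ₀
  bounded : ∀ ζ : ℂ, (ζ ∈ d.nodes ∨ ζ = I ∨ ζ = -I) → ζ ≠ 0 → ζ ≠ 1 → ζ ≠ -1 →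
    ∀ i j, (fun μ => N' μ i j) =O[𝓝[d.Γᶜ] ζ] (fun _ => (1 : ℂ))
  normalized : ∀ i j, (fun μ => N' μ i j) =O[d.atInfty] (fun μ => μ⁻¹)
  neg : ∀ μ ∈ d.good, N' (-μ) = !![N' μ 1 1, -N' μ 1 0; -N' μ 0 1, N' μ 0 0]
  inv : ∀ μ ∈ d.good, N' μ⁻¹ = !![N' μ 1 1, N' μ 1 0; N' μ 0 1, N' μ 0 0]
  one : ∀ i j, (fun μ => N' μ i j - ν' * (![-d.c, 1] : Fin 2 → ℂ) j / (μ - 1))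
    =O[d.upper 1] (fun _ => (1 : ℂ))
  residue₁ : ∀ μ₀ ∈ d.poles, ∀ i, Tendsto (fun μ => (μ - μ₀) * N' μ i 0) (𝓝[≠] μ₀)
    (𝓝 (d.coef μ₀ * exp (2 * phase y t μ₀) * (N' μ₀ i 1 + 2 * q' μ₀ * N μ₀ i 1)))
  residue₂ : ∀ μ₀ ∈ d.poles, ∀ i, Tendsto (fun μ => (μ - (starRingEnd ℂ) μ₀) * N' μ i 1)
    (𝓝[≠] ((starRingEnd ℂ) μ₀)) (𝓝 ((starRingEnd ℂ) (d.coef μ₀) *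
      exp (-(2 * phase y t ((starRingEnd ℂ) μ₀))) * (N' ((starRingEnd ℂ) μ₀) i 0 -
        2 * q' ((starRingEnd ℂ) μ₀) * N ((starRingEnd ℂ) μ₀) i 0)))

variable {d} {Ω : Set (ℝ × ℝ)} {α : ℝ → ℝ → ℝ} {M : ℝ → ℝ → ℂ → Mat}

theorem mem_dom_of_mem_good {μ : ℂ} (h : μ ∈ d.good) (j : Fin 2) : μ ∈ d.dom j :=
  (d.mem_dom_of_not_mem_sing h.1 h.2 j).1

theorem mem_regular_of_mem_good {μ : ℂ} (h : μ ∈ d.good) : μ ∈ d.regular :=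
  ⟨mem_dom_of_mem_good h 0, mem_dom_of_mem_good h 1⟩

theorem pauli2_conj (X : Mat) : pauli2 * X * pauli2 = !![X 1 1, -X 1 0; -X 0 1, X 0 0] := by
  have h : I * I = -1 := I_mul_I
  rw [Matrix.eta_fin_two X]
  ext i j
  fin_cases i <;> fin_cases j <;> simp [pauli2]
  · linear_combination -X 1 1 * h
  · linear_combination X 1 0 * h
  · linear_combination X 0 1 * h
  · linear_combination -X 0 0 * h

theorem pauli1_conj (X : Mat) : pauli1 * X * pauli1 = !![X 1 1, X 1 0; X 0 1, X 0 0] := by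
  rw [Matrix.eta_fin_two X]
  ext i j
  fin_cases i <;> fin_cases j <;> simp [pauli1]

theorem singOne_apply (a : ℝ) (i j : Fin 2) :
    d.singOne a i j = I * a / 2 * (![-d.c, 1] : Fin 2 → ℂ) j := by
  fin_cases i <;> fin_cases j <;> simp [singOne]

theorem IsSolution.neg (hM : d.IsSolution Ω α M) {y t : ℝ} (h : (y, t) ∈ Ω) {μ : ℂ}
    (hμ : μ ∈ d.good) :
    M y t (-μ) = !![M y t μ 1 1, -M y t μ 1 0; -M y t μ 0 1, M y t μ 0 0] := by
  rw [hM.symm_neg y t h μ (mem_regular_of_mem_good hμ), pauli2_conj]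

theorem IsSolution.inv (hM : d.IsSolution Ω α M) {y t : ℝ} (h : (y, t) ∈ Ω) {μ : ℂ}
    (hμ : μ ∈ d.good) :
    M y t μ⁻¹ = !![M y t μ 1 1, M y t μ 1 0; M y t μ 0 1, M y t μ 0 0] := by
  rw [hM.symm_inv y t h μ (mem_regular_of_mem_good hμ) (d.good_ne hμ).1, pauli1_conj]

theorem not_mem_special {ζ : ℂ} (h : ζ ∉ special) : ζ ≠ 0 ∧ ζ ≠ 1 ∧ ζ ≠ -1 ∧ ζ ≠ I ∧ ζ ≠ -I := by
  simpa only [special, Finset.mem_insert, Finset.mem_singleton, not_or] using h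

theorem IsSolution.isFrame (hM : d.IsSolution Ω α M) {y t : ℝ} (h : (y, t) ∈ Ω) :
    d.IsFrame y t (I * α y t / 2) (M y t) where
  row i :=
    { differentiableOn := fun j => ((hM.analytic y t h i j).1).mono Set.sdiff_subset
      jump := fun μ₀ hμ₀ => by
        obtain ⟨P, Q, hP, hQ, hPQ⟩ := hM.jump μ₀ hμ₀
        refine ⟨P y t i, Q y t i, fun j => ((hP i j).2 y t h).1, fun j => ((hQ i j).2 y t h).1, ?_⟩
        rw [hPQ y t h]
        rfl
      bounded := fun ζ hζ hs j => by
        obtain ⟨h0, h1, h2, -⟩ := not_mem_special hs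
        exact (hM.bounded ζ (Or.inl hζ) h0 h1 h2 i j y t h).1
      residue₁ := fun μ₀ hμ₀ => ((hM.residue₁ μ₀ hμ₀ i).2 y t h).1
      residue₂ := fun μ₀ hμ₀ => ((hM.residue₂ μ₀ hμ₀ i).2 y t h).1 }
  neg _ hμ := hM.neg h hμ
  inv _ hμ := hM.inv h hμ
  one i j := by
    refine (hM.sing_one i j y t h).1.congr_left fun μ => ?_
    simp only [singOne_apply]

theorem deriv_eq_of_neg {f g : ℝ → Mat} {s₀ : ℝ}
    (h : ∀ᶠ s in 𝓝 s₀, f s = !![g s 1 1, -g s 1 0; -g s 0 1, g s 0 0]) :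
    (Matrix.of fun i j => deriv (fun s => f s i j) s₀) =
      !![deriv (fun s => g s 1 1) s₀, -deriv (fun s => g s 1 0) s₀;
        -deriv (fun s => g s 0 1) s₀, deriv (fun s => g s 0 0) s₀] := by
  have e : ∀ i j, (fun s => f s i j) =ᶠ[𝓝 s₀]
      fun s => (!![g s 1 1, -g s 1 0; -g s 0 1, g s 0 0] : Mat) i j := fun i j =>
    h.mono fun s hs => by simp only [hs]
  ext i j
  rw [of_apply, (e i j).deriv_eq]
  fin_cases i <;> fin_cases j <;> simp

theorem deriv_eq_of_inv {f g : ℝ → Mat} {s₀ : ℝ}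
    (h : ∀ᶠ s in 𝓝 s₀, f s = !![g s 1 1, g s 1 0; g s 0 1, g s 0 0]) :
    (Matrix.of fun i j => deriv (fun s => f s i j) s₀) =
      !![deriv (fun s => g s 1 1) s₀, deriv (fun s => g s 1 0) s₀;
        deriv (fun s => g s 0 1) s₀, deriv (fun s => g s 0 0) s₀] := by
  have e : ∀ i j, (fun s => f s i j) =ᶠ[𝓝 s₀]
      fun s => (!![g s 1 1, g s 1 0; g s 0 1, g s 0 0] : Mat) i j := fun i j =>
    h.mono fun s hs => by simp only [hs]
  ext i j
  rw [of_apply, (e i j).deriv_eq]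
  fin_cases i <;> fin_cases j <;> simp

theorem IsSolution.isVariation_y (hΩ : IsOpen Ω) (hM : d.IsSolution Ω α M) {y t : ℝ}
    (h : (y, t) ∈ Ω) :
    d.IsVariation y t phaseY (I * (deriv (fun s => α s t) y : ℝ) / 2) (M y t)
      (fun μ => Matrix.of fun i j => deriv (fun s => M s t μ i j) y) := by
  have hev : ∀ᶠ s in 𝓝 y, (s, t) ∈ Ω :=
    (Continuous.prodMk_left t).continuousAt.eventually (hΩ.mem_nhds h)
  refine ⟨fun i j => (hM.analytic y t h i j).2.1, ?_, ?_, ?_, ?_, ?_, ?_, ?_, ?_⟩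
  · intro μ₀ hμ₀
    obtain ⟨P, Q, hP, hQ, hPQ⟩ := hM.jump μ₀ hμ₀
    refine ⟨P y t, Matrix.of fun i j => deriv (fun s => P s t i j) y, Q y t,
      Matrix.of fun i j => deriv (fun s => Q s t i j) y, fun i j => ((hP i j).2 y t h).1,
      fun i j => ((hP i j).2 y t h).2.1, fun i j => ((hQ i j).2 y t h).1,
      fun i j => ((hQ i j).2 y t h).2.1, fun i => ?_⟩
    exact deriv_jump (P := fun s => P s t) (Q := fun s => Q s t) (hev.mono fun s hs => hPQ s t hs)
      (fun i j => ((hQ i j).1 y t h).1) (hasDerivAt_phase_y y t μ₀) i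
  · intro ζ hζ h0 h1 h2 i j
    exact (hM.bounded ζ hζ h0 h1 h2 i j y t h).2.1
  · intro i j
    refine (hM.normalized i j y t h).2.1.congr_left fun μ => ?_
    simp only [dY, deriv_sub_const_fun, of_apply]
  · exact fun μ hμ => deriv_eq_of_neg (f := fun s => M s t (-μ)) (g := fun s => M s t μ)
      (hev.mono fun s hs => hM.neg hs hμ)
  · exact fun μ hμ => deriv_eq_of_inv (f := fun s => M s t μ⁻¹) (g := fun s => M s t μ)
      (hev.mono fun s hs => hM.inv hs hμ)
  · intro i j
    refine (hM.sing_one i j y t h).2.1.congr' ?_ EventuallyEq.rfl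
    filter_upwards [d.eventually_good_upper (s := 1) (by simp)] with μ hμ
    have h1 := ((hM.diff_param i j μ (mem_dom_of_mem_good hμ j)) y t h).1.hasDerivAt
    have h2 := ((hM.diff_α y t h).1.hasDerivAt).ofReal_comp
    have h3 := h1.sub ((((h2.const_mul I).div_const 2).mul_const
      ((![-d.c, 1] : Fin 2 → ℂ) j)).div_const (μ - 1))
    simp only [dY, singOne_apply, of_apply]
    exact h3.deriv
  · intro μ₀ hμ₀ i
    have h0 := ((hM.residue₁ μ₀ hμ₀ i).2 y t h).2.1
    have h1 := ((hM.diff_param i 1 μ₀ (d.pole_mem_dom_one hμ₀)) y t h).1.hasDerivAt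
    have h2 := ((((hasDerivAt_phase_y y t μ₀).const_mul 2).cexp).const_mul (d.coef μ₀)).mul h1
    exact le_trans (h0.congr fun μ => deriv_const_mul_field _)
      (congrArg 𝓝 (h2.deriv.trans (by simp only [of_apply]; ring))).le
  · intro μ₀ hμ₀ i
    have h0 := ((hM.residue₂ μ₀ hμ₀ i).2 y t h).2.1
    have h1 := ((hM.diff_param i 0 _ (d.conj_pole_mem_dom_zero hμ₀)) y t h).1.hasDerivAt
    have h2 := ((((hasDerivAt_phase_y y t ((starRingEnd ℂ) μ₀)).const_mul 2).fun_neg.cexp).const_mul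
      ((starRingEnd ℂ) (d.coef μ₀))).mul h1
    exact le_trans (h0.congr fun μ => deriv_const_mul_field _)
      (congrArg 𝓝 (h2.deriv.trans (by simp only [of_apply]; ring))).le

theorem IsSolution.isVariation_t (hΩ : IsOpen Ω) (hM : d.IsSolution Ω α M) {y t : ℝ}
    (h : (y, t) ∈ Ω) :
    d.IsVariation y t phaseT (I * (deriv (fun s => α y s) t : ℝ) / 2) (M y t)
      (fun μ => Matrix.of fun i j => deriv (fun s => M y s μ i j) t) := by
  have hev : ∀ᶠ s in 𝓝 t, (y, s) ∈ Ω :=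
    (Continuous.prodMk_right y).continuousAt.eventually (hΩ.mem_nhds h)
  refine ⟨fun i j => (hM.analytic y t h i j).2.2, ?_, ?_, ?_, ?_, ?_, ?_, ?_, ?_⟩
  · intro μ₀ hμ₀
    obtain ⟨P, Q, hP, hQ, hPQ⟩ := hM.jump μ₀ hμ₀
    refine ⟨P y t, Matrix.of fun i j => deriv (fun s => P y s i j) t, Q y t,
      Matrix.of fun i j => deriv (fun s => Q y s i j) t, fun i j => ((hP i j).2 y t h).1,
      fun i j => ((hP i j).2 y t h).2.2, fun i j => ((hQ i j).2 y t h).1,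
      fun i j => ((hQ i j).2 y t h).2.2, fun i => ?_⟩
    exact deriv_jump (P := fun s => P y s) (Q := fun s => Q y s) (hev.mono fun s hs => hPQ y s hs)
      (fun i j => ((hQ i j).1 y t h).2) (hasDerivAt_phase_t y t μ₀) i
  · intro ζ hζ h0 h1 h2 i j
    exact (hM.bounded ζ hζ h0 h1 h2 i j y t h).2.2
  · intro i j
    refine (hM.normalized i j y t h).2.2.congr_left fun μ => ?_
    simp only [dT, deriv_sub_const_fun, of_apply]
  · exact fun μ hμ => deriv_eq_of_neg (f := fun s => M y s (-μ)) (g := fun s => M y s μ)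
      (hev.mono fun s hs => hM.neg hs hμ)
  · exact fun μ hμ => deriv_eq_of_inv (f := fun s => M y s μ⁻¹) (g := fun s => M y s μ)
      (hev.mono fun s hs => hM.inv hs hμ)
  · intro i j
    refine (hM.sing_one i j y t h).2.2.congr' ?_ EventuallyEq.rfl
    filter_upwards [d.eventually_good_upper (s := 1) (by simp)] with μ hμ
    have h1 := ((hM.diff_param i j μ (mem_dom_of_mem_good hμ j)) y t h).2.hasDerivAt
    have h2 := ((hM.diff_α y t h).2.hasDerivAt).ofReal_comp
    have h3 := h1.sub ((((h2.const_mul I).div_const 2).mul_const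
      ((![-d.c, 1] : Fin 2 → ℂ) j)).div_const (μ - 1))
    simp only [dT, singOne_apply, of_apply]
    exact h3.deriv
  · intro μ₀ hμ₀ i
    have h0 := ((hM.residue₁ μ₀ hμ₀ i).2 y t h).2.2
    have h1 := ((hM.diff_param i 1 μ₀ (d.pole_mem_dom_one hμ₀)) y t h).2.hasDerivAt
    have h2 := ((((hasDerivAt_phase_t y t μ₀).const_mul 2).cexp).const_mul (d.coef μ₀)).mul h1
    exact le_trans (h0.congr fun μ => deriv_const_mul_field _)
      (congrArg 𝓝 (h2.deriv.trans (by simp only [of_apply]; ring))).le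
  · intro μ₀ hμ₀ i
    have h0 := ((hM.residue₂ μ₀ hμ₀ i).2 y t h).2.2
    have h1 := ((hM.diff_param i 0 _ (d.conj_pole_mem_dom_zero hμ₀)) y t h).2.hasDerivAt
    have h2 := ((((hasDerivAt_phase_t y t ((starRingEnd ℂ) μ₀)).const_mul 2).fun_neg.cexp).const_mul
      ((starRingEnd ℂ) (d.coef μ₀))).mul h1
    exact le_trans (h0.congr fun μ => deriv_const_mul_field _)
      (congrArg 𝓝 (h2.deriv.trans (by simp only [of_apply]; ring))).le

/-- The correction `-q' N σ₃` turns the differentiated jump and residue relations into those of `N`;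
at `1` it is bounded, as `q'` vanishes there. -/
theorem IsVariation.isFrame {y t : ℝ} {q' : ℂ → ℂ} {ν ν' : ℂ} {N N' : ℂ → Mat}
    (hN' : d.IsVariation y t q' ν' N N') (hN : d.IsFrame y t ν N)
    (hq : DifferentiableOn ℂ q' ({0, I, -I} : Set ℂ)ᶜ) (hneg : ∀ μ, q' (-μ) = -q' μ)
    (hinv : ∀ μ, q' μ⁻¹ = -q' μ) (hone : q' =O[𝓝 1] (fun μ => μ - 1)) :
    d.IsFrame y t ν' (twist q' N N') := by
  have hopen : IsOpen (({0, I, -I} : Set ℂ)ᶜ) := (Set.toFinite _).isClosed.isOpen_compl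
  have hqc : ∀ s ∉ ({0, I, -I} : Set ℂ), Tendsto q' (𝓝 s) (𝓝 (q' s)) := fun s hs =>
    (hq.differentiableAt (hopen.mem_nhds hs)).continuousAt.tendsto
  have hsp : ∀ s ∉ special, s ∉ ({0, I, -I} : Set ℂ) := by
    intro s hs
    obtain ⟨h0, -, -, h3, h4⟩ := not_mem_special hs
    simp only [Set.mem_insert_iff, Set.mem_singleton_iff]
    tauto
  refine ⟨fun i => ⟨fun j => ?_, fun μ₀ hμ₀ => ?_, fun ζ hζ hs j => ?_, fun μ₀ hμ₀ => ?_,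
    fun μ₀ hμ₀ => ?_⟩, fun μ hμ => ?_, fun μ hμ => ?_, fun i j => ?_⟩
  · exact ((hN'.differentiableOn i j).mono Set.sdiff_subset).sub
      (((hq.mono fun _ h => h.2).mul_const _).mul ((hN.row i).differentiableOn j))
  · obtain ⟨P, P', Q, Q', hP, hP', hQ, hQ', h⟩ := hN'.jump μ₀ hμ₀
    have hμs : μ₀ ∉ ({0, I, -I} : Set ℂ) := by
      obtain ⟨-, -, h0, -, -, h3, h4⟩ := hμ₀
      simp only [Set.mem_insert_iff, Set.mem_singleton_iff]
      tauto
    exact ⟨_, _,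
      fun j => (hP' i j).sub ((((hqc _ hμs).mono_left nhdsWithin_le_nhds).mul_const _).mul (hP i j)),
      fun j => (hQ' i j).sub ((((hqc _ hμs).mono_left nhdsWithin_le_nhds).mul_const _).mul (hQ i j)),
      h i⟩
  · obtain ⟨h0, h1, h2, -⟩ := not_mem_special hs
    have hb := (((hqc ζ (hsp ζ hs)).mono_left (nhdsWithin_le_nhds (s := d.Γᶜ))).mul_const
      (sgn j)).isBigO_one ℂ
    simpa using! (hN'.bounded ζ (Or.inl hζ) h0 h1 h2 i j).sub
      ((hb.mul ((hN.row i).bounded ζ hζ hs j)).congr_right fun _ => one_mul 1)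
  · have hc := (hqc μ₀ (hsp μ₀ (d.pole_not_mem_special hμ₀))).mono_left
      (nhdsWithin_le_nhds (s := {μ₀}ᶜ))
    have h1 := (hN'.residue₁ μ₀ hμ₀ i).sub (hc.mul ((hN.row i).residue₁ μ₀ hμ₀))
    refine le_trans (h1.congr fun μ => ?_) (congrArg 𝓝 ?_).le
    · simp only [twist, sgn, of_apply, cons_val_zero]
      ring
    · simp only [twist, sgn, of_apply, cons_val_one, cons_val_fin_one]
      ring
  · have hc := (hqc _ (hsp _ (d.conj_pole_not_mem_special hμ₀))).mono_left
      (nhdsWithin_le_nhds (s := {(starRingEnd ℂ) μ₀}ᶜ))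
    have h1 := (hN'.residue₂ μ₀ hμ₀ i).add (hc.mul ((hN.row i).residue₂ μ₀ hμ₀))
    refine le_trans (h1.congr fun μ => ?_) (congrArg 𝓝 ?_).le
    · simp only [twist, sgn, of_apply, cons_val_one, cons_val_fin_one]
      ring
    · simp only [twist, sgn, of_apply, cons_val_zero]
      ring
  · ext i j
    fin_cases i <;> fin_cases j <;> simp [twist, sgn, hN.neg μ hμ, hN'.neg μ hμ, hneg] <;> ring
  · ext i j
    fin_cases i <;> fin_cases j <;> simp [twist, sgn, hN.inv μ hμ, hN'.inv μ hμ, hinv, sub_eq_add_neg]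
  · have hq1 := hone.mono (nhdsWithin_le_nhds : d.upper 1 ≤ 𝓝 1)
    have hq0 : q' =O[d.upper 1] (fun _ => (1 : ℂ)) :=
      hq1.trans ((d.tendsto_sub_upper 1).isBigO_one ℂ)
    have h1 : (fun μ => q' μ * N μ i j) =O[d.upper 1] (fun _ => (1 : ℂ)) := by
      have h2 : (fun μ => q' μ * (ν * (![-d.c, 1] : Fin 2 → ℂ) j / (μ - 1))) =O[d.upper 1]
          (fun _ => (1 : ℂ)) := by
        refine (hq1.mul (isBigO_refl (fun μ => ν * (![-d.c, 1] : Fin 2 → ℂ) j / (μ - 1))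
          _)).trans ?_
        refine (isBigO_const_const (ν * (![-d.c, 1] : Fin 2 → ℂ) j) (one_ne_zero (α := ℂ))
          _).congr' ?_ EventuallyEq.rfl
        filter_upwards [d.eventually_ne_upper (s := 1) (by simp)] with μ hμ
        have : μ - 1 ≠ 0 := sub_ne_zero.2 hμ
        field_simp
      refine ((hq0.mul (hN.one i j)).congr_right fun _ => by simp).add h2 |>.congr_left
        fun μ => ?_
      ring
    refine ((hN'.one i j).sub (h1.const_mul_left (sgn j))).congr_left fun μ => ?_
    simp only [twist, of_apply]
    ring

end RHData

/-! ### The phase -/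

theorem phaseY_neg (μ : ℂ) : phaseY (-μ) = -phaseY μ := by
  rw [phaseY, phaseY, neg_sq, mul_neg, div_neg]

theorem phaseY_inv (μ : ℂ) : phaseY μ⁻¹ = -phaseY μ := by
  rcases eq_or_ne μ 0 with rfl | h
  · simp [phaseY]
  · simp only [phaseY]
    field_simp
    ring

theorem phaseT_neg (μ : ℂ) : phaseT (-μ) = -phaseT μ := by
  rw [phaseT, phaseT, neg_sq, mul_neg, neg_div]

theorem phaseT_inv (μ : ℂ) : phaseT μ⁻¹ = -phaseT μ := by
  rcases eq_or_ne μ 0 with rfl | h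
  · simp [phaseT]
  · have e : μ⁻¹ ^ 2 + 1 = (μ ^ 2 + 1) / μ ^ 2 := by field_simp; ring
    simp only [phaseT]
    rw [e]
    rcases eq_or_ne (μ ^ 2 + 1) 0 with h1 | h1
    · simp [h1]
    · field_simp
      ring

theorem sq_add_one_ne_zero {μ : ℂ} (h1 : μ ≠ I) (h2 : μ ≠ -I) : μ ^ 2 + 1 ≠ 0 := by
  have e : μ ^ 2 + 1 = (μ - I) * (μ - -I) := by linear_combination I_sq
  rw [e]
  exact mul_ne_zero (sub_ne_zero.2 h1) (sub_ne_zero.2 h2)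

theorem differentiableOn_phaseY : DifferentiableOn ℂ phaseY ({0}ᶜ : Set ℂ) := by
  unfold phaseY
  refine DifferentiableOn.div (by fun_prop) (by fun_prop) fun μ hμ => ?_
  exact mul_ne_zero (by norm_num) hμ

theorem differentiableOn_phaseT : DifferentiableOn ℂ phaseT ({I, -I}ᶜ : Set ℂ) := by
  unfold phaseT
  refine (DifferentiableOn.div (by fun_prop) (by fun_prop) fun μ hμ => ?_).fun_neg
  simp only [Set.mem_compl_iff, Set.mem_insert_iff, Set.mem_singleton_iff, not_or] at hμ
  exact pow_ne_zero _ (sq_add_one_ne_zero hμ.1 hμ.2)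

theorem phaseY_isBigO_one : phaseY =O[𝓝 1] (fun μ => μ - 1) := by
  have h := (differentiableOn_phaseY.differentiableAt
    (isOpen_ne.mem_nhds (one_ne_zero (α := ℂ)))).isBigO_sub
  refine h.congr_left fun μ => ?_
  simp [phaseY]

theorem phaseT_isBigO_one : phaseT =O[𝓝 1] (fun μ => μ - 1) := by
  have hopen : IsOpen (({I, -I} : Set ℂ)ᶜ) := (Set.toFinite _).isClosed.isOpen_compl
  have h := (differentiableOn_phaseT.differentiableAt (hopen.mem_nhds (x := 1) (by
    simp only [Set.mem_compl_iff, Set.mem_insert_iff, Set.mem_singleton_iff, not_or]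
    exact ⟨fun h => by simpa using congrArg Complex.im h,
      fun h => by simpa using congrArg Complex.im h⟩))).isBigO_sub
  refine h.congr_left fun μ => ?_
  simp [phaseT]

namespace RHData

variable {d : RHData} {Ω : Set (ℝ × ℝ)} {α : ℝ → ℝ → ℝ} {M : ℝ → ℝ → ℂ → Mat} {y t : ℝ}

theorem IsSolution.isFrame_y (hΩ : IsOpen Ω) (hM : d.IsSolution Ω α M) (h : (y, t) ∈ Ω) :
    d.IsFrame y t (I * (deriv (fun s => α s t) y : ℝ) / 2) (twist phaseY (M y t)
      (fun μ => Matrix.of fun i j => deriv (fun s => M s t μ i j) y)) :=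
  (hM.isVariation_y hΩ h).isFrame (hM.isFrame h) (differentiableOn_phaseY.mono fun _ h h' =>
    h (Or.inl h')) phaseY_neg phaseY_inv phaseY_isBigO_one

theorem IsSolution.isFrame_t (hΩ : IsOpen Ω) (hM : d.IsSolution Ω α M) (h : (y, t) ∈ Ω) :
    d.IsFrame y t (I * (deriv (fun s => α y s) t : ℝ) / 2) (twist phaseT (M y t)
      (fun μ => Matrix.of fun i j => deriv (fun s => M y s μ i j) t)) :=
  (hM.isVariation_t hΩ h).isFrame (hM.isFrame h) (differentiableOn_phaseT.mono fun _ h h' =>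
    h (Or.inr h')) phaseT_neg phaseT_inv phaseT_isBigO_one

/-! ### The determinant of a solution -/

theorem neBot_atInfty : d.atInfty.NeBot := by
  refine inf_principal_neBot_iff.2 fun U hU => ?_
  obtain ⟨R, -, hR⟩ := hasBasis_cobounded_norm.mem_iff.1 hU
  obtain ⟨z, hz, hz'⟩ := d.dense_compl.inter_open_nonempty {z : ℂ | R < ‖z‖}
    (isOpen_lt continuous_const continuous_norm) ⟨((|R| + 1 : ℝ) : ℂ), by
      rw [Set.mem_ofPred_eq, Complex.norm_real, Real.norm_eq_abs, abs_of_pos (by positivity)]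
      linarith [le_abs_self R]⟩
  exact ⟨z, hR (le_of_lt (show R < ‖z‖ from hz)), hz'⟩

theorem eventually_good_atInfty : ∀ᶠ μ in d.atInfty, μ ∈ d.good := by
  have h1 : ∀ᶠ μ in Bornology.cobounded ℂ, μ ∉ d.sing :=
    Bornology.isBounded_def.1 d.sing.finite_toSet.isBounded
  filter_upwards [mem_inf_of_left h1, mem_inf_of_right (mem_principal_self _)] with μ h1 h2
  exact ⟨h2, h1⟩

theorem tendsto_inv_atInfty : Tendsto (fun μ : ℂ => μ⁻¹) d.atInfty (𝓝 0) :=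
  tendsto_inv₀_cobounded.mono_left inf_le_left

/-- The inversion carries bounds at infinity to bounds at `0`. -/
theorem isBigO_zero_of_atInfty {X : ℂ → Mat}
    (hinv : ∀ μ ∈ d.good, X μ⁻¹ = !![X μ 1 1, X μ 1 0; X μ 0 1, X μ 0 0])
    (h : ∀ i j, (fun μ => X μ i j) =O[d.atInfty] (fun _ => (1 : ℂ))) (i j : Fin 2) :
    (fun μ => X μ i j) =O[𝓝[d.testSet] 0] (fun _ => (1 : ℂ)) := by
  refine ((h (1 - i) (1 - j)).comp_tendsto d.tendsto_inv_testSet_zero).congr' ?_ EventuallyEq.rfl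
  filter_upwards [self_mem_nhdsWithin] with μ hμ
  simp only [Function.comp, hinv μ hμ.2]
  fin_cases i <;> fin_cases j <;> simp

theorem IsSolution.tendsto_atInfty (hM : d.IsSolution Ω α M) (h : (y, t) ∈ Ω) (i j : Fin 2) :
    Tendsto (fun μ => M y t μ i j) d.atInfty (𝓝 ((1 : Mat) i j)) := by
  have h1 := (hM.normalized i j y t h).1.trans_tendsto tendsto_inv_atInfty
  simpa using h1.add_const ((1 : Mat) i j)

theorem I_not_mem : I ≠ 0 ∧ I ≠ 1 ∧ I ≠ -1 :=
  ⟨I_ne_zero, fun h => by simpa using congrArg Complex.im h,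
    fun h => by simpa using congrArg Complex.im h⟩

theorem IsSolution.isBigO_I (hM : d.IsSolution Ω α M) (h : (y, t) ∈ Ω) (i j : Fin 2) :
    (fun μ => M y t μ i j) =O[𝓝[d.testSet] I] (fun _ => (1 : ℂ)) :=
  ((hM.bounded I (Or.inr (Or.inl rfl)) I_not_mem.1 I_not_mem.2.1 I_not_mem.2.2 i j y t h).1).mono
    (nhdsWithin_mono _ d.testSet_subset_compl)

theorem IsSolution.isBigO_zero (hM : d.IsSolution Ω α M) (h : (y, t) ∈ Ω) (i j : Fin 2) :
    (fun μ => M y t μ i j) =O[𝓝[d.testSet] 0] (fun _ => (1 : ℂ)) :=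
  isBigO_zero_of_atInfty (hM.isFrame h).inv (fun i j => (hM.tendsto_atInfty h i j).isBigO_one ℂ)
    i j

theorem isBigO_bracket {F : Filter ℂ} {X Z : ℂ → Mat}
    (hX : ∀ i j, (fun μ => X μ i j) =O[F] (fun _ => (1 : ℂ)))
    (hZ : ∀ i j, (fun μ => Z μ i j) =O[F] (fun _ => (1 : ℂ))) (i k : Fin 2) :
    bracket X Z i k =O[F] (fun _ => (1 : ℂ)) :=
  (((hX i 0).mul (hZ k 1)).sub ((hX i 1).mul (hZ k 0))).congr_right fun _ => one_mul 1

/-- The brackets of a frame with itself are the constants `0` and `± det`, so that the symmetries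
leave no pole. -/
theorem IsSolution.det_eq_one (hM : d.IsSolution Ω α M) (h : (y, t) ∈ Ω) {μ : ℂ}
    (hμ : μ ∈ d.good) : M y t μ 0 0 * M y t μ 1 1 - M y t μ 0 1 * M y t μ 1 0 = 1 := by
  have hF := hM.isFrame h
  have hc : ∀ (c : ℂ) (F : Filter ℂ), (fun _ : ℂ => c) =O[F] (fun _ => (1 : ℂ)) := fun c F =>
    isBigO_const_const _ one_ne_zero _
  have hid : (fun μ : ℂ => μ) =O[𝓝[d.testSet] 0] (fun _ => (1 : ℂ)) :=
    (tendsto_id.mono_left nhdsWithin_le_nhds).isBigO_one ℂ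
  have key := (hF.bracket_eq hF (e := fun i k _ => (!![0, 1; -1, 0] : Mat) i k) (κ := 0)
    (fun i k => differentiableOn_const _) (fun μ _ => by simp) (fun μ _ => by simp)
    (fun i k => (hid.mul ((isBigO_bracket (hM.isBigO_zero h) (hM.isBigO_zero h) i k).sub
      (hc _ _))).congr_right fun _ => one_mul 1)
    (fun i k => (isBigO_bracket (hM.isBigO_I h) (hM.isBigO_I h) i k).sub (hc _ _))
    (fun i k => by
      have hl := hM.tendsto_atInfty h
      have := (((hl i 0).mul (hl k 1)).sub ((hl i 1).mul (hl k 0))).sub_const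
        ((!![0, 1; -1, 0] : Mat) i k)
      have h0 : ∀ i k : Fin 2, (1 : Mat) i 0 * (1 : Mat) k 1 - (1 : Mat) i 1 * (1 : Mat) k 0 -
          (!![0, 1; -1, 0] : Mat) i k = 0 := by simp [Fin.forall_fin_two]
      exact le_trans this (congrArg 𝓝 (h0 i k)).le) μ hμ).2.1
  simpa [bracket] using key

/-- If `N' - q' N σ₃ = L N`, then `L` is the coefficient matrix of the equation of `N exp (-p σ₃)`. -/
theorem hasDerivAt_psi_entry {m : ℝ → ℂ → Mat} {p : ℝ → ℂ} {s₀ : ℝ} {μ : ℂ} {N' L : Mat} {q' : ℂ}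
    (hm : ∀ i j, HasDerivAt (fun s => m s μ i j) (N' i j) s₀) (hp : HasDerivAt p q' s₀)
    (hL : ∀ i j, N' i j - q' * sgn j * m s₀ μ i j = ∑ k, L i k * m s₀ μ k j) (i j : Fin 2) :
    HasDerivAt (fun s => (m s μ * expPauli3 (-p s)) i j)
      ((L * (m s₀ μ * expPauli3 (-p s₀))) i j) s₀ := by
  have e : ∀ s, (m s μ * expPauli3 (-p s)) i j = m s μ i j * exp (-(sgn j * p s)) := by
    intro s
    rw [Matrix.mul_apply, Fin.sum_univ_two]
    fin_cases j <;> simp [expPauli3, sgn]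
  have h1 := (hm i j).mul ((hp.const_mul (sgn j)).fun_neg.cexp)
  rw [← Matrix.mul_assoc]
  have e2 : (L * m s₀ μ * expPauli3 (-p s₀)) i j =
      (∑ k, L i k * m s₀ μ k j) * exp (-(sgn j * p s₀)) := by
    rw [Matrix.mul_apply, Fin.sum_univ_two]
    fin_cases j <;> simp [expPauli3, sgn, Matrix.mul_apply]
  rw [e2, ← hL, funext e]
  refine h1.congr_deriv ?_
  ring

/-- The matrix whose entries are the brackets of `W` and `N`, up to signs, is `W N⁻¹`. -/
theorem sum_bracket_mul {W N : ℂ → Mat} {μ : ℂ}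
    (hdet : N μ 0 0 * N μ 1 1 - N μ 0 1 * N μ 1 0 = 1) (i j : Fin 2) :
    bracket W N i 1 μ * N μ 0 j + -bracket W N i 0 μ * N μ 1 j = W μ i j := by
  fin_cases j <;> simp only [bracket, Fin.zero_eta, Fin.mk_one]
  · linear_combination W μ i 0 * hdet
  · linear_combination W μ i 1 * hdet

theorem mem_good_of_mem_spectralSet {μ : ℂ} (h : μ ∈ d.spectralSet) : μ ∈ d.good := by
  obtain ⟨⟨⟨h1, h2, h3, h4, -⟩, ⟨-, -, -, -, h5⟩⟩, h6, h7, h8⟩ := h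
  rw [mem_good_iff]
  refine ⟨h1, h4 rfl, h5 rfl, ?_⟩
  simp only [special, Finset.mem_insert, Finset.mem_singleton]
  tauto

/-- The diagonal brackets of `N' - q' N σ₃` and `N`. -/
theorem bracket_twist_same (q' : ℂ → ℂ) (N N' : ℂ → Mat) (i : Fin 2) (μ : ℂ) :
    bracket (twist q' N N') N i i μ = bracket N' N i i μ - 2 * q' μ * (N μ i 0 * N μ i 1) := by
  simp only [bracket, twist, sgn, of_apply, cons_val_zero, cons_val_one, cons_val_fin_one]
  ring

/-- The off-diagonal brackets of `N' - q' N σ₃` and `N`, when `det N = 1`. -/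
theorem bracket_twist_ne {q' : ℂ → ℂ} {N N' : ℂ → Mat} {μ : ℂ}
    (hdet : N μ 0 0 * N μ 1 1 - N μ 0 1 * N μ 1 0 = 1) {i k : Fin 2} (hik : i ≠ k) :
    bracket (twist q' N N') N i k μ =
      bracket N' N i k μ - q' μ - 2 * q' μ * (N μ 0 1 * N μ 1 0) := by
  have h : (i = 0 ∧ k = 1) ∨ (i = 1 ∧ k = 0) := by omega
  rcases h with ⟨rfl, rfl⟩ | ⟨rfl, rfl⟩ <;>
  · simp only [bracket, twist, sgn, of_apply, cons_val_zero, cons_val_one, cons_val_fin_one]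
    linear_combination -q' μ * hdet

/-! ### The `y`-equation -/

theorem tendsto_mul_sub_of_expansion {f : ℂ → ℂ} {a b : ℂ}
    (h : (fun μ => f μ - a - b / μ) =O[d.atInfty] (fun μ => (μ ^ 2)⁻¹)) :
    Tendsto (fun μ => μ * (f μ - a)) d.atInfty (𝓝 b) := by
  have h1 : (fun μ => μ * (f μ - a - b / μ)) =O[d.atInfty] (fun μ => μ⁻¹) := by
    refine ((isBigO_refl (fun μ : ℂ => μ) _).mul h).congr' EventuallyEq.rfl ?_
    filter_upwards [eventually_good_atInfty] with μ hμ
    have := (d.good_ne hμ).1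
    field_simp
  have h2 := (h1.trans_tendsto tendsto_inv_atInfty).add_const b
  rw [zero_add] at h2
  refine h2.congr' ?_
  filter_upwards [eventually_good_atInfty] with μ hμ
  have := (d.good_ne hμ).1
  field_simp
  ring

theorem tendsto_neg_atInfty : Tendsto (fun μ : ℂ => -μ) d.atInfty d.atInfty := by
  refine tendsto_inf.2 ⟨tendsto_neg_cobounded.mono_left inf_le_left, tendsto_principal.2 ?_⟩
  filter_upwards [eventually_good_atInfty] with μ hμ
  exact (d.neg_mem_good hμ).1

/-- The first coefficient at infinity inherits the symmetry `μ ↦ -μ`. -/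
theorem IsFrame.coeff_infty {ν : ℂ} {X : ℂ → Mat} (hX : d.IsFrame y t ν X) {M₁ : Mat}
    (h : ∀ i j, Tendsto (fun μ => μ * (X μ i j - (1 : Mat) i j)) d.atInfty (𝓝 (M₁ i j))) :
    M₁ 1 0 = M₁ 0 1 ∧ M₁ 1 1 = -M₁ 0 0 := by
  have := neBot_atInfty (d := d)
  constructor
  · refine tendsto_nhds_unique (h 1 0) (((h 0 1).comp tendsto_neg_atInfty).congr' ?_)
    filter_upwards [eventually_good_atInfty] with μ hμ
    simp [hX.neg μ hμ]
  · refine tendsto_nhds_unique (h 1 1) (((h 0 0).comp tendsto_neg_atInfty).neg.congr' ?_)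
    filter_upwards [eventually_good_atInfty] with μ hμ
    simp [hX.neg μ hμ]

theorem IsVariation.tendsto_bracket {q' : ℂ → ℂ} {ν' : ℂ} {N N' : ℂ → Mat}
    (hN' : d.IsVariation y t q' ν' N N')
    (hN : ∀ i j, (fun μ => N μ i j) =O[d.atInfty] (fun _ => (1 : ℂ))) (i k : Fin 2) :
    Tendsto (bracket N' N i k) d.atInfty (𝓝 0) := by
  have h := ((hN'.normalized i 0).mul (hN k 1)).sub ((hN'.normalized i 1).mul (hN k 0))
  simp only [mul_one] at h
  exact h.trans_tendsto tendsto_inv_atInfty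

theorem IsVariation.isBigO_I {q' : ℂ → ℂ} {ν' : ℂ} {N N' : ℂ → Mat}
    (hN' : d.IsVariation y t q' ν' N N') (i j : Fin 2) :
    (fun μ => N' μ i j) =O[𝓝[d.testSet] I] (fun _ => (1 : ℂ)) :=
  (hN'.bounded I (Or.inr (Or.inl rfl)) I_not_mem.1 I_not_mem.2.1 I_not_mem.2.2 i j).mono
    (nhdsWithin_mono _ d.testSet_subset_compl)

theorem IsVariation.isBigO_zero {q' : ℂ → ℂ} {ν' : ℂ} {N N' : ℂ → Mat}
    (hN' : d.IsVariation y t q' ν' N N') (i j : Fin 2) :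
    (fun μ => N' μ i j) =O[𝓝[d.testSet] 0] (fun _ => (1 : ℂ)) :=
  isBigO_zero_of_atInfty hN'.inv (fun i j => ((hN'.normalized i j).trans_tendsto
    tendsto_inv_atInfty).isBigO_one ℂ) i j

theorem isBigO_twist {F : Filter ℂ} {q' : ℂ → ℂ} {N N' : ℂ → Mat} {g : ℂ → ℂ}
    (hq : q' =O[F] g) (hg : (fun _ => (1 : ℂ)) =O[F] g)
    (hN : ∀ i j, (fun μ => N μ i j) =O[F] (fun _ => (1 : ℂ)))
    (hN' : ∀ i j, (fun μ => N' μ i j) =O[F] (fun _ => (1 : ℂ))) (i j : Fin 2) :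
    (fun μ => twist q' N N' μ i j) =O[F] g := by
  refine ((hN' i j).trans hg).sub ((((hq.const_mul_left (sgn j)).mul (hN i j)).congr_right
    fun μ => mul_one _).congr_left fun μ => ?_)
  ring

theorem tendsto_phaseY_div : Tendsto (fun μ => phaseY μ / μ) d.atInfty (𝓝 (I / 4)) := by
  have h := ((tendsto_inv_atInfty (d := d)).pow 2).const_mul (I / 4)
  have h2 := h.const_sub (I / 4)
  simp only [ne_eq, OfNat.ofNat_ne_zero, not_false_eq_true, zero_pow, mul_zero, sub_zero] at h2
  refine h2.congr' ?_
  filter_upwards [eventually_good_atInfty] with μ hμ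
  have := (d.good_ne hμ).1
  rw [phaseY]
  field_simp

theorem laxU_eq (f μ : ℂ) : laxU f μ =
    !![-phaseY μ + I * f / (μ - 1) + I * f / (μ + 1),
        -(I * f / (μ - 1)) + I * f / (μ + 1) - I * f;
      I * f / (μ - 1) - I * f / (μ + 1) + I * f,
        phaseY μ - I * f / (μ - 1) - I * f / (μ + 1)] := by
  ext i j
  fin_cases i <;> fin_cases j <;> simp [laxU, phaseY, pauli3] <;> ring

/-- The brackets are determined with `e 0 0 = e 1 1 = κ` and `e 0 1 = e 1 0 = -∂p/∂y`, the latter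
carrying the simple poles at `0` and `∞`. -/
theorem IsSolution.y_equation (hΩ : IsOpen Ω) (hM : d.IsSolution Ω α M) (h : (y, t) ∈ Ω)
    {M₁ : Mat} (hM₁ : ∀ i j, (fun μ => M y t μ i j - (1 : Mat) i j - M₁ i j / μ)
      =O[d.atInfty] (fun μ => (μ ^ 2)⁻¹)) :
    (M₁ 1 0 = M₁ 0 1 ∧ M₁ 1 1 = -M₁ 0 0) ∧
      ∀ μ ∈ d.spectralSet, ∀ i j, HasDerivAt (fun s : ℝ => psi M s t μ i j)
        ((laxU (-(M₁ 0 1) / 2) μ * psi M y t μ) i j) y := by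
  have hF := hM.isFrame h
  have hV := hM.isVariation_y hΩ h
  have hW := hM.isFrame_y hΩ h
  have hexp := fun i j => tendsto_mul_sub_of_expansion (hM₁ i j)
  have hsymm := hF.coeff_infty hexp
  refine ⟨hsymm, ?_⟩
  set N' : ℂ → Mat := fun μ => Matrix.of fun i j => deriv (fun s => M s t μ i j) y with hN'
  set κ : ℂ := I * (-(M₁ 0 1) / 2) with hκ
  have hlim := hM.tendsto_atInfty h
  have hbr := hV.tendsto_bracket fun i j => (hlim i j).isBigO_one ℂ
  have h01 := hexp 0 1
  have h10 := hexp 1 0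
  simp only [one_apply_ne (show (0 : Fin 2) ≠ 1 by decide),
    one_apply_ne (show (1 : Fin 2) ≠ 0 by decide), sub_zero] at h01 h10
  have hl00 : Tendsto (fun μ => M y t μ 0 0) d.atInfty (𝓝 1) := hlim 0 0
  have hl11 : Tendsto (fun μ => M y t μ 1 1) d.atInfty (𝓝 1) := hlim 1 1
  have hl01 : Tendsto (fun μ => M y t μ 0 1) d.atInfty (𝓝 0) := hlim 0 1
  have hq0 : (fun μ => μ * phaseY μ) =O[𝓝[d.testSet] 0] (fun _ => (1 : ℂ)) := by
    have h1 : Tendsto (fun μ : ℂ => I * (μ ^ 2 - 1) / 4) (𝓝[d.testSet] 0)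
        (𝓝 (I * ((0 : ℂ) ^ 2 - 1) / 4)) :=
      ((by fun_prop : Continuous fun μ : ℂ => I * (μ ^ 2 - 1) / 4).tendsto 0).mono_left
        nhdsWithin_le_nhds
    refine (h1.isBigO_one ℂ).congr' ?_ EventuallyEq.rfl
    filter_upwards [self_mem_nhdsWithin] with μ hμ
    have := (d.good_ne hμ.2).1
    rw [phaseY]
    field_simp
  have hqI : phaseY =O[𝓝[d.testSet] I] (fun _ => (1 : ℂ)) :=
    (((differentiableOn_phaseY.differentiableAt (isOpen_ne.mem_nhds I_ne_zero)).continuousAt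
      |>.tendsto).mono_left nhdsWithin_le_nhds).isBigO_one ℂ
  have hc : ∀ (c : ℂ) (F : Filter ℂ), (fun _ : ℂ => c) =O[F] (fun _ => (1 : ℂ)) := fun c F =>
    isBigO_const_const _ one_ne_zero _
  have hid : (fun μ : ℂ => μ) =O[𝓝[d.testSet] 0] (fun _ => (1 : ℂ)) :=
    (tendsto_id.mono_left nhdsWithin_le_nhds).isBigO_one ℂ
  set e : Fin 2 → Fin 2 → ℂ → ℂ := fun i k μ => if i = k then κ else -phaseY μ with he
  have key := hW.bracket_eq hF (e := e) (κ := κ)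
    (fun i k => by
      simp only [he]
      split_ifs
      · exact differentiableOn_const _
      · exact DifferentiableOn.fun_neg
          (differentiableOn_phaseY.mono fun _ hμ h => hμ (Or.inl h)))
    (fun μ _ => by simp [he, phaseY_neg])
    (fun μ _ => by
      simp only [he, phaseY_inv]
      refine ⟨?_, ?_⟩
      · simp only [if_true]; ring
      · simp)
    (fun i k => by
      have hNO := hM.isBigO_zero h
      have hW0 : ∀ i j, (fun μ => μ * twist phaseY (M y t) N' μ i j) =O[𝓝[d.testSet] 0]
          (fun _ => (1 : ℂ)) := by
        intro i j
        have h1 := ((hid.mul (hV.isBigO_zero i j)).congr_right fun _ => one_mul 1).sub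
          (((hq0.const_mul_left (sgn j)).mul (hNO i j)).congr_right fun _ => one_mul 1)
        refine h1.congr_left fun μ => ?_
        simp only [twist, of_apply]
        ring
      have he0 : (fun μ => μ * e i k μ) =O[𝓝[d.testSet] 0] (fun _ => (1 : ℂ)) := by
        simp only [he]
        split_ifs
        · exact (hid.mul (hc κ _)).congr_right fun _ => one_mul 1
        · simpa only [mul_neg] using hq0.neg_left
      refine (((((hW0 i 0).mul (hNO k 1)).sub ((hW0 i 1).mul (hNO k 0))).congr_right
        fun _ => one_mul 1).sub he0).congr_left fun μ => ?_
      simp only [bracket]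
      ring)
    (fun i k => by
      have heI : e i k =O[𝓝[d.testSet] I] (fun _ => (1 : ℂ)) := by
        simp only [he]
        split_ifs
        · exact hc κ _
        · exact hqI.neg_left
      exact (isBigO_bracket (isBigO_twist hqI (isBigO_refl _ _) (hM.isBigO_I h) hV.isBigO_I)
        (hM.isBigO_I h) i k).sub heI)
    (fun i k => by
      by_cases hik : i = k
      · subst hik
        have hd : Tendsto (fun μ => 2 * (phaseY μ / μ * (μ * (M y t μ i 0 * M y t μ i 1))))
            d.atInfty (𝓝 (2 * (I / 4 * M₁ 0 1))) := by
          refine (tendsto_phaseY_div.mul ?_).const_mul 2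
          fin_cases i
          · have := hl00.mul h01
            rw [one_mul] at this
            refine this.congr fun μ => ?_
            simp only [Fin.zero_eta]
            ring
          · have := h10.mul hl11
            rw [mul_one, hsymm.1] at this
            refine this.congr fun μ => ?_
            simp only [Fin.mk_one]
            ring
        refine le_trans ((((hbr i i).sub hd).sub_const κ).congr' ?_) (congrArg 𝓝 ?_).le
        · filter_upwards [eventually_good_atInfty] with μ hμ
          have := (d.good_ne hμ).1
          simp only [he, if_true, bracket_twist_same]
          field_simp
        · rw [hκ]; ring
      · have hd : Tendsto (fun μ => 2 * (phaseY μ / μ * (M y t μ 0 1 * (μ * M y t μ 1 0))))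
            d.atInfty (𝓝 (2 * (I / 4 * (0 * M₁ 1 0)))) :=
          (tendsto_phaseY_div.mul (hl01.mul h10)).const_mul 2
        refine le_trans (((hbr i k).sub hd).congr' ?_) (congrArg 𝓝 ?_).le
        · filter_upwards [eventually_good_atInfty] with μ hμ
          have := (d.good_ne hμ).1
          simp only [he, if_neg hik, bracket_twist_ne (hM.det_eq_one h hμ) hik]
          field_simp
          ring
        · ring)
  intro μ hμ i j
  have hg := mem_good_of_mem_spectralSet hμ
  obtain ⟨b00, b01, b10, b11⟩ := key μ hg
  refine hasDerivAt_psi_entry (m := fun s => M s t) (p := fun s => phase s t μ) (N' := N' μ)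
    (fun i j => ((hM.diff_param i j μ (mem_dom_of_mem_good hg j)) y t h).1.hasDerivAt)
    (hasDerivAt_phase_y y t μ) (fun i j => ?_) i j
  refine (sum_bracket_mul (W := twist phaseY (M y t) N') (hM.det_eq_one h hg) i j).symm.trans ?_
  rw [Fin.sum_univ_two]
  have hf : I * (-(M₁ 0 1) / 2) = κ := rfl
  rw [laxU_eq, hf]
  fin_cases i
  · simp only [Fin.zero_eta, b00, b01, he, if_true, if_neg zero_ne_one, of_apply, cons_val',
      cons_val_zero, cons_val_one, cons_val_fin_one]
    ring
  · simp only [Fin.mk_one, b10, b11, he, if_true, if_neg one_ne_zero, of_apply, cons_val',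
      cons_val_zero, cons_val_one, cons_val_fin_one]
    ring

/-! ### The principal parts of the `t`-equation -/

theorem tendsto_sub_testSet (s : ℂ) : Tendsto (fun μ : ℂ => μ - s) (𝓝[d.testSet] s) (𝓝 0) := by
  have : Tendsto (fun μ : ℂ => μ - s) (𝓝 s) (𝓝 (s - s)) :=
    (continuous_id.sub continuous_const).tendsto s
  rw [sub_self] at this
  exact this.mono_left nhdsWithin_le_nhds

theorem isBigO_sub_of_expansion {f : ℂ → ℂ} {a b : ℂ}
    (h : (fun μ => f μ - a - b * (μ - I)) =O[𝓝[d.testSet] I] (fun μ => (μ - I) ^ 2)) :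
    (fun μ => f μ - a) =O[𝓝[d.testSet] I] (fun μ => μ - I) := by
  have h1 : (fun μ : ℂ => (μ - I) ^ 2) =O[𝓝[d.testSet] I] (fun μ => μ - I) := by
    have := (isBigO_refl (fun μ : ℂ => μ - I) (𝓝[d.testSet] I)).mul
      ((d.tendsto_sub_testSet I).isBigO_one ℂ)
    simpa only [sq, mul_one] using this
  have h2 := (h.trans h1).add ((isBigO_refl (fun μ : ℂ => μ - I) (𝓝[d.testSet] I)).const_mul_left b)
  simpa using h2

theorem tendsto_of_expansion {f : ℂ → ℂ} {a b : ℂ}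
    (h : (fun μ => f μ - a - b * (μ - I)) =O[𝓝[d.testSet] I] (fun μ => (μ - I) ^ 2)) :
    Tendsto f (𝓝[d.testSet] I) (𝓝 a) ∧
      Tendsto (fun μ => (f μ - a) / (μ - I)) (𝓝[d.testSet] I) (𝓝 b) := by
  constructor
  · simpa using ((isBigO_sub_of_expansion h).trans_tendsto (d.tendsto_sub_testSet I)).add_const a
  · have h1 : (fun μ => (f μ - a - b * (μ - I)) / (μ - I)) =O[𝓝[d.testSet] I]
        (fun μ => μ - I) := by
      refine (h.mul (isBigO_refl (fun μ : ℂ => (μ - I)⁻¹) _)).congr'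
        (Eventually.of_forall fun μ => (div_eq_mul_inv _ _).symm) ?_
      filter_upwards [self_mem_nhdsWithin] with μ hμ
      have : μ - I ≠ 0 := sub_ne_zero.2 (d.good_ne hμ.2).2.2.2.1
      field_simp
    have h2 := (h1.trans_tendsto (d.tendsto_sub_testSet I)).add_const b
    rw [zero_add] at h2
    refine h2.congr' ?_
    filter_upwards [self_mem_nhdsWithin] with μ hμ
    have : μ - I ≠ 0 := sub_ne_zero.2 (d.good_ne hμ.2).2.2.2.1
    field_simp
    ring

theorem IsFrame.apply_neg_inv {ν : ℂ} {X : ℂ → Mat} (hX : d.IsFrame y t ν X) {μ : ℂ} (hμ : μ ∈ d.good) :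
    X (-μ⁻¹) = !![X μ 0 0, -X μ 0 1; -X μ 1 0, X μ 1 1] := by
  rw [hX.neg _ (d.inv_mem_good hμ), hX.inv μ hμ]
  simp

/-- The map `μ ↦ -1/μ` fixes `i` and has derivative `-1` there. -/
theorem tendsto_neg_inv_testSet :
    Tendsto (fun μ : ℂ => -μ⁻¹) (𝓝[d.testSet] I) (𝓝[d.testSet] I) := by
  refine tendsto_nhdsWithin_iff.2 ⟨?_, eventually_nhdsWithin_of_forall fun μ hμ =>
    d.neg_mem_testSet (d.inv_mem_testSet hμ)⟩
  have := ((tendsto_inv₀ I_ne_zero).neg).mono_left (nhdsWithin_le_nhds (s := d.testSet))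
  simpa using this

/-- The symmetry `μ ↦ -1/μ` makes the expansion at `i` of a frame diagonal in order zero and
off-diagonal in order one. -/
theorem IsFrame.expansion_I {ν : ℂ} {X : ℂ → Mat} (hX : d.IsFrame y t ν X) {A₀ A₁ : Mat}
    (hA : ∀ i j, (fun μ => X μ i j - A₀ i j - A₁ i j * (μ - I)) =O[𝓝[d.testSet] I]
      (fun μ => (μ - I) ^ 2)) :
    A₀ 0 1 = 0 ∧ A₀ 1 0 = 0 ∧ A₁ 0 0 = 0 ∧ A₁ 1 1 = 0 := by
  have := d.neBot_testSet I
  have h0 := fun i j => (tendsto_of_expansion (hA i j)).1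
  have h1 := fun i j => (tendsto_of_expansion (hA i j)).2
  have hoff : ∀ i j, (∀ μ ∈ d.good, X (-μ⁻¹) i j = -X μ i j) → A₀ i j = 0 := by
    intro i j h
    have h2 : Tendsto (fun μ => -X μ i j) (𝓝[d.testSet] I) (𝓝 (A₀ i j)) :=
      ((h0 i j).comp tendsto_neg_inv_testSet).congr' (by
        filter_upwards [self_mem_nhdsWithin] with μ hμ using h μ hμ.2)
    have h3 := tendsto_nhds_unique h2 (h0 i j).neg
    linear_combination h3 / 2
  have hdiag : ∀ i j, (∀ μ ∈ d.good, X (-μ⁻¹) i j = X μ i j) → A₁ i j = 0 := by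
    intro i j h
    have h2 : Tendsto (fun μ : ℂ => μ * I) (𝓝[d.testSet] I) (𝓝 (I * I)) :=
      ((by fun_prop : Continuous fun μ : ℂ => μ * I).tendsto I).mono_left nhdsWithin_le_nhds
    have h3 : Tendsto (fun μ => (μ * I) * ((X μ i j - A₀ i j) / (μ - I))) (𝓝[d.testSet] I)
        (𝓝 (A₁ i j)) := by
      refine ((h1 i j).comp tendsto_neg_inv_testSet).congr' ?_
      filter_upwards [self_mem_nhdsWithin] with μ hμ
      have hμ0 := (d.good_ne hμ.2).1
      have hμI : μ - I ≠ 0 := sub_ne_zero.2 (d.good_ne hμ.2).2.2.2.1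
      have e : -μ⁻¹ - I = -I * (μ - I) / μ := by
        field_simp
        linear_combination -I_sq
      simp only [Function.comp, h μ hμ.2, e]
      have hI := I_ne_zero
      field_simp
      linear_combination (-(X μ i j - A₀ i j)) * I_sq
    have h4 := tendsto_nhds_unique h3 (h2.mul (h1 i j))
    rw [I_mul_I] at h4
    linear_combination h4 / 2
  refine ⟨hoff 0 1 ?_, hoff 1 0 ?_, hdiag 0 0 ?_, hdiag 1 1 ?_⟩ <;>
  · intro μ hμ
    simp [hX.apply_neg_inv hμ]

theorem isBigO_mul_of_expansion {F : Filter ℂ} {h f g : ℂ → ℂ} {a b : ℂ}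
    (hh : Tendsto h F (𝓝 0)) (hf : (fun μ => f μ - a) =O[F] h)
    (hg : (fun μ => g μ - b * h μ) =O[F] (fun μ => h μ ^ 2)) :
    (fun μ => f μ * g μ - a * b * h μ) =O[F] (fun μ => h μ ^ 2) := by
  have h1 : (fun μ => h μ ^ 2) =O[F] h := by
    simpa only [sq, mul_one] using (isBigO_refl h F).mul (hh.isBigO_one ℂ)
  have hg1 : g =O[F] h := by
    simpa using (hg.trans h1).add ((isBigO_refl h F).const_mul_left b)
  have h2 := ((hf.mul hg1).congr_right fun μ => (sq (h μ)).symm).add (hg.const_mul_left a)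
  refine h2.congr_left fun μ => ?_
  ring

/-- `∂p/∂t = (μ - i)⁻² + O((μ - i)⁻¹)`. -/
theorem phaseT_mul_sub : (fun μ => phaseT μ * (μ - I) ^ 2 - 1) =O[𝓝[d.testSet] I]
    (fun μ => μ - I) := by
  have hI2 : I + I ≠ 0 := by rw [← two_mul]; exact mul_ne_zero two_ne_zero I_ne_zero
  have hd : DifferentiableAt ℂ (fun μ : ℂ => -(2 * I * (μ ^ 2 - 1) * μ / (μ + I) ^ 2)) I := by
    refine (DifferentiableAt.div (by fun_prop) (by fun_prop) ?_).fun_neg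
    exact pow_ne_zero _ hI2
  refine (hd.isBigO_sub.mono (nhdsWithin_le_nhds (s := d.testSet))).congr' ?_ EventuallyEq.rfl
  filter_upwards [self_mem_nhdsWithin] with μ hμ
  obtain ⟨-, -, -, h3, h4⟩ := d.good_ne hμ.2
  have h5 : μ - I ≠ 0 := sub_ne_zero.2 h3
  have h6 : μ + I ≠ 0 := fun h => h4 (eq_neg_of_add_eq_zero_left h)
  have e1 : (μ ^ 2 + 1) ^ 2 = (μ - I) ^ 2 * (μ + I) ^ 2 := by
    rw [← mul_pow]; congr 1; linear_combination I_sq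
  have e2 : -(2 * I * (I ^ 2 - 1) * I / (I + I) ^ 2) = 1 := by
    rw [← neg_div, div_eq_one_iff_eq (pow_ne_zero _ hI2)]
    ring_nf
    rw [show (I : ℂ) ^ 4 = 1 by simp, I_sq]
    norm_num
  rw [e2, phaseT, e1]
  field_simp

theorem isBigO_phaseT_mul {f : ℂ → ℂ} {c : ℂ}
    (hf : (fun μ => f μ - c * (μ - I)) =O[𝓝[d.testSet] I] (fun μ => (μ - I) ^ 2)) :
    (fun μ => phaseT μ * f μ - c / (μ - I)) =O[𝓝[d.testSet] I] (fun _ => (1 : ℂ)) := by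
  have hne : ∀ᶠ μ in 𝓝[d.testSet] I, μ - I ≠ 0 := by
    filter_upwards [self_mem_nhdsWithin] with μ hμ
    exact sub_ne_zero.2 (d.good_ne hμ.2).2.2.2.1
  have hf1 : f =O[𝓝[d.testSet] I] (fun μ => μ - I) := by
    have := isBigO_sub_of_expansion (f := f) (a := 0) (b := c) (by simpa using hf)
    simpa using this
  have h1 := (phaseT_mul_sub.mul hf1).add
    (hf.congr_right fun μ => sq (μ - I))
  have h2 := h1.mul (isBigO_refl (fun μ : ℂ => ((μ - I) ^ 2)⁻¹) (𝓝[d.testSet] I))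
  refine h2.congr' ?_ ?_
  · filter_upwards [hne] with μ hμ
    field_simp
    ring
  · filter_upwards [hne] with μ hμ
    field_simp

theorem continuousAt_pole_sum {a b s : ℂ} (h1 : s ≠ I) (h2 : s ≠ -I) :
    ContinuousAt (fun μ : ℂ => a / (μ - I) + b / (μ + I)) s := by
  have h1' : s - I ≠ 0 := sub_ne_zero.2 h1
  have h2' : s + I ≠ 0 := fun h => h2 (eq_neg_of_add_eq_zero_left h)
  fun_prop (disch := assumption)

theorem laxV_eq (g₀ g₁ g₂ μ : ℂ) : laxV g₀ g₁ g₂ μ =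
    !![-phaseT μ + I * g₀ / (μ - 1) + I * g₀ / (μ + 1),
        -(I * g₀ / (μ - 1)) + I * g₀ / (μ + 1) + (g₁ / (μ - I) + g₂ / (μ + I));
      I * g₀ / (μ - 1) - I * g₀ / (μ + 1) + (g₂ / (μ - I) + g₁ / (μ + I)),
        phaseT μ - I * g₀ / (μ - 1) - I * g₀ / (μ + 1)] := by
  ext i j
  fin_cases i <;> fin_cases j <;> simp [laxV, phaseT, pauli3] <;> ring

/-- The brackets of the `t`-equation, where the coefficient `κ` of the poles at `± 1` is given by
the off-diagonal parts `γ₁`, `γ₂` at `± i`. -/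
theorem IsSolution.bracket_t (hΩ : IsOpen Ω) (hM : d.IsSolution Ω α M) (h : (y, t) ∈ Ω)
    {A₀ A₁ : Mat} (hA : ∀ i j, (fun μ => M y t μ i j - A₀ i j - A₁ i j * (μ - I))
      =O[𝓝[d.testSet] I] (fun μ => (μ - I) ^ 2)) {g₁ g₂ κ : ℂ} (hg₁ : g₁ = 2 * (A₀ 0 0 * A₁ 0 1))
    (hg₂ : g₂ = -(2 * (A₀ 1 1 * A₁ 1 0))) (hκ : κ = I * (g₂ - g₁) / 2) :
    let W := twist phaseT (M y t) (fun μ => Matrix.of fun i j => deriv (fun s => M y s μ i j) t)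
    ∀ μ ∈ d.good,
      bracket W (M y t) 0 0 μ = -(g₁ / (μ - I) + g₂ / (μ + I)) + κ / (μ - 1) - κ / (μ + 1) ∧
      bracket W (M y t) 0 1 μ = -phaseT μ + κ / (μ - 1) + κ / (μ + 1) ∧
      bracket W (M y t) 1 0 μ = -phaseT μ + κ / (μ - 1) + κ / (μ + 1) ∧
      bracket W (M y t) 1 1 μ = (g₂ / (μ - I) + g₁ / (μ + I)) + κ / (μ - 1) - κ / (μ + 1) := by
  intro W
  have hF := hM.isFrame h
  have hV := hM.isVariation_t hΩ h
  have hW : d.IsFrame y t _ W := hM.isFrame_t hΩ h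
  set N' : ℂ → Mat := fun μ => Matrix.of fun i j => deriv (fun s => M y s μ i j) t with hN'
  obtain ⟨hA01, hA10, hA00', hA11'⟩ := hF.expansion_I hA
  have hlim := hM.tendsto_atInfty h
  have hbr := hV.tendsto_bracket fun i j => (hlim i j).isBigO_one ℂ
  have hI0 : (0 : ℂ) ≠ I := I_ne_zero.symm
  have hI0' : (0 : ℂ) ≠ -I := (neg_ne_zero.2 I_ne_zero).symm
  have hII : I + I ≠ 0 := by rw [← two_mul]; exact mul_ne_zero two_ne_zero I_ne_zero
  have hopen : IsOpen (({I, -I} : Set ℂ)ᶜ) := (Set.toFinite _).isClosed.isOpen_compl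
  have hq0 : phaseT =O[𝓝[d.testSet] 0] (fun _ => (1 : ℂ)) :=
    (((differentiableOn_phaseT.differentiableAt (hopen.mem_nhds (x := 0) (by
      simp [hI0, hI0']))).continuousAt.tendsto).mono_left nhdsWithin_le_nhds).isBigO_one ℂ
  have hid : (fun μ : ℂ => μ) =O[𝓝[d.testSet] 0] (fun _ => (1 : ℂ)) :=
    (tendsto_id.mono_left nhdsWithin_le_nhds).isBigO_one ℂ
  have hreg : ∀ c : ℂ, (fun μ : ℂ => c / (μ + I)) =O[𝓝[d.testSet] I] (fun _ => (1 : ℂ)) := by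
    intro c
    have : ContinuousAt (fun μ : ℂ => c / (μ + I)) I := by fun_prop (disch := assumption)
    exact (this.tendsto.mono_left nhdsWithin_le_nhds).isBigO_one ℂ
  have hqinf : Tendsto phaseT d.atInfty (𝓝 0) := by
    have h1 : Tendsto (fun μ : ℂ => μ⁻¹) d.atInfty (𝓝 0) := tendsto_inv_atInfty
    have h2 := ((((h1.pow 2).const_sub 1).mul h1).const_mul (2 * I)).div
      (((h1.pow 2).const_add 1).pow 2) (by norm_num)
    have h3 := h2.neg
    norm_num at h3
    refine h3.congr' ?_
    filter_upwards [eventually_good_atInfty] with μ hμ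
    obtain ⟨h0, -, -, h3, h4⟩ := d.good_ne hμ
    have h5 := sq_add_one_ne_zero h3 h4
    have h6 : 1 + (μ ^ 2)⁻¹ = (μ ^ 2 + 1) / μ ^ 2 := by field_simp
    simp only [phaseT]
    rw [h6]
    field_simp
  have hpinf : ∀ a b : ℂ, Tendsto (fun μ : ℂ => a / (μ - I) + b / (μ + I)) d.atInfty (𝓝 0) := by
    intro a b
    have h1 := ((tendsto_div_sub_cobounded a I).add (tendsto_div_sub_cobounded b (-I))).mono_left
      (inf_le_left : d.atInfty ≤ _)
    simp only [sub_neg_eq_add, add_zero] at h1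
    exact h1
  set e : Fin 2 → Fin 2 → ℂ → ℂ := ![ ![fun μ => -(g₁ / (μ - I) + g₂ / (μ + I)), fun μ => -phaseT μ],
    ![fun μ => -phaseT μ, fun μ => g₂ / (μ - I) + g₁ / (μ + I)] ] with he
  have e00 : e 0 0 = fun μ => -(g₁ / (μ - I) + g₂ / (μ + I)) := rfl
  have e01 : e 0 1 = fun μ => -phaseT μ := rfl
  have e10 : e 1 0 = fun μ => -phaseT μ := rfl
  have e11 : e 1 1 = fun μ => g₂ / (μ - I) + g₁ / (μ + I) := rfl
  have hdiff : ∀ a b : ℂ, DifferentiableOn ℂ (fun μ : ℂ => a / (μ - I) + b / (μ + I))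
      ({0, I, -I} : Set ℂ)ᶜ := by
    intro a b μ hμ
    simp only [Set.mem_compl_iff, Set.mem_insert_iff, Set.mem_singleton_iff, not_or] at hμ
    have h1' : μ - I ≠ 0 := sub_ne_zero.2 hμ.2.1
    have h2' : μ + I ≠ 0 := fun h => hμ.2.2 (eq_neg_of_add_eq_zero_left h)
    refine DifferentiableAt.differentiableWithinAt ?_
    fun_prop (disch := assumption)
  have hdiffT : DifferentiableOn ℂ (fun μ => -phaseT μ) ({0, I, -I} : Set ℂ)ᶜ :=
    DifferentiableOn.fun_neg (differentiableOn_phaseT.mono fun _ hμ h => hμ (Or.inr h))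
  have hpole0 : ∀ a b : ℂ, (fun μ : ℂ => a / (μ - I) + b / (μ + I)) =O[𝓝[d.testSet] 0]
      (fun _ => (1 : ℂ)) := fun a b =>
    ((continuousAt_pole_sum hI0 hI0').tendsto.mono_left nhdsWithin_le_nhds).isBigO_one ℂ
  -- the products of entries that are multiplied by the double pole of `∂p/∂t`
  have hexp0 : ∀ i j, (fun μ => M y t μ i j - A₀ i j) =O[𝓝[d.testSet] I] (fun μ => μ - I) :=
    fun i j => isBigO_sub_of_expansion (hA i j)
  have hoff01 : (fun μ => M y t μ 0 1 - A₁ 0 1 * (μ - I)) =O[𝓝[d.testSet] I]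
      (fun μ => (μ - I) ^ 2) := by simpa [hA01] using hA 0 1
  have hoff10 : (fun μ => M y t μ 1 0 - A₁ 1 0 * (μ - I)) =O[𝓝[d.testSet] I]
      (fun μ => (μ - I) ^ 2) := by simpa [hA10] using hA 1 0
  have hp0 := isBigO_phaseT_mul
    (isBigO_mul_of_expansion (d.tendsto_sub_testSet I) (hexp0 0 0) hoff01)
  have hp1 := isBigO_phaseT_mul
    (isBigO_mul_of_expansion (d.tendsto_sub_testSet I) (hexp0 1 1) hoff10)
  have hp2 := isBigO_phaseT_mul
    (isBigO_mul_of_expansion (d.tendsto_sub_testSet I) (hexp0 0 1) hoff10)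
  have hbrI := isBigO_bracket hV.isBigO_I (hM.isBigO_I h)
  have key := hW.bracket_eq hF (e := e) (κ := κ)
    (by
      simp only [Fin.forall_fin_two, e00, e01, e10, e11]
      exact ⟨⟨(hdiff g₁ g₂).fun_neg, hdiffT⟩, hdiffT, hdiff g₂ g₁⟩)
    (fun μ _ => by
      simp only [e00, e01, e10, e11, phaseT_neg]
      refine ⟨?_, by ring⟩
      rw [show -μ - I = -(μ + I) by ring, show -μ + I = -(μ - I) by ring, div_neg, div_neg]
      ring)
    (fun μ hμ => by
      obtain ⟨h0, -, -, h3, h4⟩ := d.good_ne hμ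
      have h5 : μ - I ≠ 0 := sub_ne_zero.2 h3
      have h6 : μ + I ≠ 0 := fun h => h4 (eq_neg_of_add_eq_zero_left h)
      simp only [e00, e01, e10, e11, phaseT_inv]
      refine ⟨?_, trivial⟩
      have k1 : μ⁻¹ - I = -I * (μ + I) / μ := by field_simp; linear_combination I_sq
      have k2 : μ⁻¹ + I = I * (μ - I) / μ := by field_simp; linear_combination I_sq
      have k3 : -I * (μ + I) ≠ 0 := mul_ne_zero (neg_ne_zero.2 I_ne_zero) h6
      have k4 : I * (μ - I) ≠ 0 := mul_ne_zero I_ne_zero h5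
      rw [k1, k2, hκ]
      have hI := I_ne_zero
      field_simp
      linear_combination (g₁ - g₂) * (μ ^ 2 - I ^ 2) * I_sq)
    (by
      have hb := isBigO_bracket (isBigO_twist hq0 (isBigO_refl _ _) (hM.isBigO_zero h)
        hV.isBigO_zero) (hM.isBigO_zero h)
      have he0 : ∀ i k, e i k =O[𝓝[d.testSet] 0] (fun _ => (1 : ℂ)) := by
        simp only [Fin.forall_fin_two, e00, e01, e10, e11]
        exact ⟨⟨(hpole0 g₁ g₂).neg_left, hq0.neg_left⟩, hq0.neg_left, hpole0 g₂ g₁⟩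
      exact fun i k => (hid.mul ((hb i k).sub (he0 i k))).congr_right fun _ => one_mul 1)
    (by
      simp only [Fin.forall_fin_two, e00, e01, e10, e11]
      have hoff : ∀ i k : Fin 2, i ≠ k → (fun μ => bracket W (M y t) i k μ - -phaseT μ)
          =O[𝓝[d.testSet] I] (fun _ => (1 : ℂ)) := by
        intro i k hik
        refine ((hbrI i k).sub (hp2.const_mul_left 2)).congr' ?_ EventuallyEq.rfl
        filter_upwards [self_mem_nhdsWithin] with μ hμ
        simp only [W, bracket_twist_ne (hM.det_eq_one h hμ.2) hik, hA01]
        ring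
      refine ⟨⟨?_, hoff 0 1 (by decide)⟩, hoff 1 0 (by decide), ?_⟩
      · refine (((hbrI 0 0).sub (hp0.const_mul_left 2)).add (hreg g₂)).congr_left fun μ => ?_
        simp only [W, bracket_twist_same, hg₁]
        ring
      · refine (((hbrI 1 1).sub (hp1.const_mul_left 2)).sub (hreg g₁)).congr_left fun μ => ?_
        simp only [W, bracket_twist_same, hg₂]
        ring)
    (by
      have hq2 : ∀ i j k l : Fin 2, Tendsto (fun μ => 2 * phaseT μ * (M y t μ i j * M y t μ k l))
          d.atInfty (𝓝 0) := by
        intro i j k l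
        have := (hqinf.const_mul 2).mul ((hlim i j).mul (hlim k l))
        simpa using this
      have he0 : ∀ i k, Tendsto (e i k) d.atInfty (𝓝 0) := by
        simp only [Fin.forall_fin_two, e00, e01, e10, e11]
        have hn := (hpinf g₁ g₂).neg
        have hqn := hqinf.neg
        rw [neg_zero] at hn hqn
        exact ⟨⟨hn, hqn⟩, hqn, hpinf g₂ g₁⟩
      have hb : ∀ i k, Tendsto (bracket W (M y t) i k) d.atInfty (𝓝 0) := by
        intro i k
        by_cases hik : i = k
        · subst hik
          have := (hbr i i).sub (hq2 i 0 i 1)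
          rw [sub_zero] at this
          refine this.congr fun μ => ?_
          simp only [W, hN', bracket_twist_same]
        · have := ((hbr i k).sub hqinf).sub (hq2 0 1 1 0)
          rw [sub_zero, sub_zero] at this
          refine this.congr' ?_
          filter_upwards [eventually_good_atInfty] with μ hμ
          simp only [W, hN', bracket_twist_ne (hM.det_eq_one h hμ) hik]
      intro i k
      simpa using (hb i k).sub (he0 i k))
  simpa only [e00, e01, e10, e11] using key

/-! ### The coefficient of the poles at `± 1` in the `t`-equation -/

theorem singNegOne_apply_one (a : ℝ) (j : Fin 2) :
    d.singNegOne a 1 j = I * a / 2 * (![d.c, 1] : Fin 2 → ℂ) j := by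
  fin_cases j <;> simp [singNegOne]

theorem tendsto_phaseT_div : Tendsto (fun μ => phaseT μ / (μ + 1)) (d.upper (-1)) (𝓝 (-I)) := by
  have h0 : ContinuousAt (fun μ : ℂ => -(2 * I * (μ - 1) * μ / (μ ^ 2 + 1) ^ 2)) (-1) := by
    have : (((-1 : ℂ) ^ 2 + 1) ^ 2) ≠ 0 := by norm_num
    fun_prop (disch := assumption)
  have h1 := h0.tendsto.mono_left (nhdsWithin_le_nhds (s := {μ | 0 < μ.im} \ d.Γ))
  refine le_trans (h1.congr' ?_) (congrArg 𝓝 (by norm_num; ring)).le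
  filter_upwards [d.eventually_good_upper (s := -1) (by simp)] with μ hμ
  obtain ⟨-, -, h2, h3, h4⟩ := d.good_ne hμ
  have h5 := sq_add_one_ne_zero h3 h4
  have h6 : μ + 1 ≠ 0 := fun h => h2 (eq_neg_of_add_eq_zero_left h)
  rw [phaseT]
  field_simp
  ring

/-- The expansion of the second row at `-1` and its `t`-derivative, as limits. -/
theorem IsSolution.tendsto_neg_one (hM : d.IsSolution Ω α M) (h : (y, t) ∈ Ω) {B : ℝ → ℝ → Mat}
    (hB : ∀ i j, PartialDiff Ω (fun y t => B y t i j))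
    (hMB : ∀ i j, IsBigOC1 Ω
      (fun y t μ => M y t μ i j - d.singNegOne (α y t) i j / (μ + 1) - B y t i j)
      (d.upper (-1)) (fun μ => μ + 1)) (j : Fin 2) :
    Tendsto (fun μ => M y t μ 1 j - I * α y t / 2 * (![d.c, 1] : Fin 2 → ℂ) j / (μ + 1))
      (d.upper (-1)) (𝓝 (B y t 1 j)) ∧
    Tendsto (fun μ => deriv (fun s => M y s μ 1 j) t -
        I * (deriv (fun s => α y s) t : ℝ) / 2 * (![d.c, 1] : Fin 2 → ℂ) j / (μ + 1))
      (d.upper (-1)) (𝓝 (deriv (fun s => B y s 1 j) t)) := by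
  have h0 : Tendsto (fun μ : ℂ => μ + 1) (d.upper (-1)) (𝓝 0) := by
    simpa using d.tendsto_sub_upper (-1)
  constructor
  · have h1 := ((hMB 1 j y t h).1.trans_tendsto h0).add_const (B y t 1 j)
    simpa only [singNegOne_apply_one, sub_add_cancel, zero_add] using h1
  · have h1 := ((hMB 1 j y t h).2.2.trans_tendsto h0).add_const (deriv (fun s => B y s 1 j) t)
    rw [zero_add] at h1
    refine h1.congr' ?_
    filter_upwards [d.eventually_good_upper (s := -1) (by simp)] with μ hμ
    have h2 := ((hM.diff_param 1 j μ (mem_dom_of_mem_good hμ j)) y t h).2.hasDerivAt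
    have h3 := ((hM.diff_α y t h).2.hasDerivAt).ofReal_comp
    have h4 := (h2.sub ((((h3.const_mul I).div_const 2).mul_const
      ((![d.c, 1] : Fin 2 → ℂ) j)).div_const (μ + 1))).sub ((hB 1 j y t h).2.hasDerivAt)
    simp only [dT, singNegOne_apply_one]
    exact eq_sub_iff_add_eq.1 h4.deriv

/-- Comparison of the principal parts of one bracket at `-1`. -/
theorem IsSolution.coeff_eq_beta2 (hM : d.IsSolution Ω α M) (h : (y, t) ∈ Ω) {B : ℝ → ℝ → Mat}
    (hB : ∀ i j, PartialDiff Ω (fun y t => B y t i j))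
    (hMB : ∀ i j, IsBigOC1 Ω
      (fun y t μ => M y t μ i j - d.singNegOne (α y t) i j / (μ + 1) - B y t i j)
      (d.upper (-1)) (fun μ => μ + 1)) {g₁ g₂ κ : ℂ}
    (hbr : ∀ μ ∈ d.good,
      bracket (twist phaseT (M y t) (fun μ => Matrix.of fun i j => deriv (fun s => M y s μ i j) t))
        (M y t) 1 1 μ = (g₂ / (μ - I) + g₁ / (μ + I)) + κ / (μ - 1) - κ / (μ + 1)) :
    κ = I * beta2 d.c α B y t := by
  have := d.neBot_upper (s := -1) (by simp)
  have h0 : Tendsto (fun μ : ℂ => μ + 1) (d.upper (-1)) (𝓝 0) := by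
    simpa using d.tendsto_sub_upper (-1)
  obtain ⟨hf, hf'⟩ := hM.tendsto_neg_one h hB hMB 0
  obtain ⟨hg, hg'⟩ := hM.tendsto_neg_one h hB hMB 1
  simp only [cons_val_zero, cons_val_one, cons_val_fin_one] at hf hf' hg hg'
  set σ : ℂ := I * α y t / 2 with hσ
  set σ' : ℂ := I * (deriv (fun s => α y s) t : ℝ) / 2 with hσ'
  have hl : Tendsto (fun μ => (μ + 1) * bracket (twist phaseT (M y t)
      (fun μ => Matrix.of fun i j => deriv (fun s => M y s μ i j) t)) (M y t) 1 1 μ)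
      (d.upper (-1)) (𝓝 (-κ)) := by
    have hc : ContinuousAt (fun μ : ℂ => (μ + 1) * (g₂ / (μ - I) + g₁ / (μ + I) + κ / (μ - 1)) - κ)
        (-1) := by
      have h1 : (-1 : ℂ) ≠ I := I_not_mem.2.2.symm
      have h2 : (-1 : ℂ) ≠ -I := fun h => I_not_mem.2.1 (neg_injective h).symm
      have h3 : (-1 : ℂ) - 1 ≠ 0 := by norm_num
      have h4 := continuousAt_pole_sum (a := g₂) (b := g₁) h1 h2
      have h5 : ContinuousAt (fun μ : ℂ => κ / (μ - 1)) (-1) := by fun_prop (disch := assumption)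
      exact ((continuousAt_id.add continuousAt_const).mul (h4.add h5)).sub continuousAt_const
    have h1 := hc.tendsto.mono_left (nhdsWithin_le_nhds (s := {μ | 0 < μ.im} \ d.Γ))
    rw [neg_add_cancel, zero_mul, zero_sub] at h1
    refine h1.congr' ?_
    filter_upwards [d.eventually_good_upper (s := -1) (by simp)] with μ hμ
    have h6 : μ + 1 ≠ 0 := fun h => (d.good_ne hμ).2.2.1 (eq_neg_of_add_eq_zero_left h)
    rw [hbr μ hμ]
    field_simp
  have hr := ((((hg.const_mul (σ' * d.c)).sub (hf.const_mul σ')).add (hf'.const_mul σ)).sub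
    (hg'.const_mul (σ * d.c))).add (h0.mul ((hf'.mul hg).sub (hg'.mul hf)))
  have hq := (tendsto_phaseT_div (d := d)).mul (((h0.mul hf).add_const (σ * d.c)).mul
    ((h0.mul hg).add_const σ))
  have h1 := tendsto_nhds_unique hl (((hr.sub (hq.const_mul 2))).congr' (by
    filter_upwards [d.eventually_good_upper (s := -1) (by simp)] with μ hμ
    have h6 : μ + 1 ≠ 0 := fun h => (d.good_ne hμ).2.2.1 (eq_neg_of_add_eq_zero_left h)
    rw [bracket_twist_same]
    simp only [bracket, of_apply]
    field_simp
    ring))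
  rw [beta2]
  rw [hσ, hσ'] at h1
  linear_combination -h1 - (I * d.c * (α y t : ℂ) ^ 2 / 2) * I_sq

/-! ### The `t`-equation -/

theorem IsSolution.t_equation (hΩ : IsOpen Ω) (hM : d.IsSolution Ω α M) (h : (y, t) ∈ Ω)
    {A₀ A₁ : Mat} (hA : ∀ i j, (fun μ => M y t μ i j - A₀ i j - A₁ i j * (μ - I))
      =O[𝓝[d.Γᶜ] I] (fun μ => (μ - I) ^ 2)) :
    (A₀ 0 0 ≠ 0 ∧ A₀ = !![A₀ 0 0, 0; 0, (A₀ 0 0)⁻¹] ∧ A₁ = !![0, A₁ 0 1; A₁ 1 0, 0]) ∧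
      ∀ B : ℝ → ℝ → Mat, (∀ i j, PartialDiff Ω (fun y t => B y t i j)) →
        (∀ i j, IsBigOC1 Ω
          (fun y t μ => M y t μ i j - d.singNegOne (α y t) i j / (μ + 1) - B y t i j)
          (d.upper (-1)) (fun μ => μ + 1)) →
        ∀ μ ∈ d.spectralSet, ∀ i j, HasDerivAt (fun s : ℝ => psi M y s μ i j)
          ((laxV (beta2 d.c α B y t) (2 * A₁ 0 1 * A₀ 0 0)
            (-(2 * A₁ 1 0 * (A₀ 0 0)⁻¹)) μ * psi M y t μ) i j) t := by
  have hA' := fun i j => (hA i j).mono (nhdsWithin_mono I d.testSet_subset_compl)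
  obtain ⟨h01, h10, h00, h11⟩ := (hM.isFrame h).expansion_I hA'
  have hlim := fun i j => (tendsto_of_expansion (hA' i j)).1
  have hdet : A₀ 0 0 * A₀ 1 1 = 1 := by
    have := d.neBot_testSet I
    have h1 := ((hlim 0 0).mul (hlim 1 1)).sub ((hlim 0 1).mul (hlim 1 0))
    have h2 := tendsto_nhds_unique (tendsto_const_nhds.congr' (by
      filter_upwards [self_mem_nhdsWithin] with μ hμ
      exact (hM.det_eq_one h hμ.2).symm)) h1
    rw [h01, zero_mul, sub_zero] at h2
    exact h2.symm
  have hne : A₀ 0 0 ≠ 0 := left_ne_zero_of_mul_eq_one hdet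
  have hinv : A₀ 1 1 = (A₀ 0 0)⁻¹ := eq_inv_of_mul_eq_one_right hdet
  refine ⟨⟨hne, ?_, ?_⟩, ?_⟩
  · rw [← hinv, Matrix.eta_fin_two A₀, h01, h10]
    rfl
  · rw [Matrix.eta_fin_two A₁, h00, h11]
    rfl
  · intro B hB hMB μ hμ i j
    have hg := mem_good_of_mem_spectralSet hμ
    set g₁ : ℂ := 2 * A₁ 0 1 * A₀ 0 0 with hg₁
    set g₂ : ℂ := -(2 * A₁ 1 0 * (A₀ 0 0)⁻¹) with hg₂
    have key := hM.bracket_t hΩ h hA' (g₁ := g₁) (g₂ := g₂) (by rw [hg₁]; ring)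
      (by rw [hg₂, hinv]; ring) rfl
    have hκ := hM.coeff_eq_beta2 h hB hMB fun μ hμ => (key μ hμ).2.2.2
    rw [hκ] at key
    obtain ⟨b00, b01, b10, b11⟩ := key μ hg
    refine hasDerivAt_psi_entry (m := fun s => M y s) (p := fun s => phase y s μ)
      (fun i j => ((hM.diff_param i j μ (mem_dom_of_mem_good hg j)) y t h).2.hasDerivAt)
      (hasDerivAt_phase_t y t μ) (fun i j => ?_) i j
    refine (sum_bracket_mul (W := twist phaseT (M y t)
      (fun μ => Matrix.of fun i j => deriv (fun s => M y s μ i j) t))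
      (hM.det_eq_one h hg) i j).symm.trans ?_
    rw [Fin.sum_univ_two, laxV_eq]
    fin_cases i
    · simp only [Fin.zero_eta, b00, b01, of_apply, cons_val', cons_val_zero, cons_val_one,
        cons_val_fin_one]
      ring
    · simp only [Fin.mk_one, b10, b11, of_apply, cons_val', cons_val_zero, cons_val_one,
        cons_val_fin_one]
      ring

end RHData

end MCH

theorem mainTheorem5 (d : MCH.RHData) (Ω : Set (ℝ × ℝ)) (hΩ : IsOpen Ω)
    (α : ℝ → ℝ → ℝ) (M : ℝ → ℝ → ℂ → MCH.Mat) (hM : d.IsSolution Ω α M) :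
    -- the `y`-equation
    (∀ y t, (y, t) ∈ Ω → ∀ M₁ : MCH.Mat,
      (∀ i j, (fun μ => M y t μ i j - (1 : MCH.Mat) i j - M₁ i j / μ)
        =O[d.atInfty] (fun μ => (μ ^ 2)⁻¹)) →
      (M₁ 1 0 = M₁ 0 1 ∧ M₁ 1 1 = -M₁ 0 0) ∧
      ∀ μ ∈ d.spectralSet, ∀ i j,
        HasDerivAt (fun s : ℝ => MCH.psi M s t μ i j)
          ((MCH.laxU (-(M₁ 0 1) / 2) μ * MCH.psi M y t μ) i j) y) ∧
    -- the `t`-equation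
    (∀ y t, (y, t) ∈ Ω → ∀ A₀ A₁ : MCH.Mat,
      (∀ i j, (fun μ => M y t μ i j - A₀ i j - A₁ i j * (μ - I))
        =O[𝓝[d.Γᶜ] I] (fun μ => (μ - I) ^ 2)) →
      (A₀ 0 0 ≠ 0 ∧ A₀ = !![A₀ 0 0, 0; 0, (A₀ 0 0)⁻¹] ∧ A₁ = !![0, A₁ 0 1; A₁ 1 0, 0]) ∧
      ∀ B : ℝ → ℝ → MCH.Mat,
        (∀ i j, MCH.PartialDiff Ω (fun y t => B y t i j)) →
        (∀ i j, MCH.IsBigOC1 Ω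
          (fun y t μ => M y t μ i j - d.singNegOne (α y t) i j / (μ + 1) - B y t i j)
          (d.upper (-1)) (fun μ => μ + 1)) →
        ∀ μ ∈ d.spectralSet, ∀ i j,
          HasDerivAt (fun s : ℝ => MCH.psi M y s μ i j)
            ((MCH.laxV (MCH.beta2 d.c α B y t) (2 * A₁ 0 1 * A₀ 0 0)
              (-(2 * A₁ 1 0 * (A₀ 0 0)⁻¹)) μ * MCH.psi M y t μ) i j) t) :=
  ⟨fun _ _ h _ hM₁ => hM.y_equation hΩ h hM₁, fun _ _ h _ _ hA => hM.t_equation hΩ h hA⟩
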